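/- **Definitions.** A temporal graph $\mathcal G=(V,E_1,\dots,E_T)$ consists of a finite vertex set $V$ and $T$ edge sets $E_1,\dots,E_T\subseteq\binom V2$; its underlying graph is $(V,\bigcup_{t}E_t)$. A temporal $(s,z)$-path of length $\ell$ is a sequence of transitions $(v_{i-1},v_i,t_i)_{i=1}^{\ell}$ with $v_0=s$, $v_\ell=z$, $\{v_{i-1},v_i\}\in E_{t_i}$ for all $i$, $t_1<t_2<\dots<t_\ell$, and pairwise distinct $v_0,\dots,v_\ell$. It occupies $v_i$ during $[t_i,t_{i+1}]$ for $1\le i\le \ell-1$, $v_0$ during $[t_1,t_1]$, and $v_\ell$ during $[t_\ell,t_\ell]$ (a path of length $0$ occupies nothing). Two temporal paths temporally intersect if there are a vertex $v$ and two intervals $[a_1,b_1]$, $[a_2,b_2]$ with $[a_1,b_1]\cap[a_2,b_2]\neq\emptyset$ such that the first path occupies $v$ during $[a_1,b_1]$ and the second occupies $v$ during $[a_2,b_2]$; otherwise they are temporally disjoint. *Temporally Disjoint Paths*: given a temporal graph $\mathcal G=(V,E_1,\dots,E_T)$ and a finite multiset $S$ of source-sink pairs from $V\times V$, are there pairwise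 temporally disjoint temporal $(s_i,z_i)$-paths for all $(s_i,z_i)\in S$ (one path for every occurrence of a pair)? A parameterized problem is a set of yes-instances among instances $(x,k)$, where $x$ is a word over $\{0,1\}$ and $k\in\mathbb N_0$ is the parameter. A parameterized reduction from $L$ to $L'$ maps every instance $(x,k)$ of $L$ to an instance $(x',k')$ of $L'$ such that $(x,k)\in L\iff(x',k')\in L'$, $k'\le g(k)$, and $(x',k')$ is computed in time $f(k)\cdot(|x|+1)^{O(1)}$ (on a random access machine with addition and subtraction and uniform cost), for some computable functions $f,g$. The class $W[1]$ consists of all parameterized problems that have, for some constant $d$, a parameterized reduction to the following problem: given a Boolean circuit $C$ of depth at most $d$ and weft at most $1$ (every path from an input to the output contains at most one gate of fan-in greater than two) and $k\in\mathbb N_0$, with parameter $k$, does $C$ have a satisfying assignment that sets exactly $k$ inputs to true? A parameterized problem is $W[1]$-hard if every problem in $W[1]$ has a parameterized reduction to it. **Theorem.** Temporally Disjoint Paths is $W[1]$-hard when parameterized by the combination of the number $|S|$ of source-sink pairs (counted with multiplicity) and the vertex cover number of the underlying graph, that is, by the sum of these two numbers. -/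

import Mathlib

/-! ### Words -/

/-- A finite sequence of natural numbers, written over `{0,1}` with every number in unary: each
`n` becomes `1ⁿ0`.  (All numbers that occur in the encodings below are bounded by the size of the
encoded object, so this is polynomially equivalent to writing them in binary.) -/
def unaryWord (l : List ℕ) : List Bool :=
  l.flatMap fun n => List.replicate n true ++ [false]

theorem unaryWord_injective : Function.Injective unaryWord := by
  have key : ∀ (m n : ℕ) (a b : List Bool),
      List.replicate m true ++ false :: a = List.replicate n true ++ false :: b →
        m = n ∧ a = b := by
    intro m
    induction m with
    | zero =>
      intro n a b h
      cases n with
      | zero => simpa using h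
      | succ n => simp [List.replicate_succ] at h
    | succ m ih =>
      intro n a b h
      cases n with
      | zero => simp [List.replicate_succ] at h
      | succ n =>
        have := ih n a b (by simpa [List.replicate_succ] using h)
        exact ⟨by omega, this.2⟩
  intro l
  induction l with
  | nil =>
    intro l' h
    cases l' with
    | nil => rfl
    | cons b l' => simp [unaryWord] at h
  | cons a l ih =>
    intro l' h
    cases l' with
    | nil => simp [unaryWord] at h
    | cons b l' =>
      have h' := key a b (unaryWord l) (unaryWord l') (by simpa [unaryWord] using h)
      rw [h'.1, ih h'.2]

/-! ### Random access machines

Time is measured on a random access machine: finitely many registers and finitely many unbounded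
arrays (a program mentions only finitely many), all holding natural numbers, with constants,
addition, truncated subtraction, indirect reading and writing, tests for zero, and the uniform
cost measure.  The control flow is structured. -/

/-- Memory contents: `reg x` is register `x`, and `arr a i` is cell `i` of array `a`. -/
@[ext] structure Memory where
  reg : ℕ → ℕ
  arr : ℕ → ℕ → ℕ

namespace Memory

def setReg (m : Memory) (x v : ℕ) : Memory :=
  { m with reg := Function.update m.reg x v }

def setArr (m : Memory) (a i v : ℕ) : Memory :=
  { m with arr := Function.update m.arr a (Function.update (m.arr a) i v) }

end Memory

/-- Programs; the arguments are names of registers (`x y z`), names of arrays (`a`) and numerical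
constants (`c`). -/
inductive Prog where
  /-- `x := c` -/
  | const (x c : ℕ)
  /-- `x := y + z` -/
  | add (x y z : ℕ)
  /-- `x := max (y - z) 0` -/
  | sub (x y z : ℕ)
  /-- `x := a[y]` -/
  | load (x a y : ℕ)
  /-- `a[y] := z` -/
  | store (a y z : ℕ)
  /-- first `p`, then `q` -/
  | seq (p q : Prog)
  /-- if `x = 0` then `p` else `q` -/
  | ifZero (x : ℕ) (p q : Prog)
  /-- while `x ≠ 0` do `p` -/
  | while (x : ℕ) (p : Prog)

/-- `Runs p m t m'`: started on memory `m`, the program `p` halts after exactly `t` steps with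
memory `m'`.  Every elementary instruction and every test counts as one step. -/
inductive Runs : Prog → Memory → ℕ → Memory → Prop
  | const (x c : ℕ) (m : Memory) : Runs (.const x c) m 1 (m.setReg x c)
  | add (x y z : ℕ) (m : Memory) : Runs (.add x y z) m 1 (m.setReg x (m.reg y + m.reg z))
  | sub (x y z : ℕ) (m : Memory) : Runs (.sub x y z) m 1 (m.setReg x (m.reg y - m.reg z))
  | load (x a y : ℕ) (m : Memory) : Runs (.load x a y) m 1 (m.setReg x (m.arr a (m.reg y)))
  | store (a y z : ℕ) (m : Memory) : Runs (.store a y z) m 1 (m.setArr a (m.reg y) (m.reg z))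
  | seq {p q : Prog} {m m' m'' : Memory} {t t' : ℕ} :
      Runs p m t m' → Runs q m' t' m'' → Runs (.seq p q) m (t + t') m''
  | ifZero_zero {x : ℕ} {p q : Prog} {m m' : Memory} {t : ℕ} :
      m.reg x = 0 → Runs p m t m' → Runs (.ifZero x p q) m (t + 1) m'
  | ifZero_nonzero {x : ℕ} {p q : Prog} {m m' : Memory} {t : ℕ} :
      m.reg x ≠ 0 → Runs q m t m' → Runs (.ifZero x p q) m (t + 1) m'
  | while_zero {x : ℕ} {p : Prog} {m : Memory} :
      m.reg x = 0 → Runs (.while x p) m 1 m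
  | while_nonzero {x : ℕ} {p : Prog} {m m' m'' : Memory} {t t' : ℕ} :
      m.reg x ≠ 0 → Runs p m t m' → Runs (.while x p) m' t' m'' →
        Runs (.while x p) m (t + t' + 1) m''

/-- The contents of cell `i` of an array that holds the word `w`: `1` for the letter `false`, `2`
for the letter `true`, and `0` (blank) behind the end of `w`. -/
def wordCell (w : List Bool) (i : ℕ) : ℕ :=
  match w[i]? with
  | none => 0
  | some false => 1
  | some true => 2

/-- The initial memory on input `(w, k)`: array `0` holds the word `w`, register `0` holds the
number `k`, everything else is `0`. -/
def inputMemory (w : List Bool) (k : ℕ) : Memory where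
  reg x := if x = 0 then k else 0
  arr a i := if a = 0 then wordCell w i else 0

/-- `m` represents the output `(w, k)`: array `0` holds the word `w` up to its first blank, and
register `0` holds the number `k`. -/
def Memory.Outputs (m : Memory) (w : List Bool) (k : ℕ) : Prop :=
  (∀ i ≤ w.length, m.arr 0 i = wordCell w i) ∧ m.reg 0 = k

/-! ### Parameterized problems and parameterized reductions -/

/-- A parameterized problem: every instance is presented to algorithms as a pair `(x, k)` of a
word `x` over `{0,1}` and its parameter `k`, and `yes` singles out the yes-instances.  The language
in `Σ* × ℕ` is the set of the pairs `code i` with `yes i`. -/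
structure ParamProblem where
  Inst : Type
  code : Inst → List Bool × ℕ
  code_injective : Function.Injective code
  yes : Inst → Prop

namespace ParamProblem

/-- An arbitrary set of pairs `(x, k)` as a parameterized problem. -/
def ofLanguage (L : Set (List Bool × ℕ)) : ParamProblem where
  Inst := List Bool × ℕ
  code i := i
  code_injective _ _ h := h
  yes i := i ∈ L

/-- The word that presents an instance. -/
def word (P : ParamProblem) (i : P.Inst) : List Bool := (P.code i).1

/-- The parameter of an instance. -/
def param (P : ParamProblem) (i : P.Inst) : ℕ := (P.code i).2

end ParamProblem

/-- `R`, as a map between presented instances `(x, k) ↦ (x', k')`, is computed by some program in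
`f(k) · |x|^O(1)` time, for a computable function `f`.  (`|x| + 1` instead of `|x|` takes care of
the empty word.) -/
def FPTComputable (P Q : ParamProblem) (R : P.Inst → Q.Inst) : Prop :=
  ∃ (p : Prog) (f : ℕ → ℕ) (c : ℕ), Computable f ∧
    ∀ i : P.Inst, ∃ (t : ℕ) (m : Memory),
      Runs p (inputMemory (P.word i) (P.param i)) t m ∧
      t ≤ f (P.param i) * ((P.word i).length + 1) ^ c ∧
      m.Outputs (Q.word (R i)) (Q.param (R i))

/-- There is a parameterized (many-one) reduction from `P` to `Q`. -/
def FPTReducible (P Q : ParamProblem) : Prop :=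
  ∃ R : P.Inst → Q.Inst,
    (∀ i, P.yes i ↔ Q.yes (R i)) ∧
    (∃ g : ℕ → ℕ, Computable g ∧ ∀ i, Q.param (R i) ≤ g (P.param i)) ∧
    FPTComputable P Q R

/-! ### Boolean circuits and the W-hierarchy -/

/-- A gate of a circuit; the nodes of a circuit are numbered, and a gate lists the numbers of the
nodes that it takes its inputs from. -/
inductive Gate where
  | not (j : ℕ)
  | and (l : List ℕ)
  | or (l : List ℕ)

namespace Gate

def children : Gate → List ℕ
  | not j => [j]
  | and l => l
  | or l => l

/-- A gate that may stand as node number `N`: it reads only nodes with smaller numbers, each of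
them once, and conjunctions and disjunctions have fan-in at least two. -/
def Valid (N : ℕ) (g : Gate) : Prop :=
  (∀ j ∈ g.children, j < N) ∧ g.children.Nodup ∧
    match g with
    | not _ => True
    | and l => 2 ≤ l.length
    | or l => 2 ≤ l.length

/-- The value of a gate, given the values of all earlier nodes. -/
def eval : Gate → (ℕ → Bool) → Bool
  | not j, v => !v j
  | and l, v => l.all v
  | or l, v => l.any v

def code : Gate → List ℕ
  | not j => [0, j]
  | and l => 1 :: l.length :: l
  | or l => 2 :: l.length :: l

end Gate

/-- A Boolean circuit: a directed acyclic graph in topological order, whose nodes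
`0, …, inputs - 1` are the input nodes, whose node `inputs + p` is the `p`-th gate, and whose
output node is `out`. -/
@[ext] structure Circuit where
  inputs : ℕ
  gates : List Gate
  out : ℕ
  valid : ∀ (p : ℕ) (h : p < gates.length), gates[p].Valid (inputs + p)
  out_lt : out < inputs + gates.length

namespace Circuit

/-- Computes a value for every node, in topological order: `init` lists the values of the input
nodes, and `step` gives the value of a gate from the values of the earlier nodes.  (`d` is a
default value that is never read.)  Returns the value of the output node. -/
def fold {α : Type} (C : Circuit) (d : α) (init : List α) (step : Gate → (ℕ → α) → α) : α :=
  (C.gates.foldl (fun vals g => vals ++ [step g fun j => vals.getD j d]) init).getD C.out d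

/-- The output of the circuit on the assignment `x`. -/
def eval (C : Circuit) (x : Fin C.inputs → Bool) : Bool :=
  C.fold false (List.ofFn x) Gate.eval

/-- The depth: the maximal number of edges on a path from an input node to the output node. -/
def depth (C : Circuit) : ℕ :=
  C.fold 0 (List.replicate C.inputs 0) fun g v => (g.children.map v).foldr max 0 + 1

/-- The weft: the maximal number of large gates (gates of fan-in more than two) on a path from an
input node to the output node. -/
def weft (C : Circuit) : ℕ :=
  C.fold 0 (List.replicate C.inputs 0) fun g v =>
    (g.children.map v).foldr max 0 + if 2 < g.children.length then 1 else 0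

def code (C : Circuit) : List ℕ :=
  C.inputs :: C.out :: C.gates.flatMap Gate.code

theorem code_injective : Function.Injective code := by
  have key : ∀ l l' : List Gate, l.flatMap Gate.code = l'.flatMap Gate.code → l = l' := by
    intro l
    induction l with
    | nil =>
      intro l' h
      cases l' with
      | nil => rfl
      | cons b l' => cases b <;> simp [Gate.code] at h
    | cons a l ih =>
      intro l' h
      cases l' with
      | nil => cases a <;> simp [Gate.code] at h
      | cons b l' =>
        cases a <;> cases b <;> simp [Gate.code] at h
        · rw [h.1, ih _ h.2]
        · have := List.append_inj h.2 h.1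
          rw [this.1, ih _ this.2]
        · have := List.append_inj h.2 h.1
          rw [this.1, ih _ this.2]
  intro C D h
  simp only [code, List.cons.injEq] at h
  exact Circuit.ext h.1 (key _ _ h.2.2) h.2.1

end Circuit

/-- Weighted circuit satisfiability for circuits of weft at most `t` and depth at most `d`: given
`(C, k)`, with parameter `k`, does `C` have a satisfying assignment of weight exactly `k`? -/
def weightedCircuitSat (t d : ℕ) : ParamProblem where
  Inst := { I : Circuit × ℕ // I.1.weft ≤ t ∧ I.1.depth ≤ d }
  code I := (unaryWord I.1.1.code, I.1.2)
  code_injective := by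
    rintro ⟨⟨C, k⟩, hC⟩ ⟨⟨D, l⟩, hD⟩ h
    simp only [Prod.mk.injEq] at h
    obtain rfl := Circuit.code_injective (unaryWord_injective h.1)
    obtain rfl := h.2
    rfl
  yes I := ∃ x : Fin I.1.1.inputs → Bool,
    (Finset.univ.filter fun i => x i = true).card = I.1.2 ∧ I.1.1.eval x = true

/-- The class `W[t]`: all parameterized problems that, for some constant `d`, have a parameterized
reduction to weighted satisfiability of circuits of weft at most `t` and depth at most `d`. -/
def InW (t : ℕ) (P : ParamProblem) : Prop :=
  ∃ d : ℕ, FPTReducible P (weightedCircuitSat t d)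

/-- `W[t]`-hardness under parameterized reductions. -/
def WHard (t : ℕ) (Q : ParamProblem) : Prop :=
  ∀ P : ParamProblem, InW t P → FPTReducible P Q

/-! ### Temporal graphs -/

/-- A temporal graph on the vertex set `V`: a finite sequence of edge sets.  The time steps
`1, …, T` are numbered `0, …, T - 1` here. -/
structure TemporalGraph (V : Type) where
  lifetime : ℕ
  layer : Fin lifetime → SimpleGraph V

namespace TemporalGraph

variable {V : Type}

/-- The underlying graph: all edges that appear in some time step. -/
def underlying (G : TemporalGraph V) : SimpleGraph V := ⨆ t, G.layer t

/-- A temporal `(s, z)`-path with `len` transitions `(vert i, vert (i + 1), time i)`, at strictly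
increasing time steps, visiting no vertex twice. -/
structure TPath (G : TemporalGraph V) (s z : V) where
  len : ℕ
  vert : Fin (len + 1) → V
  time : Fin len → Fin G.lifetime
  vert_zero : vert 0 = s
  vert_last : vert (Fin.last len) = z
  adj : ∀ i : Fin len, (G.layer (time i)).Adj (vert i.castSucc) (vert i.succ)
  time_strictMono : StrictMono time
  vert_injective : Function.Injective vert

namespace TPath

variable {G : TemporalGraph V} {s z s' z' : V}

/-- `P.Occupies v a b`: the path `P` occupies the vertex `v` during the time interval `[a, b]`.
An inner vertex is occupied from the arrival to the departure of the path, the first vertex only at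
the time of the first transition, the last vertex only at the time of the last transition. -/
inductive Occupies (P : G.TPath s z) : V → Fin G.lifetime → Fin G.lifetime → Prop
  | first (h : 0 < P.len) : Occupies P (P.vert 0) (P.time ⟨0, h⟩) (P.time ⟨0, h⟩)
  | inner (i : ℕ) (h : i + 1 < P.len) :
      Occupies P (P.vert ⟨i + 1, by omega⟩) (P.time ⟨i, by omega⟩) (P.time ⟨i + 1, h⟩)
  | last (h : 0 < P.len) :
      Occupies P (P.vert (Fin.last P.len))
        (P.time ⟨P.len - 1, by omega⟩) (P.time ⟨P.len - 1, by omega⟩)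

/-- Two temporal paths temporally intersect if they occupy a common vertex during time intervals
that are not disjoint. -/
def Intersects (P : G.TPath s z) (Q : G.TPath s' z') : Prop :=
  ∃ (v : V) (a₁ b₁ a₂ b₂ : Fin G.lifetime),
    P.Occupies v a₁ b₁ ∧ Q.Occupies v a₂ b₂ ∧ (Set.Icc a₁ b₁ ∩ Set.Icc a₂ b₂).Nonempty

end TPath

end TemporalGraph

/-- An instance of Temporally Disjoint Paths: a temporal graph with finitely many vertices and a
finite multiset of source-sink pairs, given as a list. -/
structure TDPInstance where
  n : ℕ
  graph : TemporalGraph (Fin n)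
  pairs : List (Fin n × Fin n)

namespace TDPInstance

/-- There are pairwise temporally disjoint temporal paths, one for every occurrence of a pair in
the multiset. -/
def Solvable (I : TDPInstance) : Prop :=
  ∃ P : ∀ i : Fin I.pairs.length, I.graph.TPath I.pairs[i].1 I.pairs[i].2,
    ∀ i j, i ≠ j → ¬ (P i).Intersects (P j)

/-- The number of source-sink pairs plus the vertex cover number of the underlying graph. -/
noncomputable def param (I : TDPInstance) : ℕ :=
  I.pairs.length + I.graph.underlying.vertexCoverNum.toNat

open Classical in
/-- The adjacency matrices of all layers, row by row. -/
noncomputable def matrices (I : TDPInstance) : List ℕ :=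
  (List.finRange I.graph.lifetime).flatMap fun t =>
    (List.finRange I.n).flatMap fun u =>
      (List.finRange I.n).map fun v => if (I.graph.layer t).Adj u v then 1 else 0

noncomputable def code (I : TDPInstance) : List ℕ :=
  I.n :: I.graph.lifetime :: (I.matrices ++ I.pairs.flatMap fun p => [p.1.val, p.2.val])

theorem code_injective : Function.Injective code := by
  have key : ∀ {α : Type} (f g : α → List ℕ) (l : List α),
      (∀ a, (f a).length = (g a).length) → l.flatMap f = l.flatMap g →
        ∀ a ∈ l, f a = g a := by
    intro α f g l hl
    induction l with
    | nil => simp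
    | cons b l ih =>
      intro h a ha
      simp only [List.flatMap_cons] at h
      have h' := List.append_inj h (hl b)
      rcases List.mem_cons.1 ha with rfl | ha
      · exact h'.1
      · exact ih h'.2 a ha
  have key2 : ∀ {n : ℕ} (l l' : List (Fin n × Fin n)),
      (l.flatMap fun p => [p.1.val, p.2.val]) = (l'.flatMap fun p => [p.1.val, p.2.val]) →
        l = l' := by
    intro n l
    induction l with
    | nil =>
      intro l' h
      cases l' with
      | nil => rfl
      | cons b l' => simp at h
    | cons a l ih =>
      intro l' h
      cases l' with
      | nil => simp at h
      | cons b l' =>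
        simp only [List.flatMap_cons, List.cons_append, List.nil_append, List.cons.injEq] at h
        rw [Prod.ext (Fin.ext h.1) (Fin.ext h.2.1), ih _ h.2.2]
  rintro ⟨n, ⟨T, E⟩, S⟩ ⟨n', ⟨T', E'⟩, S'⟩ h
  simp only [code, List.cons.injEq] at h
  obtain ⟨rfl, rfl, h⟩ := h
  have h' := List.append_inj h (by simp [matrices])
  obtain rfl := key2 _ _ h'.2
  have hE : E = E' := by
    funext t
    ext u v
    have h1 := key _ _ _ (by simp) h'.1 t (List.mem_finRange t)
    have h2 := key _ _ _ (by simp) h1 u (List.mem_finRange u)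
    have h3 := List.map_inj_left.1 h2 v (List.mem_finRange v)
    by_cases hE : (E t).Adj u v <;> by_cases hE' : (E' t).Adj u v <;> simp_all
  rw [hE]

end TDPInstance

/-- Temporally Disjoint Paths, parameterized by the combination of the number of source-sink pairs
and the vertex cover number of the underlying graph. -/
noncomputable def temporallyDisjointPaths : ParamProblem where
  Inst := TDPInstance
  code I := (unaryWord I.code, I.param)
  code_injective _ _ h :=
    TDPInstance.code_injective (unaryWord_injective (congrArg Prod.fst h))
  yes := TDPInstance.Solvable

/-! Fix a depth bound `d` and put `q = 2 ^ d`. A circuit of weft at most one with `n` inputs and a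
weight `k` are turned into a binary constraint satisfaction problem whose number of variables
depends only on `k` and `d`, and this is turned into disjoint paths. For fixed `d` the whole
translation takes polynomial time, so it can follow any parameterized reduction to weighted circuit
satisfiability (`FPTReducible.trans_emits`).

Circuits. A child of a large gate has weft zero, so it depends on boundedly many inputs. If a large
gate has its controlling value, one child certifies this; otherwise the other value can be assumed
by default. Hence every assignment has a set `S` of at most `q` inputs such that an evaluation with
defaults, `Guess`, finds the true output from any correct partial information that covers `S`
(`Circuit.Model.exists_guess`). The evaluation need not know `S`, and additional correct information
does no harm.

Constraints. Let `0 = x 0 < x 1 < … < x k < x (k + 1) = n + 1` list the true inputs, shifted by one,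
between two sentinels. One position shows that an input is true, two consecutive positions show that
it is false, so a tuple of `2 * q` positions covers `S`. There is a right variable for each of the
`K = (k + 2) ^ (2 * q)` tuples; its value lists the inputs at these positions. The left variables `i
> 0` hold `x i` and make the tuples consistent. The left variable `0` names one more tuple with its
value, and its constraint with a right variable demands that the circuit evaluates to true on the
joint information of both tuples. A satisfying assignment meets all constraints if the left variable
`0` names a covering tuple. Conversely, some right variable covers `S`, and its constraint forces
the output to be true (`CSP.exists_isSolution_iff`).

Paths. Each variable has two vertices `inn` and `out` and a selecting path that blocks first `inn`
and then `out` for a whole epoch. Only by waiting at a gap vertex between them does it leave a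
window in which both are free, and the time of the window is the value of the variable. For every
pair of variables a verifying path crosses the left variable in the first epoch and the right one in
the second, through a link vertex that exists only for compatible values and is reachable only at
their times. Thus all paths can be disjoint exactly if the constraints are satisfiable
(`CSP.tdp_solvable_iff`). There are `2 * K + K * K` paths, and the vertices `inn` and `out` form a
minimum vertex cover of size `4 * K`, so the parameter depends only on `k` and `d`. -/

/-! ### Polynomial bounds -/

/-- `b` is bounded by a polynomial. -/
def PolyBdd (b : ℕ → ℕ) : Prop := ∃ c, ∀ N, b N ≤ (N + 2) ^ c

namespace PolyBdd

variable {b b' : ℕ → ℕ}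

theorem mono (h : PolyBdd b') (hb : ∀ N, b N ≤ b' N) : PolyBdd b :=
  h.imp fun _ hc N => (hb N).trans (hc N)

/-- The base `N + 2` is at least two for every `N`, so raising the exponent absorbs constants as
well as sums. -/
theorem const (n : ℕ) : PolyBdd fun _ => n :=
  ⟨n, fun N => Nat.lt_two_pow_self.le.trans (Nat.pow_le_pow_left (by omega) n)⟩

theorem id : PolyBdd fun N => N := ⟨1, fun N => by simp⟩

theorem add (h : PolyBdd b) (h' : PolyBdd b') : PolyBdd fun N => b N + b' N := by
  obtain ⟨c, hc⟩ := h
  obtain ⟨c', hc'⟩ := h'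
  refine ⟨max c c' + 1, fun N => ?_⟩
  have h1 : (N + 2) ^ c ≤ (N + 2) ^ max c c' := Nat.pow_le_pow_right (by omega) (le_max_left _ _)
  have h2 : (N + 2) ^ c' ≤ (N + 2) ^ max c c' := Nat.pow_le_pow_right (by omega) (le_max_right _ _)
  rw [pow_succ]
  have := hc N
  have := hc' N
  nlinarith

theorem mul (h : PolyBdd b) (h' : PolyBdd b') : PolyBdd fun N => b N * b' N := by
  obtain ⟨c, hc⟩ := h
  obtain ⟨c', hc'⟩ := h'
  exact ⟨c + c', fun N => by rw [pow_add]; exact Nat.mul_le_mul (hc N) (hc' N)⟩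

theorem pow (h : PolyBdd b) (n : ℕ) : PolyBdd fun N => b N ^ n := by
  induction n with
  | zero => simpa using const 1
  | succ n ih => simpa only [pow_succ] using ih.mul h

theorem pow_add_two (h : PolyBdd b) (n : ℕ) : PolyBdd fun N => (b N + 2) ^ n :=
  (h.add (const 2)).pow n

theorem base (n : ℕ) : PolyBdd fun N => (N + 2) ^ n := id.pow_add_two n

theorem max (h : PolyBdd b) (h' : PolyBdd b') : PolyBdd fun N => max (b N) (b' N) :=
  (h.add h').mono fun N => by omega

end PolyBdd

/-! ### Runs -/

namespace Memory

theorem reg_setReg (m : Memory) (x v r : ℕ) :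
    (m.setReg x v).reg r = if r = x then v else m.reg r := by
  simp [setReg, Function.update_apply]

@[simp] theorem arr_setReg (m : Memory) (x v : ℕ) : (m.setReg x v).arr = m.arr := rfl

@[simp] theorem reg_setArr (m : Memory) (a i v : ℕ) : (m.setArr a i v).reg = m.reg := rfl

theorem arr_setArr (m : Memory) (a i v b j : ℕ) :
    (m.setArr a i v).arr b j = if b = a ∧ j = i then v else m.arr b j := by
  unfold setArr
  by_cases h : b = a
  · subst h; simp [Function.update_apply]
  · simp [h]

end Memory

/-- `j` counts the completed rounds. The loop register need not be a counter: it only has to vanish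
exactly when `n` rounds are done, as in scanning a word for its first blank. -/
theorem Runs.while_of_invariant' {x n T : ℕ} {p : Prog} {Inv : ℕ → Memory → Prop}
    (hx : ∀ j m, Inv j m → (m.reg x = 0 ↔ n ≤ j))
    (step : ∀ j < n, ∀ m, Inv j m → ∃ t m', Runs p m t m' ∧ Inv (j + 1) m' ∧ t ≤ T)
    {m : Memory} (h0 : Inv 0 m) :
    ∃ t m', Runs (.while x p) m t m' ∧ Inv n m' ∧ t ≤ n * (T + 1) + 1 := by
  have key : ∀ r j m, j + r = n → Inv j m →
      ∃ t m', Runs (.while x p) m t m' ∧ Inv n m' ∧ t ≤ r * (T + 1) + 1 := by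
    intro r
    induction r with
    | zero =>
      intro j m hj hI
      obtain rfl : j = n := by omega
      exact ⟨1, m, .while_zero ((hx _ _ hI).2 le_rfl), hI, by omega⟩
    | succ r ih =>
      intro j m hj hI
      obtain ⟨t, m', hr, hI', ht⟩ := step j (by omega) m hI
      obtain ⟨t', m'', hr', hI'', ht'⟩ := ih (j + 1) m' (by omega) hI'
      refine ⟨_, m'', .while_nonzero (fun h => ?_) hr hr', hI'', ?_⟩
      · have := (hx _ _ hI).1 h
        omega
      · rw [Nat.succ_mul]
        omega
  exact key n 0 m (by omega) h0

theorem Runs.while_of_invariant {x n T : ℕ} {p : Prog} {Inv : ℕ → Memory → Prop}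
    (step : ∀ j < n, ∀ m, Inv j m → m.reg x = n - j →
      ∃ t m', Runs p m t m' ∧ Inv (j + 1) m' ∧ m'.reg x = n - (j + 1) ∧ t ≤ T)
    {m : Memory} (h0 : Inv 0 m) (hx : m.reg x = n) :
    ∃ t m', Runs (.while x p) m t m' ∧ Inv n m' ∧ t ≤ n * (T + 1) + 1 := by
  obtain ⟨t, m', h1, h2, h3⟩ := Runs.while_of_invariant' (x := x) (n := n) (T := T) (p := p)
    (Inv := fun j m => Inv j m ∧ m.reg x = n - j) (fun j m h => by omega)
    (fun j hj m h => by
      obtain ⟨t, m', h1, h2, h3, h4⟩ := step j hj m h.1 h.2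
      exact ⟨t, m', h1, ⟨h2, h3⟩, h4⟩) ⟨h0, by omega⟩
  exact ⟨t, m', h1, h2.1, h3⟩

/-! ### Values that can be kept in memory -/

/-- Types whose elements can be kept in registers and in (constant) arrays.  Array `0` is never
used for this purpose. -/
class Storable (α : Type) where
  Loc : Type
  Within : Loc → ℕ → ℕ → Prop
  Holds : Loc → α → Memory → Prop
  Bdd : ℕ → α → Prop
  within_mono : ∀ {l : Loc} {lo hi hi' : ℕ}, Within l lo hi → hi ≤ hi' → Within l lo hi'
  holds_frame : ∀ {l : Loc} {lo hi : ℕ} {x : α} {m m' : Memory}, Within l lo hi →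
    (∀ r, lo ≤ r → r < hi → m'.reg r = m.reg r) → (∀ a, a ≠ 0 → m'.arr a = m.arr a) →
    Holds l x m → Holds l x m'
  bdd_mono : ∀ {N N' : ℕ} {x : α}, N ≤ N' → Bdd N x → Bdd N' x

open Storable

instance : Storable ℕ where
  Loc := ℕ
  Within l lo hi := lo ≤ l ∧ l < hi
  Holds l x m := m.reg l = x
  Bdd N x := x ≤ N
  within_mono h h' := ⟨h.1, h.2.trans_le h'⟩
  holds_frame h hr _ hx := (hr _ h.1 h.2).trans hx
  bdd_mono h h' := h'.trans h

open Classical in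
noncomputable instance : Storable Prop where
  Loc := ℕ
  Within l lo hi := lo ≤ l ∧ l < hi
  Holds l x m := m.reg l = if x then 1 else 0
  Bdd _ _ := True
  within_mono h h' := ⟨h.1, h.2.trans_le h'⟩
  holds_frame h hr _ hx := (hr _ h.1 h.2).trans hx
  bdd_mono _ h := h

/-- Arrays serve as read-only input, since the programs of `PolyTime` leave all arrays unchanged. A
location therefore needs no interval and only has to avoid array `0`, where the output is written.
-/
instance : Storable (ℕ → ℕ) where
  Loc := ℕ
  Within l _ _ := l ≠ 0
  Holds l x m := m.arr l = x
  Bdd N x := ∀ i, x i ≤ N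
  within_mono h _ := h
  holds_frame h _ ha hx := (ha _ h).trans hx
  bdd_mono h h' i := (h' i).trans h

instance {α β : Type} [Storable α] [Storable β] : Storable (α × β) where
  Loc := Loc α × Loc β
  Within l lo hi := Within l.1 lo hi ∧ Within l.2 lo hi
  Holds l x m := Holds l.1 x.1 m ∧ Holds l.2 x.2 m
  Bdd N x := Bdd N x.1 ∧ Bdd N x.2
  within_mono h h' := ⟨within_mono h.1 h', within_mono h.2 h'⟩
  holds_frame h hr ha hx := ⟨holds_frame h.1 hr ha hx.1, holds_frame h.2 hr ha hx.2⟩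
  bdd_mono h h' := ⟨bdd_mono h h'.1, bdd_mono h h'.2⟩

/-! ### Polynomial time functions on stored values -/

section PolyTime

variable {α β γ δ : Type} [Storable α] [Storable β] [Storable γ] [Storable δ]

/-- `f` is computed by a program in polynomial time and its values are polynomially bounded.
Whatever memory the program is allowed to use, it does not change the registers below `hi`. -/
@[fun_prop]
def PolyTime (f : α → β) : Prop :=
  (∃ c, ∀ N x, Bdd N x → Bdd ((N + 2) ^ c) (f x)) ∧
  ∃ c, ∀ (l : Loc α) (lo hi : ℕ), lo ≤ hi → Within l lo hi →
    ∃ (p : Prog) (l' : Loc β) (hi' : ℕ), hi ≤ hi' ∧ Within l' lo hi' ∧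
      ∀ N x m, Bdd N x → Holds l x m → ∃ t m', Runs p m t m' ∧ Holds l' (f x) m' ∧
        (∀ r < hi, m'.reg r = m.reg r) ∧ m'.arr = m.arr ∧ t ≤ (N + 2) ^ c

namespace PolyTime

theorem of_bounds {f : α → β} (b b' : ℕ → ℕ) (hb : PolyBdd b) (hb' : PolyBdd b')
    (h : ∀ N x, Bdd N x → Bdd (b N) (f x))
    (h' : ∀ (l : Loc α) (lo hi : ℕ), lo ≤ hi → Within l lo hi →
      ∃ (p : Prog) (l' : Loc β) (hi' : ℕ), hi ≤ hi' ∧ Within l' lo hi' ∧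
        ∀ N x m, Bdd N x → Holds l x m → ∃ t m', Runs p m t m' ∧ Holds l' (f x) m' ∧
          (∀ r < hi, m'.reg r = m.reg r) ∧ m'.arr = m.arr ∧ t ≤ b' N) : PolyTime f := by
  obtain ⟨c, hc⟩ := hb
  obtain ⟨c', hc'⟩ := hb'
  refine ⟨⟨c, fun N x hx => bdd_mono (hc N) (h N x hx)⟩, c', fun l lo hi hlo hl => ?_⟩
  obtain ⟨p, l', hi', h1, h2, h3⟩ := h' l lo hi hlo hl
  refine ⟨p, l', hi', h1, h2, fun N x m hN hm => ?_⟩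
  obtain ⟨t, m', r1, r2, r3, r4, r5⟩ := h3 N x m hN hm
  exact ⟨t, m', r1, r2, r3, r4, r5.trans (hc' N)⟩

theorem of_loc {f : α → β} (g : Loc α → Loc β) (h : ∀ N x, Bdd N x → Bdd N (f x))
    (hw : ∀ l lo hi, Within l lo hi → Within (g l) lo hi)
    (hh : ∀ l x m, Holds l x m → Holds (g l) (f x) m) : PolyTime f := by
  refine of_bounds (fun N => N) (fun _ => 1) .id (.const 1) h fun l lo hi hlo hl =>
    -- There is no empty program; clearing the scratch register `hi`, which holds no stored value,
    -- takes its place.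
    ⟨.const hi 0, g l, hi, le_rfl, hw _ _ _ hl, fun N x m hN hm =>
      ⟨1, _, .const _ _ _, ?_, fun r hr => ?_, rfl, le_rfl⟩⟩
  · refine hh _ _ _ (holds_frame (m := m) hl (fun r _ hr => ?_) (fun _ _ => rfl) hm)
    rw [Memory.reg_setReg, if_neg hr.ne]
  · rw [Memory.reg_setReg, if_neg hr.ne]

@[fun_prop]
theorem id : PolyTime fun x : α => x :=
  of_loc (fun l => l) (fun _ _ h => h) (fun _ _ _ h => h) fun _ _ _ h => h

theorem fst' : PolyTime fun x : α × β => x.1 :=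
  of_loc (fun l => l.1) (fun _ _ h => h.1) (fun _ _ _ h => h.1) fun _ _ _ h => h.1

theorem snd' : PolyTime fun x : α × β => x.2 :=
  of_loc (fun l => l.2) (fun _ _ h => h.2) (fun _ _ _ h => h.2) fun _ _ _ h => h.2

@[fun_prop]
theorem comp {g : β → γ} {f : α → β} (hg : PolyTime g) (hf : PolyTime f) :
    PolyTime fun x => g (f x) := by
  obtain ⟨⟨a, ha⟩, a', ha'⟩ := hf
  obtain ⟨⟨b, hb⟩, b', hb'⟩ := hg
  refine of_bounds (fun N => ((N + 2) ^ a + 2) ^ b)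
    (fun N => (N + 2) ^ a' + ((N + 2) ^ a + 2) ^ b') ((PolyBdd.base a).pow_add_two b)
    ((PolyBdd.base a').add ((PolyBdd.base a).pow_add_two b'))
    (fun N x hx => hb _ _ (ha _ _ hx)) fun l lo hi hlo hl => ?_
  obtain ⟨p, l1, h1, hh1, hw1, hp⟩ := ha' l lo hi hlo hl
  obtain ⟨q, l2, h2, hh2, hw2, hq⟩ := hb' l1 lo h1 (hlo.trans hh1) hw1
  refine ⟨.seq p q, l2, h2, hh1.trans hh2, hw2, fun N x m hN hm => ?_⟩
  obtain ⟨t, m', r1, r2, r3, r4, r5⟩ := hp N x m hN hm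
  obtain ⟨t', m'', s1, s2, s3, s4, s5⟩ := hq _ _ m' (ha _ _ hN) r2
  exact ⟨_, m'', .seq r1 s1, s2, fun r hr => (s3 r (hr.trans_le hh1)).trans (r3 r hr),
    s4.trans r4, add_le_add r5 s5⟩

@[fun_prop]
theorem fst {f : α → β × γ} (hf : PolyTime f) : PolyTime fun x => (f x).1 := fst'.comp hf

@[fun_prop]
theorem snd {f : α → β × γ} (hf : PolyTime f) : PolyTime fun x => (f x).2 := snd'.comp hf

-- Registers are allocated upwards: the second program works above the limit `h1` reported by the
-- first, so it destroys neither the first result nor the common argument.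
@[fun_prop]
theorem pair {f : α → β} {g : α → γ} (hf : PolyTime f) (hg : PolyTime g) :
    PolyTime fun x => (f x, g x) := by
  obtain ⟨⟨a, ha⟩, a', ha'⟩ := hf
  obtain ⟨⟨b, hb⟩, b', hb'⟩ := hg
  refine of_bounds (fun N => max ((N + 2) ^ a) ((N + 2) ^ b))
    (fun N => (N + 2) ^ a' + (N + 2) ^ b') ((PolyBdd.base a).max (.base b))
    ((PolyBdd.base a').add (.base b'))
    (fun N x hx => ⟨bdd_mono (le_max_left _ _) (ha _ _ hx),
      bdd_mono (le_max_right _ _) (hb _ _ hx)⟩) fun l lo hi hlo hl => ?_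
  obtain ⟨p, l1, h1, hh1, hw1, hp⟩ := ha' l lo hi hlo hl
  obtain ⟨q, l2, h2, hh2, hw2, hq⟩ := hb' l lo h1 (hlo.trans hh1) (within_mono hl hh1)
  refine ⟨.seq p q, (l1, l2), h2, hh1.trans hh2, ⟨within_mono hw1 hh2, hw2⟩,
    fun N x m hN hm => ?_⟩
  obtain ⟨t, m', r1, r2, r3, r4, r5⟩ := hp N x m hN hm
  obtain ⟨t', m'', s1, s2, s3, s4, s5⟩ := hq _ _ m' hN
    (holds_frame hl (fun r _ hr => r3 r hr) (fun a _ => by rw [r4]) hm)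
  exact ⟨_, m'', .seq r1 s1, ⟨holds_frame hw1 (fun r _ hr => s3 r hr) (fun a _ => by rw [s4]) r2,
    s2⟩, fun r hr => (s3 r (hr.trans_le hh1)).trans (r3 r hr), s4.trans r4, add_le_add r5 s5⟩

@[fun_prop]
theorem const (n : ℕ) : PolyTime fun _ : α => n :=
  of_bounds (fun _ => n) (fun _ => 1) (.const n) (.const 1) (fun _ _ _ => le_rfl)
    fun l lo hi hlo hl => ⟨.const hi n, hi, hi + 1, by omega, ⟨by omega, by omega⟩,
      fun N x m hN hm => ⟨1, _, .const _ _ _, (Memory.reg_setReg ..).trans (if_pos rfl),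
        fun r hr => by rw [Memory.reg_setReg, if_neg hr.ne], rfl, le_rfl⟩⟩

/-- A single instruction that writes register `hi`. -/
theorem of_instruction {f : α → ℕ} (b : ℕ → ℕ) (hb : PolyBdd b)
    (h : ∀ N x, Bdd N x → f x ≤ b N) (e : ℕ → Loc α → Prog)
    (he : ∀ n l x m, Holds l x m → Runs (e n l) m 1 (m.setReg n (f x))) : PolyTime f :=
  of_bounds b (fun _ => 1) hb (.const 1) h
    fun l lo hi hlo hl => ⟨e hi l, hi, hi + 1, by omega, ⟨by omega, by omega⟩,
      fun N x m hN hm => ⟨1, _, he hi l x m hm, (Memory.reg_setReg ..).trans (if_pos rfl),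
        fun r hr => by rw [Memory.reg_setReg, if_neg hr.ne], rfl, le_rfl⟩⟩

theorem add' : PolyTime fun x : ℕ × ℕ => x.1 + x.2 :=
  of_instruction (fun N => N + N) (PolyBdd.id.add .id)
    (fun _ _ h => add_le_add h.1 h.2) (fun n l => .add n l.1 l.2)
    fun n l x m h => by rw [← h.1, ← h.2]; exact .add ..

theorem sub' : PolyTime fun x : ℕ × ℕ => x.1 - x.2 :=
  of_instruction (fun N => N) .id
    (fun _ _ h => (Nat.sub_le _ _).trans h.1) (fun n l => .sub n l.1 l.2)
    fun n l x m h => by rw [← h.1, ← h.2]; exact .sub ..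

theorem load' : PolyTime fun x : (ℕ → ℕ) × ℕ => x.1 x.2 :=
  of_instruction (fun N => N) .id
    (fun _ _ h => h.1 _) (fun n l => .load n l.1 l.2)
    fun n l x m h => by rw [← h.1, ← h.2]; exact .load ..

@[fun_prop]
theorem add {f g : α → ℕ} (hf : PolyTime f) (hg : PolyTime g) : PolyTime fun x => f x + g x :=
  add'.comp (hf.pair hg)

@[fun_prop]
theorem sub {f g : α → ℕ} (hf : PolyTime f) (hg : PolyTime g) : PolyTime fun x => f x - g x :=
  sub'.comp (hf.pair hg)

theorem load {f : α → ℕ → ℕ} {g : α → ℕ} (hf : PolyTime f) (hg : PolyTime g) :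
    PolyTime fun x => f x (g x) :=
  load'.comp (hf.pair hg)

theorem toNat {p : α → Prop} [∀ x, Decidable (p x)] (hp : PolyTime p) :
    PolyTime fun x => if p x then 1 else 0 := by
  have h : PolyTime fun q : Prop => @ite ℕ q (Classical.dec q) 1 0 :=
    of_bounds (fun _ => 1) (fun _ => 1) (.const 1) (.const 1)
      (fun N x _ => by
        change @ite ℕ x (Classical.dec x) 1 0 ≤ 1
        split_ifs <;> omega)
      fun l lo hi hlo hl => ⟨.const hi 0, l, hi, le_rfl, hl, fun N x m hN hm =>
        ⟨1, _, .const _ _ _, by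
          change (m.setReg hi 0).reg l = _
          rw [Memory.reg_setReg, if_neg (ne_of_lt hl.2)]
          exact hm,
          fun r hr => by rw [Memory.reg_setReg, if_neg hr.ne], rfl, le_rfl⟩⟩
  convert h.comp hp

/-- A predicate is decidable in polynomial time if its indicator function is. -/
theorem of_toNat {p : α → Prop} {f : α → ℕ} (hf : PolyTime f)
    (h : ∀ x, f x = @ite ℕ (p x) (Classical.dec _) 1 0) : PolyTime p := by
  obtain ⟨-, c, hc⟩ := hf
  refine ⟨⟨0, fun _ _ _ => trivial⟩, c, fun l lo hi hlo hl => ?_⟩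
  obtain ⟨q, l', hi', h1, h2, h3⟩ := hc l lo hi hlo hl
  refine ⟨q, l', hi', h1, h2, fun N x m hN hm => ?_⟩
  obtain ⟨t, m', r1, r2, r3⟩ := h3 N x m hN hm
  exact ⟨t, m', r1, Eq.trans r2 (h x), r3⟩

/-- A loop whose intermediate values are polynomially bounded. -/
theorem natRec {n f : α → ℕ} {g : α → ℕ → ℕ → ℕ} (hn : PolyTime n) (hf : PolyTime f)
    (hg : PolyTime fun p : (α × ℕ) × ℕ => g p.1.1 p.1.2 p.2) (b : ℕ → ℕ) (hb : PolyBdd b)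
    (h : ∀ N x, Bdd N x → ∀ i ≤ n x, Nat.rec (motive := fun _ => ℕ) (f x) (g x) i ≤ b N) :
    PolyTime fun x => Nat.rec (motive := fun _ => ℕ) (f x) (g x) (n x) := by
  obtain ⟨⟨a, ha⟩, cn, hcn⟩ := hn
  obtain ⟨-, cf, hcf⟩ := hf
  obtain ⟨-, cg, hcg⟩ := hg
  -- A common bound for the three arguments of the loop body: the input, the round number and the
  -- accumulator.
  let B : ℕ → ℕ := fun N => N + (N + 2) ^ a + b N
  have hB : PolyBdd B := (PolyBdd.id.add (.base a)).add hb
  refine of_bounds b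
    (fun N => (N + 2) ^ cn + ((N + 2) ^ cf + (5 + ((N + 2) ^ a * ((B N + 2) ^ cg + 3 + 1) + 1))))
    hb ((PolyBdd.base cn).add ((PolyBdd.base cf).add ((PolyBdd.const 5).add (((PolyBdd.base a).mul
      (((hB.pow_add_two cg).add (.const 3)).add (.const 1))).add (.const 1)))))
    (fun N x hx => h N x hx _ le_rfl) fun l lo hi hlo hl => ?_
  obtain ⟨pn, rn, h1, hh1, hw1, hpn⟩ := hcn l lo hi hlo hl
  obtain ⟨pf, rf, h2, hh2, hw2, hpf⟩ := hcf l lo h1 (hlo.trans hh1) (within_mono hl hh1)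
  obtain ⟨pg, rg, h3, hh3, hw3, hpg⟩ := hcg ((l, h2), h2 + 1) lo (h2 + 5) (by omega)
    ⟨⟨within_mono hl (by omega), (⟨by omega, by omega⟩ : lo ≤ h2 ∧ h2 < h2 + 5)⟩,
      (⟨by omega, by omega⟩ : lo ≤ h2 + 1 ∧ h2 + 1 < h2 + 5)⟩
  change ℕ at rn rf rg
  change lo ≤ rn ∧ rn < h1 at hw1
  change lo ≤ rf ∧ rf < h2 at hw2
  -- Register `h2` is the round number, `h2 + 1` the accumulator, `h2 + 2` the number of rounds
  -- left; `h2 + 3` and `h2 + 4` hold one and zero. Adding zero copies a register.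
  refine ⟨.seq pn <| .seq pf <| .seq (.seq (.const h2 0) <| .seq (.const (h2 + 3) 1) <|
    .seq (.const (h2 + 4) 0) <| .seq (.add (h2 + 1) rf h2) (.add (h2 + 2) rn h2)) <|
    .while (h2 + 2) <| .seq pg <| .seq (.add (h2 + 1) rg (h2 + 4)) <|
      .seq (.add h2 h2 (h2 + 3)) (.sub (h2 + 2) (h2 + 2) (h2 + 3)),
    h2 + 1, h2 + 5, by omega, (⟨by omega, by omega⟩ : lo ≤ h2 + 1 ∧ h2 + 1 < h2 + 5),
    fun N x m hN hm => ?_⟩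
  obtain ⟨t1, m1, r1, v1, k1, a1, b1⟩ := hpn N x m hN hm
  obtain ⟨t2, m2, r2, v2, k2, a2, b2⟩ := hpf N x m1 hN
    (holds_frame hl (fun r _ hr => k1 r hr) (fun a _ => by rw [a1]) hm)
  change m1.reg rn = n x at v1
  change m2.reg rf = f x at v2
  have hnx : n x ≤ (N + 2) ^ a := ha N x hN
  have v1' : m2.reg rn = n x := (k2 _ hw1.2).trans v1
  let Inv : ℕ → Memory → Prop := fun j m' =>
    (∀ r < hi, m'.reg r = m.reg r) ∧ m'.arr = m.arr ∧ m'.reg h2 = j ∧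
      m'.reg (h2 + 1) = Nat.rec (motive := fun _ => ℕ) (f x) (g x) j ∧ m'.reg (h2 + 3) = 1 ∧
      m'.reg (h2 + 4) = 0
  obtain ⟨t3, m3, r3, ⟨i1, i2, i3, i4, i5, i6⟩, b3⟩ :=
    Runs.while_of_invariant (x := h2 + 2) (n := n x) (T := (B N + 2) ^ cg + 3)
      (p := .seq pg <| .seq (.add (h2 + 1) rg (h2 + 4)) <|
        .seq (.add h2 h2 (h2 + 3)) (.sub (h2 + 2) (h2 + 2) (h2 + 3))) (Inv := Inv)
      (fun j hj m' hI hx => by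
        obtain ⟨i1, i2, i3, i4, i5, i6⟩ := hI
        have hbj := h N x hN j hj.le
        obtain ⟨t, m'', r, v, k, a', b'⟩ := hpg (B N) ((x, j), Nat.rec (f x) (g x) j) m'
          ⟨⟨bdd_mono (by simp only [B]; omega) hN,
            (by simp only [B]; omega : j ≤ B N)⟩, hbj.trans (by simp only [B]; omega)⟩
          ⟨⟨holds_frame hl (fun r _ hr => i1 r hr) (fun a _ => by rw [i2]) hm, i3⟩, i4⟩
        change m''.reg rg = g x j _ at v
        refine ⟨_, _, .seq r (.seq (.add ..) (.seq (.add ..) (.sub ..))), ⟨fun r hr => ?_, ?_, ?_,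
          ?_, ?_, ?_⟩, ?_, by omega⟩
        · simp only [Memory.reg_setReg]
          rw [if_neg (by omega), if_neg (by omega), if_neg (by omega), k r (by omega), i1 r hr]
        · exact a'.trans i2
        · simp [Memory.reg_setReg, k, i3, i5]
        · simp [Memory.reg_setReg, k, v, i6]
        · simp [Memory.reg_setReg, k, i5]
        · simp [Memory.reg_setReg, k, i6]
        · simp only [Memory.reg_setReg]
          simp [k, hx, i5]
          omega)
      (m := ((((m2.setReg h2 0).setReg (h2 + 3) 1).setReg (h2 + 4) 0).setReg (h2 + 1)
        (f x)).setReg (h2 + 2) (n x))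
      ⟨fun r hr => by
        simp only [Memory.reg_setReg]
        rw [if_neg (by omega), if_neg (by omega), if_neg (by omega), if_neg (by omega),
          if_neg (by omega), k2 r (by omega), k1 r hr],
        by simp [a2, a1], by simp [Memory.reg_setReg], by simp [Memory.reg_setReg],
        by simp [Memory.reg_setReg], by simp [Memory.reg_setReg]⟩
      (by simp [Memory.reg_setReg])
  have e1 : ((((m2.setReg h2 0).setReg (h2 + 3) 1).setReg (h2 + 4) 0).reg rf +
      (((m2.setReg h2 0).setReg (h2 + 3) 1).setReg (h2 + 4) 0).reg h2) = f x := by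
    simp only [Memory.reg_setReg]
    rw [if_neg (by omega), if_neg (by omega), if_neg (by omega), v2]
    simp
  have e2 : (((((m2.setReg h2 0).setReg (h2 + 3) 1).setReg (h2 + 4) 0).setReg (h2 + 1)
        (f x)).reg rn +
      ((((m2.setReg h2 0).setReg (h2 + 3) 1).setReg (h2 + 4) 0).setReg (h2 + 1)
        (f x)).reg h2) = n x := by
    simp only [Memory.reg_setReg]
    rw [if_neg (by omega), if_neg (by omega), if_neg (by omega), if_neg (by omega), v1']
    simp
  refine ⟨_, m3, .seq r1 (.seq r2 (.seq (.seq (.const ..) (.seq (.const ..) (.seq (.const ..)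
    (.seq (.add ..) (.add ..))))) (by rw [e1, e2]; exact r3))), i4, i1, i2, ?_⟩
  · have : n x * ((B N + 2) ^ cg + 3 + 1) ≤ (N + 2) ^ a * ((B N + 2) ^ cg + 3 + 1) :=
      Nat.mul_le_mul_right _ hnx
    omega

end PolyTime

end PolyTime

/-! ### Arithmetic, case distinctions and bounded quantifiers -/

namespace PolyTime

variable {α β γ δ : Type} [Storable α] [Storable β] [Storable γ] [Storable δ]

theorem sum {n : α → ℕ} {g : α → ℕ → ℕ} (hn : PolyTime n)
    (hg : PolyTime fun p : α × ℕ => g p.1 p.2) :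
    PolyTime fun x => ∑ i ∈ Finset.range (n x), g x i := by
  have e : ∀ x k, ∑ i ∈ Finset.range k, g x i =
      Nat.rec (motive := fun _ => ℕ) 0 (fun i acc => acc + g x i) k := by
    intro x k
    induction k with
    | zero => rfl
    | succ k ih => rw [Finset.sum_range_succ, ih]
  simp only [e]
  have hg' := hg
  have hn' := hn
  obtain ⟨⟨a, ha⟩, -⟩ := hn'
  obtain ⟨⟨b, hb⟩, -⟩ := hg'
  refine natRec (g := fun x i acc => acc + g x i) hn (const 0)
    (snd'.add (hg.comp fst')) (fun N => (N + 2) ^ a * (N + (N + 2) ^ a + 2) ^ b)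
    ((PolyBdd.base a).mul ((PolyBdd.id.add (.base a)).pow_add_two b)) fun N x hx i hi => ?_
  rw [← e]
  have hnx : n x ≤ (N + 2) ^ a := ha N x hx
  refine (Finset.sum_le_card_nsmul _ _ ((N + (N + 2) ^ a + 2) ^ b) fun j hj => ?_).trans ?_
  · rw [Finset.mem_range] at hj
    exact hb (N + (N + 2) ^ a) (x, j) ⟨bdd_mono (by omega) hx, (by omega : j ≤ _)⟩
  · rw [Finset.card_range, smul_eq_mul]
    exact Nat.mul_le_mul_right _ (hi.trans hnx)

theorem iterate {n f : α → ℕ} {g : α → ℕ → ℕ} (hn : PolyTime n) (hf : PolyTime f)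
    (hg : PolyTime fun p : α × ℕ => g p.1 p.2) (b : ℕ → ℕ) (hb : PolyBdd b)
    (h : ∀ N x, Bdd N x → ∀ i ≤ n x, (g x)^[i] (f x) ≤ b N) :
    PolyTime fun x => (g x)^[n x] (f x) := by
  have e : ∀ x k, (g x)^[k] (f x) =
      Nat.rec (motive := fun _ => ℕ) (f x) (fun _ acc => g x acc) k := by
    intro x k
    induction k with
    | zero => rfl
    | succ k ih => rw [Function.iterate_succ_apply', ih]
  simp only [e] at h ⊢
  exact natRec (g := fun x _ acc => g x acc) hn hf
    (hg.comp ((fst'.comp fst').pair snd')) b hb h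

-- Multiplication is repeated addition, as the machine has no instruction for it.
@[fun_prop]
theorem mul {f g : α → ℕ} (hf : PolyTime f) (hg : PolyTime g) : PolyTime fun x => f x * g x := by
  simpa using sum (g := fun x _ => g x) hf (hg.comp fst')

theorem pow_const {f : α → ℕ} (hf : PolyTime f) (n : ℕ) : PolyTime fun x => f x ^ n := by
  induction n with
  | zero => simpa using const 1
  | succ n ih => simpa only [pow_succ] using ih.mul hf

@[fun_prop]
theorem lt {f g : α → ℕ} (hf : PolyTime f) (hg : PolyTime g) : PolyTime fun x => f x < g x := by
  refine of_toNat (f := fun x => 1 - (1 - (g x - f x))) (by fun_prop) fun x => ?_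
  split_ifs <;> omega

@[fun_prop]
theorem not {p : α → Prop} (hp : PolyTime p) : PolyTime fun x => ¬ p x := by
  classical
  refine of_toNat (f := fun x => 1 - if p x then 1 else 0) ((const 1).sub hp.toNat) fun x => ?_
  split_ifs <;> rfl

@[fun_prop]
theorem and {p q : α → Prop} (hp : PolyTime p) (hq : PolyTime q) :
    PolyTime fun x => p x ∧ q x := by
  classical
  refine of_toNat (f := fun x => (if p x then 1 else 0) * if q x then 1 else 0)
    (hp.toNat.mul hq.toNat) fun x => ?_
  by_cases h : p x <;> by_cases h' : q x <;> simp [h, h']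

@[fun_prop]
theorem or {p q : α → Prop} (hp : PolyTime p) (hq : PolyTime q) :
    PolyTime fun x => p x ∨ q x := by
  have : (fun x => p x ∨ q x) = fun x => ¬ (¬ p x ∧ ¬ q x) := by
    funext x
    exact propext (by tauto)
  rw [this]
  fun_prop

@[fun_prop]
theorem imp {p q : α → Prop} (hp : PolyTime p) (hq : PolyTime q) :
    PolyTime fun x => p x → q x := by
  have : (fun x => p x → q x) = fun x => ¬ p x ∨ q x := by
    funext x
    exact propext imp_iff_not_or
  rw [this]
  fun_prop

@[fun_prop]
theorem le {f g : α → ℕ} (hf : PolyTime f) (hg : PolyTime g) : PolyTime fun x => f x ≤ g x := by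
  simp only [← not_lt]
  fun_prop

@[fun_prop]
theorem eq {f g : α → ℕ} (hf : PolyTime f) (hg : PolyTime g) : PolyTime fun x => f x = g x := by
  simp only [le_antisymm_iff]
  fun_prop

theorem bex {n : α → ℕ} {p : α → ℕ → Prop} (hn : PolyTime n)
    (hp : PolyTime fun y : α × ℕ => p y.1 y.2) : PolyTime fun x => ∃ i < n x, p x i := by
  classical
  refine of_toNat (f := fun x => 1 - (1 - ∑ i ∈ Finset.range (n x), if p x i then 1 else 0))
    ((const 1).sub ((const 1).sub (hn.sum hp.toNat))) fun x => ?_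
  by_cases h : ∃ i < n x, p x i
  · obtain ⟨i, hi, hpi⟩ := h
    rw [if_pos ⟨i, hi, hpi⟩]
    have := Finset.single_le_sum (f := fun i => if p x i then 1 else 0) (fun _ _ => Nat.zero_le _)
      (Finset.mem_range.2 hi)
    simp only [if_pos hpi] at this
    omega
  · rw [if_neg h, Finset.sum_eq_zero fun i hi => if_neg fun hpi =>
      h ⟨i, Finset.mem_range.1 hi, hpi⟩]
    rfl

theorem ball {n : α → ℕ} {p : α → ℕ → Prop} (hn : PolyTime n)
    (hp : PolyTime fun y : α × ℕ => p y.1 y.2) : PolyTime fun x => ∀ i < n x, p x i := by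
  have : (fun x => ∀ i < n x, p x i) = fun x => ¬ ∃ i < n x, ¬ p x i := by
    funext x
    exact propext (by push Not; rfl)
  rw [this]
  exact (hn.bex hp.not).not

theorem ite {p : α → Prop} [∀ x, Decidable (p x)] {f g : α → ℕ} (hp : PolyTime p)
    (hf : PolyTime f) (hg : PolyTime g) : PolyTime fun x => if p x then f x else g x := by
  have : (fun x => if p x then f x else g x) =
      fun x => (if p x then 1 else 0) * f x + (1 - if p x then 1 else 0) * g x := by
    funext x
    split_ifs <;> simp
  rw [this]
  have := hp.toNat
  fun_prop

@[fun_prop]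
theorem div {f g : α → ℕ} (hf : PolyTime f) (hg : PolyTime g) : PolyTime fun x => f x / g x := by
  -- The quotient counts the positive multiples of `g x` up to `f x`; the condition `0 < g x` makes
  -- division by zero give zero.
  have : (fun x => f x / g x) = fun x => ∑ i ∈ Finset.range (f x),
      if 0 < g x ∧ (i + 1) * g x ≤ f x then 1 else 0 := by
    funext x
    rcases Nat.eq_zero_or_pos (g x) with h | h
    · simp [h]
    · rw [← Finset.card_filter]
      have : {i ∈ Finset.range (f x) | 0 < g x ∧ (i + 1) * g x ≤ f x} =
          Finset.range (f x / g x) := by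
        ext i
        rw [Finset.mem_filter, Finset.mem_range, Finset.mem_range, ← Nat.succ_le_iff (n := _ / _),
          Nat.le_div_iff_mul_le h]
        refine ⟨fun h' => h'.2.2, fun h' => ⟨?_, h, h'⟩⟩
        exact (Nat.le_mul_of_pos_right _ h).trans h'
      rw [this, Finset.card_range]
  rw [this]
  refine sum hf (toNat ?_)
  fun_prop

@[fun_prop]
theorem mod {f g : α → ℕ} (hf : PolyTime f) (hg : PolyTime g) : PolyTime fun x => f x % g x := by
  have : (fun x => f x % g x) = fun x => f x - g x * (f x / g x) := by
    funext x
    have := Nat.mod_add_div (f x) (g x)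
    omega
  rw [this]
  fun_prop

end PolyTime

/-! ### Programs that write a list of numbers -/

/-- Array `0` begins with the word `w`, and register `ptr` points behind it. -/
def Memory.Wrote (m : Memory) (ptr : ℕ) (w : List Bool) : Prop :=
  m.reg ptr = w.length ∧ ∀ i < w.length, m.arr 0 i = wordCell w i

theorem wordCell_append_left {w w' : List Bool} {i : ℕ} (h : i < w.length) :
    wordCell (w ++ w') i = wordCell w i := by
  unfold wordCell
  rw [List.getElem?_append_left h]

theorem wordCell_length (w : List Bool) : wordCell w w.length = 0 := by
  simp [wordCell]

theorem wordCell_eq_zero {w : List Bool} {i : ℕ} : wordCell w i = 0 ↔ w.length ≤ i := by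
  unfold wordCell
  rw [← List.getElem?_eq_none_iff]
  rcases w[i]? with _ | _ | _ <;> simp

theorem wordCell_le_two (w : List Bool) (i : ℕ) : wordCell w i ≤ 2 := by
  unfold wordCell
  rcases w[i]? with _ | _ | _ <;> simp

theorem Memory.Wrote.snoc {m m' : Memory} {ptr : ℕ} {w : List Bool} (h : m.Wrote ptr w) (b : Bool)
    (hr : m'.reg ptr = w.length + 1)
    (ha : ∀ i, m'.arr 0 i = if i = w.length then (if b then 2 else 1) else m.arr 0 i) :
    m'.Wrote ptr (w ++ [b]) := by
  refine ⟨by simp [hr], fun i hi => ?_⟩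
  rw [ha]
  split_ifs with h1 h2
  · subst h1 h2; simp [wordCell]
  · subst h1; simp only [Bool.not_eq_true] at h2; simp [wordCell, h2]
  · rw [List.length_append, List.length_singleton] at hi
    rw [wordCell_append_left (by omega), h.2 i (by omega)]

section Emits

variable {α β : Type} [Storable α] [Storable β]

/-- There is a polynomial time program that appends the word for the list `f x` to the output. -/
def Emits (f : α → List ℕ) : Prop :=
  ∃ b, PolyBdd b ∧ ∀ (l : Loc α) (ptr lo hi : ℕ), ptr < lo → lo ≤ hi → Within l lo hi →
    ∃ p : Prog, ∀ N x m w, Bdd N x → Holds l x m → m.Wrote ptr w →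
      ∃ t m', Runs p m t m' ∧ m'.Wrote ptr (w ++ unaryWord (f x)) ∧
        (∀ r < hi, r ≠ ptr → m'.reg r = m.reg r) ∧ (∀ a, a ≠ 0 → m'.arr a = m.arr a) ∧ t ≤ b N

namespace Emits

theorem append {f g : α → List ℕ} (hf : Emits f) (hg : Emits g) :
    Emits fun x => f x ++ g x := by
  obtain ⟨b, hb, hf⟩ := hf
  obtain ⟨b', hb', hg⟩ := hg
  refine ⟨fun N => b N + b' N, hb.add hb', fun l ptr lo hi h1 h2 h3 => ?_⟩
  obtain ⟨p, hp⟩ := hf l ptr lo hi h1 h2 h3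
  obtain ⟨q, hq⟩ := hg l ptr lo hi h1 h2 h3
  refine ⟨.seq p q, fun N x m w hN hm hw => ?_⟩
  obtain ⟨t, m', r1, w1, k1, a1, b1⟩ := hp N x m w hN hm hw
  obtain ⟨t', m'', r2, w2, k2, a2, b2⟩ := hq N x m' _ hN
    (holds_frame h3 (fun r hr hr' => k1 r hr' (by omega)) a1 hm) w1
  refine ⟨_, m'', .seq r1 r2, ?_, fun r hr hr' => (k2 r hr hr').trans (k1 r hr hr'),
    fun a ha => (a2 a ha).trans (a1 a ha), add_le_add b1 b2⟩
  simpa [unaryWord] using w2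

theorem comp {f : β → List ℕ} {g : α → β} (hf : Emits f) (hg : PolyTime g) :
    Emits fun x => f (g x) := by
  obtain ⟨b, ⟨c, hc⟩, hf⟩ := hf
  obtain ⟨⟨a, ha⟩, a', hg⟩ := hg
  refine ⟨fun N => (N + 2) ^ a' + ((N + 2) ^ a + 2) ^ c,
    (PolyBdd.base a').add ((PolyBdd.base a).pow_add_two c), fun l ptr lo hi h1 h2 h3 => ?_⟩
  obtain ⟨p, l', hi', hh, hw', hp⟩ := hg l lo hi h2 h3
  obtain ⟨q, hq⟩ := hf l' ptr lo hi' h1 (h2.trans hh) hw'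
  refine ⟨.seq p q, fun N x m w hN hm hw => ?_⟩
  obtain ⟨t, m', r1, w1, k1, a1, b1⟩ := hp N x m hN hm
  obtain ⟨t', m'', r2, w2, k2, a2, b2⟩ := hq _ _ m' w (ha _ _ hN) w1
    ⟨(k1 ptr (by omega)).trans hw.1, fun i hi => by rw [a1]; exact hw.2 i hi⟩
  exact ⟨_, m'', .seq r1 r2, w2, fun r hr hr' => (k2 r (by omega) hr').trans (k1 r hr),
    fun a ha => (a2 a ha).trans (by rw [a1]), add_le_add b1 (b2.trans (hc _))⟩

theorem singleton' : Emits fun n : ℕ => [n] := by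
  refine ⟨fun N => 4 + (N * (3 + 1) + 1 + 2), (PolyBdd.const 4).add
    (((PolyBdd.id.mul (.const _)).add (.const 1)).add (.const 2)),
    fun l ptr lo hi h1 h2 h3 => ?_⟩
  change ℕ at l
  change lo ≤ l ∧ l < hi at h3
  -- Registers `hi + 1` and `hi + 2` hold the cell contents for the letters `false` and `true`; the
  -- former is also the constant one that moves the pointer and the counter `hi + 3`.
  refine ⟨.seq (.seq (.const hi 0) <| .seq (.const (hi + 1) 1) <| .seq (.const (hi + 2) 2) <|
    .add (hi + 3) l hi) <| .seq (.while (hi + 3) <| .seq (.store 0 ptr (hi + 2)) <|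
      .seq (.add ptr ptr (hi + 1)) (.sub (hi + 3) (hi + 3) (hi + 1))) <|
    .seq (.store 0 ptr (hi + 1)) (.add ptr ptr (hi + 1)), fun N x m w hN hm hw => ?_⟩
  change m.reg l = x at hm
  change x ≤ N at hN
  let Inv : ℕ → Memory → Prop := fun j m' =>
    m'.Wrote ptr (w ++ List.replicate j true) ∧ (∀ r < hi, r ≠ ptr → m'.reg r = m.reg r) ∧
      (∀ a, a ≠ 0 → m'.arr a = m.arr a) ∧ m'.reg (hi + 1) = 1 ∧ m'.reg (hi + 2) = 2
  obtain ⟨t, m', r, ⟨i1, i2, i3, i4, i5⟩, b⟩ := Runs.while_of_invariant (x := hi + 3) (n := x)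
    (T := 3) (p := .seq (.store 0 ptr (hi + 2)) <|
      .seq (.add ptr ptr (hi + 1)) (.sub (hi + 3) (hi + 3) (hi + 1))) (Inv := Inv)
    (fun j hj m' hI hx => by
      obtain ⟨i1, i2, i3, i4, i5⟩ := hI
      refine ⟨_, _, .seq (.store ..) (.seq (.add ..) (.sub ..)), ⟨?_, fun r hr hr' => ?_,
        fun a ha => ?_, ?_, ?_⟩, ?_, le_rfl⟩
      · rw [List.replicate_succ', ← List.append_assoc]
        refine i1.snoc true ?_ fun i => ?_
        · simp only [Memory.reg_setReg, Memory.reg_setArr, i4, i1.1]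
          rw [if_neg (by omega)]
          simp
        · simp [Memory.arr_setArr, i1.1, i5]
      · simp only [Memory.reg_setReg, Memory.reg_setArr]
        rw [if_neg (by omega), if_neg hr', i2 r hr hr']
      · simp only [Memory.arr_setReg]
        rw [← i3 a ha]
        funext i
        simp [Memory.arr_setArr, ha]
      · simp only [Memory.reg_setReg, Memory.reg_setArr]
        rw [if_neg (by omega), if_neg (by omega), i4]
      · simp only [Memory.reg_setReg, Memory.reg_setArr]
        rw [if_neg (by omega), if_neg (by omega), i5]
      · simp only [Memory.reg_setReg, Memory.reg_setArr]
        rw [if_pos trivial, if_neg (by omega), if_neg (by omega), hx, i4]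
        omega)
    (m := (((m.setReg hi 0).setReg (hi + 1) 1).setReg (hi + 2) 2).setReg (hi + 3) x)
    ⟨by
      refine ⟨?_, fun i hi => ?_⟩
      · simp only [Memory.reg_setReg]
        rw [if_neg (by omega), if_neg (by omega), if_neg (by omega), if_neg (by omega), hw.1]
        simp
      · simp only [List.replicate_zero, List.append_nil] at hi ⊢
        exact hw.2 i hi,
      fun r hr _ => by
        simp only [Memory.reg_setReg]
        rw [if_neg (by omega), if_neg (by omega), if_neg (by omega), if_neg (by omega)],
      fun a _ => rfl, by simp [Memory.reg_setReg], by simp [Memory.reg_setReg]⟩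
    (by simp [Memory.reg_setReg])
  have e : (((m.setReg hi 0).setReg (hi + 1) 1).setReg (hi + 2) 2).reg l +
      (((m.setReg hi 0).setReg (hi + 1) 1).setReg (hi + 2) 2).reg hi = x := by
    simp only [Memory.reg_setReg]
    rw [if_neg (by omega), if_neg (by omega), if_neg (by omega)]
    simp [hm]
  refine ⟨_, _, .seq (.seq (.const ..) <| .seq (.const ..) <| .seq (.const ..) <| .add ..)
    (.seq (by rw [e]; exact r) (.seq (.store ..) (.add ..))), ?_, fun r hr hr' => ?_,
    fun a ha => ?_, ?_⟩
  · have : w ++ unaryWord [x] = (w ++ List.replicate x true) ++ [false] := by simp [unaryWord]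
    rw [this]
    refine i1.snoc false ?_ fun i => ?_
    · simp [Memory.reg_setReg, i4, i1.1]
    · simp [Memory.arr_setArr, i1.1, i4]
  · simp only [Memory.reg_setReg, Memory.reg_setArr]
    rw [if_neg hr', i2 r hr hr']
  · simp only [Memory.arr_setReg]
    rw [← i3 a ha]
    funext i
    simp [Memory.arr_setArr, ha]
  · have : x * (3 + 1) ≤ N * (3 + 1) := Nat.mul_le_mul_right _ hN
    beta_reduce
    omega

theorem singleton {f : α → ℕ} (hf : PolyTime f) : Emits fun x => [f x] := singleton'.comp hf

theorem flatMap_range {n : α → ℕ} {f : α → ℕ → List ℕ} (hn : PolyTime n)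
    (hf : Emits fun p : α × ℕ => f p.1 p.2) :
    Emits fun x => (List.range (n x)).flatMap (f x) := by
  obtain ⟨⟨a, ha⟩, a', hn⟩ := hn
  obtain ⟨b, ⟨c, hc⟩, hf⟩ := hf
  let B : ℕ → ℕ := fun N => N + (N + 2) ^ a
  have hB : PolyBdd B := PolyBdd.id.add (.base a)
  refine ⟨fun N => (N + 2) ^ a' + (3 + ((N + 2) ^ a * ((B N + 2) ^ c + 2 + 1) + 1)),
    (PolyBdd.base a').add ((PolyBdd.const 3).add (((PolyBdd.base a).mul
      (((hB.pow_add_two c).add (.const 2)).add (.const 1))).add (.const 1))),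
    fun l ptr lo hi h1 h2 h3 => ?_⟩
  obtain ⟨pn, rn, h, hh, hw, hpn⟩ := hn l lo hi h2 h3
  change ℕ at rn
  change lo ≤ rn ∧ rn < h at hw
  obtain ⟨q, hq⟩ := hf (l, h) ptr lo (h + 3) h1 (by omega)
    ⟨within_mono h3 (by omega), (⟨by omega, by omega⟩ : lo ≤ h ∧ h < h + 3)⟩
  refine ⟨.seq pn <| .seq (.seq (.const h 0) <| .seq (.const (h + 1) 1) <| .add (h + 2) rn h) <|
    .while (h + 2) <| .seq q <| .seq (.add h h (h + 1)) (.sub (h + 2) (h + 2) (h + 1)),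
    fun N x m w hN hm hw0 => ?_⟩
  obtain ⟨t1, m1, r1, v1, k1, a1, b1⟩ := hpn N x m hN hm
  change m1.reg rn = n x at v1
  have hnx : n x ≤ (N + 2) ^ a := ha N x hN
  let Inv : ℕ → Memory → Prop := fun j m' =>
    m'.Wrote ptr (w ++ unaryWord ((List.range j).flatMap (f x))) ∧
      (∀ r < hi, r ≠ ptr → m'.reg r = m.reg r) ∧ (∀ a, a ≠ 0 → m'.arr a = m.arr a) ∧
      m'.reg h = j ∧ m'.reg (h + 1) = 1
  obtain ⟨t, m', r, ⟨i1, i2, i3, i4, i5⟩, b'⟩ := Runs.while_of_invariant (x := h + 2) (n := n x)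
    (T := (B N + 2) ^ c + 2)
    (p := .seq q <| .seq (.add h h (h + 1)) (.sub (h + 2) (h + 2) (h + 1))) (Inv := Inv)
    (fun j hj m' hI hx => by
      obtain ⟨i1, i2, i3, i4, i5⟩ := hI
      obtain ⟨t, m'', r, w', k, a', b'⟩ := hq (B N) (x, j) m' _
        ⟨bdd_mono (by simp only [B]; omega) hN, (by simp only [B]; omega : j ≤ B N)⟩
        ⟨holds_frame h3 (fun r hr hr' => i2 r hr' (by omega)) i3 hm, i4⟩ i1
      refine ⟨_, _, .seq r (.seq (.add ..) (.sub ..)), ⟨?_, fun r hr hr' => ?_,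
        fun a ha => ?_, ?_, ?_⟩, ?_, Nat.add_le_add_right (b'.trans (hc _)) 2⟩
      · have e : w ++ unaryWord ((List.range (j + 1)).flatMap (f x)) =
            w ++ unaryWord ((List.range j).flatMap (f x)) ++ unaryWord (f x j) := by
          simp [List.range_succ, unaryWord]
        rw [e]
        refine ⟨?_, w'.2⟩
        simp only [Memory.reg_setReg]
        rw [if_neg (by omega), if_neg (by omega)]
        exact w'.1
      · simp only [Memory.reg_setReg]
        rw [if_neg (by omega), if_neg (by omega), k r (by omega) hr', i2 r hr hr']
      · simp only [Memory.arr_setReg]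
        exact (a' a ha).trans (i3 a ha)
      · simp only [Memory.reg_setReg]
        rw [if_neg (by omega), if_pos trivial, k _ (by omega) (by omega), k _ (by omega) (by omega),
          i4, i5]
      · simp only [Memory.reg_setReg]
        rw [if_neg (by omega), if_neg (by omega), k _ (by omega) (by omega), i5]
      · simp only [Memory.reg_setReg]
        rw [if_pos trivial, if_neg (by omega), if_neg (by omega), k _ (by omega) (by omega),
          k _ (by omega) (by omega), hx, i5]
        omega)
    (m := ((m1.setReg h 0).setReg (h + 1) 1).setReg (h + 2) (n x))
    ⟨by
      refine ⟨?_, fun i hi => ?_⟩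
      · simp only [Memory.reg_setReg]
        rw [if_neg (by omega), if_neg (by omega), if_neg (by omega), k1 _ (by omega), hw0.1]
        simp [unaryWord]
      · simp only [Memory.arr_setReg, a1]
        simp only [List.range_zero, List.flatMap_nil, unaryWord, List.append_nil] at hi ⊢
        exact hw0.2 i hi,
      fun r hr _ => by
        simp only [Memory.reg_setReg]
        rw [if_neg (by omega), if_neg (by omega), if_neg (by omega), k1 _ hr],
      fun a _ => by simp [a1], by simp [Memory.reg_setReg], by simp [Memory.reg_setReg]⟩
    (by simp [Memory.reg_setReg])
  have e : ((m1.setReg h 0).setReg (h + 1) 1).reg rn +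
      ((m1.setReg h 0).setReg (h + 1) 1).reg h = n x := by
    simp only [Memory.reg_setReg]
    rw [if_neg (by omega), if_neg (by omega)]
    simp [v1]
  refine ⟨_, _, .seq r1 (.seq (.seq (.const ..) <| .seq (.const ..) <| .add ..)
    (by rw [e]; exact r)), i1, i2, i3, ?_⟩
  have : n x * ((B N + 2) ^ c + 2 + 1) ≤ (N + 2) ^ a * ((B N + 2) ^ c + 2 + 1) :=
    Nat.mul_le_mul_right _ hnx
  beta_reduce
  omega

end Emits

end Emits

/-! ### Composition with an arbitrary parameterized reduction -/

namespace Prog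

/-- All names of registers and arrays in the program are smaller than this number. -/
def bound : Prog → ℕ
  | const x _ => x + 1
  | add x y z => max (x + 1) (max (y + 1) (z + 1))
  | sub x y z => max (x + 1) (max (y + 1) (z + 1))
  | load x a y => max (x + 1) (max (a + 1) (y + 1))
  | store a y z => max (a + 1) (max (y + 1) (z + 1))
  | seq p q => max p.bound q.bound
  | ifZero x p q => max (x + 1) (max p.bound q.bound)
  | .while x p => max (x + 1) p.bound

end Prog

namespace Runs

theorem frame {p : Prog} {m m' : Memory} {t N : ℕ} (h : Runs p m t m') (hp : p.bound ≤ N) :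
    (∀ r, N ≤ r → m'.reg r = m.reg r) ∧ ∀ a, N ≤ a → m'.arr a = m.arr a := by
  induction h with
  | const | add | sub | load =>
    simp only [Prog.bound] at hp
    refine ⟨fun r hr => ?_, fun a _ => rfl⟩
    rw [Memory.reg_setReg, if_neg (by omega)]
  | store =>
    simp only [Prog.bound] at hp
    refine ⟨fun r _ => rfl, fun a ha => ?_⟩
    funext i
    rw [Memory.arr_setArr, if_neg (by omega)]
  | seq _ _ ih ih' =>
    simp only [Prog.bound, max_le_iff] at hp
    have h1 := ih hp.1
    have h2 := ih' hp.2
    exact ⟨fun r hr => (h2.1 r hr).trans (h1.1 r hr), fun r hr => (h2.2 r hr).trans (h1.2 r hr)⟩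
  | ifZero_zero _ _ ih =>
    simp only [Prog.bound, max_le_iff] at hp
    exact ih hp.2.1
  | ifZero_nonzero _ _ ih =>
    simp only [Prog.bound, max_le_iff] at hp
    exact ih hp.2.2
  | while_zero => exact ⟨fun _ _ => rfl, fun _ _ => rfl⟩
  | while_nonzero _ _ _ ih ih' =>
    have h2 := ih' hp
    simp only [Prog.bound, max_le_iff] at hp
    have h1 := ih hp.2
    exact ⟨fun r hr => (h2.1 r hr).trans (h1.1 r hr), fun r hr => (h2.2 r hr).trans (h1.2 r hr)⟩

/-- A step makes at most one new cell of array `0` nonzero. Cells are counted, instead of bounding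
their indices, because indirect addressing can write far away; the count still bounds the length of
an output word. -/
theorem support {p : Prog} {m m' : Memory} {t : ℕ} (h : Runs p m t m') (S : Finset ℕ)
    (hS : ∀ i, m.arr 0 i ≠ 0 → i ∈ S) :
    ∃ S' : Finset ℕ, S'.card ≤ S.card + t ∧ ∀ i, m'.arr 0 i ≠ 0 → i ∈ S' := by
  induction h generalizing S with
  | const | add | sub | load => exact ⟨S, by omega, hS⟩
  | store a y z m =>
    refine ⟨insert (m.reg y) S, Finset.card_insert_le _ _, fun i hi => ?_⟩
    rw [Memory.arr_setArr] at hi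
    split_ifs at hi with h
    · exact Finset.mem_insert.2 (.inl h.2)
    · exact Finset.mem_insert_of_mem (hS i hi)
  | seq _ _ ih ih' =>
    obtain ⟨S', h1, h2⟩ := ih S hS
    obtain ⟨S'', h3, h4⟩ := ih' S' h2
    exact ⟨S'', by omega, h4⟩
  | ifZero_zero _ _ ih | ifZero_nonzero _ _ ih =>
    obtain ⟨S', h1, h2⟩ := ih S hS
    exact ⟨S', by omega, h2⟩
  | while_zero => exact ⟨S, by omega, hS⟩
  | while_nonzero _ _ _ ih ih' =>
    obtain ⟨S', h1, h2⟩ := ih S hS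
    obtain ⟨S'', h3, h4⟩ := ih' S' h2
    exact ⟨S'', by omega, h4⟩

theorem length_output_le {p : Prog} {w w' : List Bool} {k k' t : ℕ} {m : Memory}
    (h : Runs p (inputMemory w k) t m) (hm : m.Outputs w' k') : w'.length ≤ w.length + t := by
  obtain ⟨S, h1, h2⟩ := h.support (Finset.range w.length) fun i hi => by
    by_contra hi'
    rw [Finset.mem_range, not_lt] at hi'
    exact hi (by simp [inputMemory, wordCell_eq_zero.2 hi'])
  have : Finset.range w'.length ⊆ S := fun i hi => by
    rw [Finset.mem_range] at hi
    refine h2 i ?_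
    rw [hm.1 i hi.le, Ne, wordCell_eq_zero]
    omega
  have := Finset.card_le_card this
  simp only [Finset.card_range] at this h1
  omega

end Runs

/-- A polynomial time transformation of words and parameters, in a form that can be executed after
an arbitrary program. -/
theorem exists_prog_outputs {f : ((ℕ → ℕ) × ℕ) × ℕ → List ℕ} {g : ℕ → ℕ} (hf : Emits f)
    (hg : PolyTime g) : ∃ c, ∀ n, 0 < n → ∃ p : Prog, ∀ w k m, Memory.Outputs m w k →
      (∀ a, n ≤ a → m.arr a = fun _ => 0) → ∃ t m', Runs p m t m' ∧
        m'.Outputs (unaryWord (f ((wordCell w, w.length), k))) (g k) ∧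
        t ≤ (w.length + k + 4) ^ c := by
  obtain ⟨b, hb, hf⟩ := hf
  obtain ⟨-, c, hg⟩ := hg
  have hB : PolyBdd fun N => 5 + ((N * (3 + 1) + 1) + (1 + (b N + (2 + ((N + 2) ^ c + 2))))) :=
    (PolyBdd.const 5).add (((PolyBdd.id.mul (.const _)).add (.const _)).add ((PolyBdd.const 1).add
      (hb.add ((PolyBdd.const 2).add ((PolyBdd.base c).add (.const 2))))))
  obtain ⟨C, hC⟩ := hB
  refine ⟨C, fun n hn => ?_⟩
  obtain ⟨q, hq⟩ := hf ((n, n + 1), n + 2) n (n + 1) (n + 3) (by omega) (by omega)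
    ⟨⟨(hn.ne' : n ≠ 0), (⟨by omega, by omega⟩ : n + 1 ≤ n + 1 ∧ n + 1 < n + 3)⟩,
      (⟨by omega, by omega⟩ : n + 1 ≤ n + 2 ∧ n + 2 < n + 3)⟩
  obtain ⟨r, l, h, hh, hl, hr⟩ := hg (n + 2) (n + 1) (n + 3) (by omega)
    (⟨by omega, by omega⟩ : n + 1 ≤ n + 2 ∧ n + 2 < n + 3)
  change ℕ at l
  change n + 1 ≤ l ∧ l < h at hl
  -- The word in array `0` is copied to the untouched array `n` up to its first blank, because the
  -- new word will overwrite it. Register `n` becomes the output pointer, `n + 1` the length of the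
  -- word and `n + 2` the parameter.
  refine ⟨.seq (.seq (.const (n + 3) 0) <| .seq (.add (n + 2) 0 (n + 3)) <|
      .seq (.const (n + 4) 1) <| .seq (.const (n + 1) 0) (.load (n + 5) 0 (n + 1))) <|
    .seq (.while (n + 5) <| .seq (.store n (n + 1) (n + 5)) <|
      .seq (.add (n + 1) (n + 1) (n + 4)) (.load (n + 5) 0 (n + 1))) <|
    -- A blank must be written behind the new word, because old contents may remain there.
    .seq (.const n 0) <| .seq q <| .seq (.seq (.const (n + 3) 0) (.store 0 n (n + 3))) <|
    .seq r <| .seq (.const h 0) (.add 0 l h), fun w k m hm hm0 => ?_⟩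
  set N := w.length + k + 2 with hN
  let Inv : ℕ → Memory → Prop := fun j m' => m'.arr 0 = m.arr 0 ∧
    m'.arr n = (fun i => if i < j then wordCell w i else 0) ∧
    m'.reg (n + 1) = j ∧ m'.reg (n + 2) = k ∧ m'.reg (n + 4) = 1 ∧
    m'.reg (n + 5) = m.arr 0 j ∧ j ≤ w.length
  obtain ⟨t1, m1, r1, ⟨i1, i2, i3, i4, i5, i6, -⟩, b1⟩ := Runs.while_of_invariant' (x := n + 5)
    (n := w.length) (T := 3) (p := .seq (.store n (n + 1) (n + 5)) <|
      .seq (.add (n + 1) (n + 1) (n + 4)) (.load (n + 5) 0 (n + 1))) (Inv := Inv)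
    (fun j m' hI => by
      rw [hI.2.2.2.2.2.1, hm.1 j hI.2.2.2.2.2.2, wordCell_eq_zero])
    (fun j hj m' hI => by
      obtain ⟨i1, i2, i3, i4, i5, i6, i7⟩ := hI
      refine ⟨_, _, .seq (.store ..) (.seq (.add ..) (.load ..)), ⟨?_, ?_, ?_, ?_, ?_, ?_,
        by omega⟩, le_rfl⟩
      · simp only [Memory.arr_setReg]
        rw [← i1]
        funext i
        rw [Memory.arr_setArr, if_neg (by omega)]
      · simp only [Memory.arr_setReg]
        funext i
        rw [Memory.arr_setArr, i3, i2, i6, hm.1 j hj.le]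
        simp only [true_and]
        split_ifs with h1 h2 h2 <;> first | omega | rfl | (subst h1; rfl)
      · simp only [Memory.reg_setReg, Memory.reg_setArr]
        rw [if_neg (by omega), if_pos trivial, i3, i5]
      · simp only [Memory.reg_setReg, Memory.reg_setArr]
        rw [if_neg (by omega), if_neg (by omega), i4]
      · simp only [Memory.reg_setReg, Memory.reg_setArr]
        rw [if_neg (by omega), if_neg (by omega), i5]
      · simp only [Memory.reg_setReg, Memory.reg_setArr, Memory.arr_setReg]
        rw [if_pos trivial, if_pos trivial, i3, i5, Memory.arr_setArr, if_neg (by omega), i1])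
    (m := ((((m.setReg (n + 3) 0).setReg (n + 2) k).setReg (n + 4) 1).setReg (n + 1) 0).setReg
      (n + 5) (m.arr 0 0))
    ⟨rfl, by simpa using hm0 n le_rfl, by simp [Memory.reg_setReg], by simp [Memory.reg_setReg],
      by simp [Memory.reg_setReg], by simp [Memory.reg_setReg], Nat.zero_le _⟩
  have e1 : (m.setReg (n + 3) 0).reg 0 + (m.setReg (n + 3) 0).reg (n + 3) = k := by
    simp [Memory.reg_setReg, hm.2]
  have e2 : ((((m.setReg (n + 3) 0).setReg (n + 2) k).setReg (n + 4) 1).setReg (n + 1) 0).arr 0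
      (((((m.setReg (n + 3) 0).setReg (n + 2) k).setReg (n + 4) 1).setReg (n + 1) 0).reg
        (n + 1)) = m.arr 0 0 := by
    simp [Memory.reg_setReg]
  have hbdd : Bdd N ((wordCell w, w.length), k) :=
    ⟨⟨fun i => (wordCell_le_two w i).trans (by omega), (by omega : w.length ≤ N)⟩,
      (by omega : k ≤ N)⟩
  obtain ⟨t2, m2, r2, w2, k2, a2, b2⟩ := hq N ((wordCell w, w.length), k) (m1.setReg n 0) []
    hbdd ⟨⟨by
      change m1.arr n = _
      rw [i2]
      funext i
      split_ifs with h
      · rfl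
      · exact (wordCell_eq_zero.2 (by omega)).symm, by
      change (m1.setReg n 0).reg (n + 1) = _
      rw [Memory.reg_setReg, if_neg (by omega), i3]⟩, by
      change (m1.setReg n 0).reg (n + 2) = _
      rw [Memory.reg_setReg, if_neg (by omega), i4]⟩
    ⟨by simp [Memory.reg_setReg], fun i hi => by simp at hi⟩
  rw [List.nil_append] at w2
  obtain ⟨t3, m3, r3, v3, k3, a3, b3⟩ := hr N k
    ((m2.setReg (n + 3) 0).setArr 0 (m2.reg n) 0) hbdd.2 (by
      change (m2.setReg (n + 3) 0).reg (n + 2) = k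
      rw [Memory.reg_setReg, if_neg (by omega), k2 _ (by omega) (by omega), Memory.reg_setReg,
        if_neg (by omega), i4])
  change m3.reg l = g k at v3
  have e3 : (m2.setReg (n + 3) 0).setArr 0 ((m2.setReg (n + 3) 0).reg n)
      ((m2.setReg (n + 3) 0).reg (n + 3)) = (m2.setReg (n + 3) 0).setArr 0 (m2.reg n) 0 := by
    rw [Memory.reg_setReg, Memory.reg_setReg, if_neg (by omega), if_pos rfl]
  refine ⟨_, _, .seq (.seq (.const ..) <| .seq (.add ..) <| .seq (.const ..) <|
    .seq (.const ..) <| .load ..) <| .seq (by rw [e1, e2]; exact r1) <| .seq (.const ..) <|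
    .seq r2 <| .seq (.seq (.const ..) (.store ..)) <| .seq (by rw [e3]; exact r3) <|
    .seq (.const ..) (.add ..), ⟨fun i hi => ?_, ?_⟩, ?_⟩
  · simp only [Memory.arr_setReg, a3, Memory.arr_setArr, true_and, w2.1]
    split_ifs with h
    · rw [h, wordCell_length]
    · exact w2.2 i (by omega)
  · simp only [Memory.reg_setReg]
    rw [if_pos trivial, if_neg (by omega), if_pos trivial, v3, add_zero]
  · refine le_trans ?_ (hC N)
    have : w.length * (3 + 1) ≤ N * (3 + 1) := Nat.mul_le_mul_right _ (by omega)
    beta_reduce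
    omega

theorem Computable.pow_const {f : ℕ → ℕ} (hf : Computable f) (n : ℕ) :
    Computable fun k => f k ^ n := by
  induction n with
  | zero => simpa using Computable.const (1 : ℕ)
  | succ n ih => simpa only [pow_succ] using (Primrec.nat_mul.to_comp.comp ih hf :)

/-- Parameterized reductions may be followed by polynomial time reductions. -/
theorem FPTReducible.trans_emits {P Q Q' : ParamProblem} (h : FPTReducible P Q)
    (R : Q.Inst → Q'.Inst) (hR : ∀ i, Q.yes i ↔ Q'.yes (R i))
    {f : ((ℕ → ℕ) × ℕ) × ℕ → List ℕ} {g : ℕ → ℕ} (hf : Emits f) (hg : PolyTime g)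
    (hword : ∀ i, Q'.word (R i) =
      unaryWord (f ((wordCell (Q.word i), (Q.word i).length), Q.param i)))
    (hparam : ∀ i, Q'.param (R i) = g (Q.param i)) : FPTReducible P Q' := by
  obtain ⟨R₁, h1, ⟨g₁, hg₁, hg₁'⟩, p, f₁, c, hf₁, hp⟩ := h
  obtain ⟨C, hC⟩ := exists_prog_outputs hf hg
  obtain ⟨a, ha⟩ := hg.1
  have key : ∀ n : ℕ, Computable fun k => f₁ k + g₁ k + n := fun n =>
    Primrec.nat_add.to_comp.comp (Primrec.nat_add.to_comp.comp hf₁ hg₁) (.const n)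
  obtain ⟨q, hq⟩ := hC (p.bound + 1) (by omega)
  refine ⟨fun i => R (R₁ i), fun i => (h1 i).trans (hR _), ⟨fun k => (g₁ k + 2) ^ a,
    (Primrec.nat_add.to_comp.comp hg₁ (.const 2)).pow_const a, fun i => ?_⟩, .seq p q,
    fun k => 2 * (f₁ k + g₁ k + 5) ^ (C + 1), (c + 1) * (C + 1),
    Primrec.nat_mul.to_comp.comp (.const 2) ((key 5).pow_const _), fun i => ?_⟩
  · rw [hparam]
    exact ha _ _ (hg₁' i)
  · obtain ⟨t, m, r1, b1, o1⟩ := hp i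
    obtain ⟨t', m', r2, o2, b2⟩ := hq _ _ m o1 fun a ha => by
      rw [(r1.frame le_rfl).2 a (by omega)]
      funext i
      simp only [inputMemory]
      rw [if_neg (by omega)]
    refine ⟨_, m', .seq r1 r2, ?_, by rw [hword, hparam]; exact o2⟩
    have hlen := r1.length_output_le o1
    have hk := hg₁' i
    set n := (P.word i).length
    set k := P.param i
    -- `X` bounds both the running time of the first program and the size of its output, which
    -- `length_output_le` controls by that time.
    set X := (f₁ k + g₁ k + 5) * (n + 1) ^ (c + 1) with hX
    have h2 : (n + 1) ^ c ≤ (n + 1) ^ (c + 1) := Nat.pow_le_pow_right (by omega) (by omega)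
    have h3 : n + 1 ≤ (n + 1) ^ (c + 1) := Nat.le_self_pow (by omega) _
    have h4 : f₁ k * (n + 1) ^ c ≤ f₁ k * (n + 1) ^ (c + 1) := Nat.mul_le_mul_left _ h2
    have h5 : g₁ k ≤ g₁ k * (n + 1) ^ (c + 1) := Nat.le_mul_of_pos_right _ (by positivity)
    have h6 : (Q.word (R₁ i)).length + Q.param (R₁ i) + 4 ≤ X := by
      rw [hX, add_mul, add_mul]
      omega
    have h7 : t ≤ X := by
      rw [hX, add_mul, add_mul]
      omega
    have h8 : X ≤ X ^ (C + 1) := Nat.le_self_pow (by omega) _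
    have h9 : t' ≤ X ^ (C + 1) := b2.trans ((Nat.pow_le_pow_left h6 C).trans
      (Nat.pow_le_pow_right (by omega) (by omega)))
    calc t + t' ≤ 2 * X ^ (C + 1) := by omega
      _ = _ := by rw [hX, mul_pow, ← pow_mul, mul_assoc]

/-! ### The temporal graph of a binary constraint satisfaction problem

There are `K` left and `K` right variables with values below `D`; the constraint `R i a j b` says
that the value `a` of the left variable `i` and the value `b` of the right variable `j` are
compatible.  For every variable, a selecting path leaves the vertex `inn` and reaches the vertex
`out` with a delay in between; the time of that delay is the value of the variable.  For every pair
of a left and a right variable, a verifying path has to cross both during the delays. -/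

namespace CSP

inductive Vertex where
  | src (c i : ℕ)
  | snk (c i : ℕ)
  | inn (c i : ℕ)
  | out (c i : ℕ)
  | gap (c i a : ℕ)
  | psrc (i j : ℕ)
  | psnk (i j : ℕ)
  | link (i j a b : ℕ)

open Vertex

/-- Four digits in base `B` and a tag. -/
def pack (B tag x y z w : ℕ) : ℕ := tag + 8 * (x + B * (y + B * (z + B * w)))

theorem pack_lt {B tag x y z w : ℕ} (ht : tag < 8) (hx : x < B) (hy : y < B) (hz : z < B)
    (hw : w < B) : pack B tag x y z w < 8 * B ^ 4 := by
  have h1 : z + B * w < B ^ 2 := by nlinarith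
  have h2 : y + B * (z + B * w) < B ^ 3 := by
    have : B * (z + B * w + 1) ≤ B * B ^ 2 := Nat.mul_le_mul_left _ h1
    nlinarith
  have h3 : x + B * (y + B * (z + B * w)) < B ^ 4 := by
    have : B * (y + B * (z + B * w) + 1) ≤ B * B ^ 3 := Nat.mul_le_mul_left _ h2
    nlinarith
  unfold pack
  omega

theorem add_mul_inj {B x y x' y' : ℕ} (hx : x < B) (hx' : x' < B)
    (h : x + B * y = x' + B * y') : x = x' ∧ y = y' := by
  have h1 := congrArg (· % B) h
  simp only [Nat.add_mul_mod_self_left, Nat.mod_eq_of_lt hx, Nat.mod_eq_of_lt hx'] at h1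
  subst h1
  exact ⟨rfl, Nat.eq_of_mul_eq_mul_left (by omega) (Nat.add_left_cancel h)⟩

theorem pack_inj {B tag x y z w tag' x' y' z' w' : ℕ} (ht : tag < 8) (ht' : tag' < 8)
    (hx : x < B) (hx' : x' < B) (hy : y < B) (hy' : y' < B) (hz : z < B) (hz' : z' < B)
    (h : pack B tag x y z w = pack B tag' x' y' z' w') :
    tag = tag' ∧ x = x' ∧ y = y' ∧ z = z' ∧ w = w' := by
  obtain ⟨h1, h⟩ := add_mul_inj ht ht' h
  obtain ⟨h2, h⟩ := add_mul_inj hx hx' h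
  obtain ⟨h3, h⟩ := add_mul_inj hy hy' h
  obtain ⟨h4, h⟩ := add_mul_inj hz hz' h
  exact ⟨h1, h2, h3, h4, h⟩

namespace Vertex

/-- The number of a vertex. -/
def num (B : ℕ) : Vertex → ℕ
  | src c i => pack B 0 c i 0 0
  | snk c i => pack B 1 c i 0 0
  | inn c i => pack B 2 c i 0 0
  | out c i => pack B 3 c i 0 0
  | gap c i a => pack B 4 c i a 0
  | psrc i j => pack B 5 i j 0 0
  | psnk i j => pack B 6 i j 0 0
  | link i j a b => pack B 7 i j a b

/-- All indices of the vertex are smaller than `B`. -/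
def Small (B : ℕ) : Vertex → Prop
  | src c i => c < B ∧ i < B
  | snk c i => c < B ∧ i < B
  | inn c i => c < B ∧ i < B
  | out c i => c < B ∧ i < B
  | gap c i a => c < B ∧ i < B ∧ a < B
  | psrc i j => i < B ∧ j < B
  | psnk i j => i < B ∧ j < B
  | link i j a b => i < B ∧ j < B ∧ a < B ∧ b < B

theorem num_lt {B : ℕ} {x : Vertex} (hx : x.Small B) : x.num B < 8 * B ^ 4 := by
  cases x <;> simp only [Small] at hx <;> exact pack_lt (by omega) (by omega) (by omega) (by omega)
    (by omega)

theorem num_inj {B : ℕ} {x y : Vertex} (hx : x.Small B) (hy : y.Small B)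
    (h : x.num B = y.num B) : x = y := by
  cases x <;> cases y <;> simp only [Small] at hx hy <;>
    have := pack_inj (by omega) (by omega) (by omega) (by omega) (by omega) (by omega) (by omega)
      (by omega) h <;> simp_all

end Vertex

/-- The length of the time interval that belongs to one value. -/
def width (K : ℕ) : ℕ := 3 * K + 2

/-- The length of the time interval that belongs to one side. -/
def epoch (K D : ℕ) : ℕ := D * width K + 2

/-- Time number `r` among those that belong to the value `a` on side `c`. -/
def time (K D c a r : ℕ) : ℕ := c * epoch K D + 1 + a * width K + r

/-! ### Edges and neighbourhoods -/

section Edge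

variable (K D : ℕ) (R : ℕ → ℕ → ℕ → ℕ → Prop)

/-- The edges at time `t`, in one direction. -/
def EdgeAt {τ : Type} (φ : Vertex → τ) (t : ℕ) (u v : τ) (c i j a b : ℕ) : Prop :=
  (u = φ (src c i) ∧ v = φ (inn c i) ∧ t = c * epoch K D) ∨
  (u = φ (out c i) ∧ v = φ (snk c i) ∧ t = c * epoch K D + epoch K D - 1) ∨
  (u = φ (inn c i) ∧ v = φ (gap c i a) ∧ t = time K D c a 0) ∨
  (u = φ (gap c i a) ∧ v = φ (out c i) ∧ t = time K D c a (width K - 1)) ∨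
  (u = φ (inn c i) ∧ v = φ (out c i)) ∨
  (u = φ (psrc i j) ∧ v = φ (inn 0 i)) ∨
  (u = φ (out 1 j) ∧ v = φ (psnk i j)) ∨
  (u = φ (out 0 i) ∧ v = φ (link i j a b) ∧ time K D 0 a 0 ≤ t ∧ t < time K D 0 a (width K) ∧
    R i a j b) ∨
  (u = φ (link i j a b) ∧ v = φ (inn 1 j) ∧ time K D 1 b 0 ≤ t ∧ t < time K D 1 b (width K) ∧
    R i a j b)

def Edge {τ : Type} (φ : Vertex → τ) (t : ℕ) (u v : τ) : Prop :=
  ∃ c < 2, ∃ i < K, ∃ j < K, ∃ a < D, ∃ b < D, EdgeAt K D R φ t u v c i j a b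

def Adj {τ : Type} (φ : Vertex → τ) (t : ℕ) (u v : τ) : Prop :=
  Edge K D R φ t u v ∨ Edge K D R φ t v u

/-- Exceeds every index that occurs: sides are below `2`, variables below `K`, values below `D`. -/
def base : ℕ := K + D + 2

variable {K D R}

/-- The formula for the edges admits an arbitrary naming `φ` of the vertices: with `id` it is
convenient for reasoning, with `num` it is what the machine evaluates. This connects the two. -/
theorem edge_iff {τ : Type} {φ : Vertex → τ} {t : ℕ} {u v : τ} : Edge K D R φ t u v ↔
    ∃ x y : Vertex, x.Small (base K D) ∧ y.Small (base K D) ∧ Edge K D R id t x y ∧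
      u = φ x ∧ v = φ y := by
  constructor
  · rintro ⟨c, hc, i, hi, j, hj, a, ha, b, hb, h⟩
    have key : ∀ x y : Vertex, x.Small (base K D) → y.Small (base K D) →
        EdgeAt K D R id t x y c i j a b → u = φ x → v = φ y → ∃ x y : Vertex, x.Small (base K D) ∧
          y.Small (base K D) ∧ Edge K D R id t x y ∧ u = φ x ∧ v = φ y :=
      fun x y hx hy h hu hv =>
        ⟨x, y, hx, hy, ⟨c, hc, i, hi, j, hj, a, ha, b, hb, h⟩, hu, hv⟩
    rcases h with ⟨hu, hv, h⟩ | ⟨hu, hv, h⟩ | ⟨hu, hv, h⟩ | ⟨hu, hv, h⟩ | ⟨hu, hv⟩ | ⟨hu, hv⟩ |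
      ⟨hu, hv⟩ | ⟨hu, hv, h⟩ | ⟨hu, hv, h⟩ <;>
    refine key _ _ ?_ ?_ ?_ hu hv <;>
    first
    | (simp only [Vertex.Small, base]; omega)
    | (simp [EdgeAt]; done)
    | simpa [EdgeAt] using h
  · rintro ⟨x, y, -, -, ⟨c, hc, i, hi, j, hj, a, ha, b, hb, h⟩, rfl, rfl⟩
    refine ⟨c, hc, i, hi, j, hj, a, ha, b, hb, ?_⟩
    rcases h with ⟨rfl, rfl, h⟩ | ⟨rfl, rfl, h⟩ | ⟨rfl, rfl, h⟩ | ⟨rfl, rfl, h⟩ | ⟨rfl, rfl⟩ |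
      ⟨rfl, rfl⟩ | ⟨rfl, rfl⟩ | ⟨rfl, rfl, h⟩ | ⟨rfl, rfl, h⟩ <;>
    first
    | (simp [EdgeAt]; done)
    | simp [EdgeAt, h]

theorem adj_iff {τ : Type} {φ : Vertex → τ} {t : ℕ} {u v : τ} : Adj K D R φ t u v ↔
    ∃ x y : Vertex, x.Small (base K D) ∧ y.Small (base K D) ∧ Adj K D R id t x y ∧
      u = φ x ∧ v = φ y := by
  unfold Adj
  rw [edge_iff, edge_iff (u := v)]
  constructor
  · rintro (⟨x, y, hx, hy, h, hu, hv⟩ | ⟨x, y, hx, hy, h, hu, hv⟩)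
    · exact ⟨x, y, hx, hy, .inl h, hu, hv⟩
    · exact ⟨y, x, hy, hx, .inr h, hv, hu⟩
  · rintro ⟨x, y, hx, hy, h | h, hu, hv⟩
    · exact .inl ⟨x, y, hx, hy, h, hu, hv⟩
    · exact .inr ⟨y, x, hy, hx, h, hv, hu⟩

theorem Adj.symm {τ : Type} {φ : Vertex → τ} {t : ℕ} {u v : τ} (h : Adj K D R φ t u v) :
    Adj K D R φ t v u := Or.symm h

theorem adj_src {t c i : ℕ} {y : Vertex} (h : Adj K D R id t (src c i) y) :
    y = inn c i ∧ t = c * epoch K D := by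
  rcases h with ⟨c, hc, i, hi, j, hj, a, ha, b, hb, h⟩ | ⟨c, hc, i, hi, j, hj, a, ha, b, hb, h⟩ <;>
  simp [EdgeAt] at h
  · obtain ⟨⟨rfl, rfl⟩, rfl, h⟩ := h
    exact ⟨rfl, h⟩

theorem adj_snk {t c i : ℕ} {y : Vertex} (h : Adj K D R id t (snk c i) y) :
    y = out c i ∧ t = c * epoch K D + epoch K D - 1 := by
  rcases h with ⟨c, hc, i, hi, j, hj, a, ha, b, hb, h⟩ | ⟨c, hc, i, hi, j, hj, a, ha, b, hb, h⟩ <;>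
  simp [EdgeAt] at h
  · obtain ⟨rfl, ⟨rfl, rfl⟩, h⟩ := h
    exact ⟨rfl, h⟩

theorem adj_psrc {t i j : ℕ} {y : Vertex} (h : Adj K D R id t (psrc i j) y) : y = inn 0 i := by
  rcases h with ⟨c, hc, i, hi, j, hj, a, ha, b, hb, h⟩ | ⟨c, hc, i, hi, j, hj, a, ha, b, hb, h⟩ <;>
  simp [EdgeAt] at h
  · obtain ⟨⟨rfl, rfl⟩, rfl⟩ := h
    rfl

theorem adj_psnk {t i j : ℕ} {y : Vertex} (h : Adj K D R id t (psnk i j) y) : y = out 1 j := by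
  rcases h with ⟨c, hc, i, hi, j, hj, a, ha, b, hb, h⟩ | ⟨c, hc, i, hi, j, hj, a, ha, b, hb, h⟩ <;>
  simp [EdgeAt] at h
  · obtain ⟨rfl, rfl, rfl⟩ := h
    rfl

theorem adj_gap {t c i a : ℕ} {y : Vertex} (h : Adj K D R id t (gap c i a) y) :
    y = inn c i ∧ a < D ∧ t = time K D c a 0 ∨
      y = out c i ∧ a < D ∧ t = time K D c a (width K - 1) := by
  rcases h with ⟨c, hc, i, hi, j, hj, a, ha, b, hb, h⟩ | ⟨c, hc, i, hi, j, hj, a, ha, b, hb, h⟩ <;>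
  simp [EdgeAt] at h
  · obtain ⟨⟨rfl, rfl, rfl⟩, rfl, h⟩ := h
    exact .inr ⟨rfl, ha, h⟩
  · obtain ⟨rfl, ⟨rfl, rfl, rfl⟩, h⟩ := h
    exact .inl ⟨rfl, ha, h⟩

/-- The edges to the left side and to the right side live in different epochs, which makes a link a
one-way passage from left to right. -/
theorem adj_link {t i j a b : ℕ} {y : Vertex} (h : Adj K D R id t (link i j a b) y) :
    y = out 0 i ∧ a < D ∧ t < time K D 0 a (width K) ∨
      y = inn 1 j ∧ b < D ∧ time K D 1 b 0 ≤ t ∧ t < time K D 1 b (width K) := by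
  rcases h with ⟨c, hc, i, hi, j, hj, a, ha, b, hb, h⟩ | ⟨c, hc, i, hi, j, hj, a, ha, b, hb, h⟩ <;>
  simp [EdgeAt] at h
  · obtain ⟨⟨rfl, rfl, rfl, rfl⟩, rfl, h⟩ := h
    exact .inr ⟨rfl, hb, h.1, h.2.1⟩
  · obtain ⟨rfl, ⟨rfl, rfl, rfl, rfl⟩, h⟩ := h
    exact .inl ⟨rfl, ha, h.2.1⟩

theorem adj_inn {t c i : ℕ} {y : Vertex} (h : Adj K D R id t (inn c i) y) :
    y = src c i ∨ y = out c i ∨ (∃ a < D, y = gap c i a ∧ t = time K D c a 0) ∨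
      (c = 0 ∧ ∃ j, y = psrc i j) ∨ ∃ i' a, ∃ b, c = 1 ∧ y = link i' i a b ∧ time K D 1 b 0 ≤ t := by
  rcases h with ⟨c, hc, i, hi, j, hj, a, ha, b, hb, h⟩ | ⟨c, hc, i, hi, j, hj, a, ha, b, hb, h⟩ <;>
  simp [EdgeAt] at h
  · rcases h with ⟨⟨rfl, rfl⟩, rfl, h⟩ | ⟨⟨rfl, rfl⟩, rfl⟩
    · exact .inr (.inr (.inl ⟨a, ha, rfl, h⟩))
    · exact .inr (.inl rfl)
  · rcases h with ⟨rfl, ⟨rfl, rfl⟩, h⟩ | ⟨rfl, rfl, rfl⟩ | ⟨rfl, ⟨rfl, rfl⟩, h⟩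
    · exact .inl rfl
    · exact .inr (.inr (.inr (.inl ⟨rfl, j, rfl⟩)))
    · exact .inr (.inr (.inr (.inr ⟨i, a, b, rfl, rfl, h.1⟩)))

theorem adj_out {t c i : ℕ} {y : Vertex} (h : Adj K D R id t (out c i) y) :
    y = snk c i ∨ y = inn c i ∨ (∃ a, y = gap c i a) ∨
      (c = 0 ∧ ∃ j, ∃ a < D, ∃ b < D, y = link i j a b ∧ R i a j b ∧ time K D 0 a 0 ≤ t ∧
        t < time K D 0 a (width K)) ∨ c = 1 ∧ ∃ i', y = psnk i' i := by
  rcases h with ⟨c, hc, i, hi, j, hj, a, ha, b, hb, h⟩ | ⟨c, hc, i, hi, j, hj, a, ha, b, hb, h⟩ <;>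
  simp [EdgeAt] at h
  · rcases h with ⟨⟨rfl, rfl⟩, rfl, h⟩ | ⟨⟨rfl, rfl⟩, rfl⟩ | ⟨⟨rfl, rfl⟩, rfl, h⟩
    · exact .inl rfl
    · exact .inr (.inr (.inr (.inr ⟨rfl, i, rfl⟩)))
    · exact .inr (.inr (.inr (.inl ⟨rfl, j, a, ha, b, hb, rfl, h.2.2, h.1, h.2.1⟩)))
  · rcases h with ⟨rfl, ⟨rfl, rfl⟩, h⟩ | ⟨rfl, rfl, rfl⟩
    · exact .inr (.inr (.inl ⟨a, rfl⟩))
    · exact .inr (.inl rfl)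

end Edge

end CSP

namespace CSP

open Vertex

/-! ### Temporal paths as sequences of vertices and times -/

section Trail

variable {K D : ℕ} {R : ℕ → ℕ → ℕ → ℕ → Prop}

theorem time_width_le {c a : ℕ} (ha : a < D) :
    time K D c a (width K) + 1 ≤ c * epoch K D + epoch K D := by
  have : (a + 1) * width K ≤ D * width K := Nat.mul_le_mul_right _ ha
  unfold time epoch
  rw [add_mul] at this
  omega

theorem time_add (c a r : ℕ) : time K D c a r = time K D c a 0 + r := rfl

theorem le_time (c a r : ℕ) : c * epoch K D + 1 ≤ time K D c a r := by
  unfold time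
  omega

/-- The time intervals of different values are disjoint. -/
theorem eq_of_time_le {c a a' t : ℕ} (h1 : time K D c a 0 ≤ t) (h2 : t < time K D c a (width K))
    (h3 : time K D c a' 0 ≤ t) (h4 : t < time K D c a' (width K)) : a = a' := by
  have key : ∀ x y, x < y → x * width K + width K ≤ y * width K := fun x y h => by
    have : (x + 1) * width K ≤ y * width K := Nat.mul_le_mul_right _ h
    rwa [add_mul, one_mul] at this
  unfold time at *
  rcases lt_trichotomy a a' with h | h | h
  · have := key _ _ h
    omega
  · exact h
  · have := key _ _ h
    omega

variable (K D R) in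
/-- A temporal path, with indices and times as natural numbers. -/
structure Trail (L : ℕ) (v : ℕ → Vertex) (τ : ℕ → ℕ) : Prop where
  adj : ∀ i < L, Adj K D R id (τ i) (v i) (v (i + 1))
  lt : ∀ i, i + 1 < L → τ i < τ (i + 1)
  inj : ∀ i j, i ≤ L → j ≤ L → v i = v j → i = j

/-- The vertices at which the paths end. -/
def Vertex.IsEnd (x : Vertex) : Prop := (∃ c i, x = snk c i) ∨ ∃ i j, x = psnk i j

namespace Trail

variable {L : ℕ} {v : ℕ → Vertex} {τ : ℕ → ℕ}

theorem succ_lt (hz : (v L).IsEnd) {x : Vertex} {n : ℕ} (hn : n < L) (hx : v (n + 1) = x)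
    (h : ¬ x.IsEnd) : n + 1 < L := by
  rcases Nat.lt_or_eq_of_le (Nat.succ_le_of_lt hn) with h' | h'
  · exact h'
  · rw [← h', Nat.succ_eq_add_one, hx] at hz
    exact absurd hz h

/-- Apart from `out`, reached directly or through a gap, every way out of `inn` is a trap: `src` and
`psrc` have no other neighbour, and a link entered from `inn` is entered after its edges to the left
side have disappeared. -/
theorem cross (h : Trail K D R L v τ) (hz : (v L).IsEnd) {n c i : ℕ} (hn : n < L)
    (hv : v n = inn c i) : ∃ p, n ≤ p ∧ p + 1 < L ∧ v (p + 1) = out c i ∧ τ n ≤ τ p ∧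
      (τ n = τ p ∨ ∃ a < D, τ n = time K D c a 0 ∧ τ p = time K D c a (width K - 1)) := by
  have h1 := h.adj n hn
  rw [hv] at h1
  rcases adj_inn h1 with h1 | h1 | ⟨a, ha, h1, ht⟩ | ⟨rfl, j, h1⟩ | ⟨i', a, b, rfl, h1, ht⟩ <;>
    have hL := succ_lt hz hn h1 (by simp [IsEnd]) <;> have h2 := h.adj _ hL <;> rw [h1] at h2
  · have := h.inj (n + 1 + 1) n (by omega) (by omega) (by rw [hv, (adj_src h2).1])
    omega
  · exact ⟨n, le_rfl, hL, h1, le_rfl, .inl rfl⟩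
  · rcases adj_gap h2 with h2 | h2
    · have := h.inj (n + 1 + 1) n (by omega) (by omega) (by rw [hv, h2.1])
      omega
    · exact ⟨n + 1, by omega, succ_lt hz hL h2.1 (by simp [IsEnd]), h2.1, (h.lt n hL).le,
        .inr ⟨a, ha, ht, h2.2.2⟩⟩
  · have := h.inj (n + 1 + 1) n (by omega) (by omega) (by rw [hv, adj_psrc h2])
    omega
  · rcases adj_link h2 with h2 | h2
    · have h3 := time_width_le (K := K) (c := 0) h2.2.1
      have h4 := le_time (K := K) (D := D) 1 b 0
      have h5 := h.lt n hL
      omega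
    · have := h.inj (n + 1 + 1) n (by omega) (by omega) (by rw [hv, h2.1])
      omega

/-- Since `inn` and `out` have been visited, a gap leads nowhere. The path ends here or, on the left
side, goes on through a link whose left value belongs to the current time interval. -/
theorem leave (h : Trail K D R L v τ) (hz : (v L).IsEnd) {n p c i : ℕ} (hn : n < p) (hp : p < L)
    (hv : v n = inn c i) (hv' : v p = out c i) :
    v L = snk c i ∨
    (c = 0 ∧ p + 1 < L ∧ ∃ j, ∃ a < D, ∃ b < D, v (p + 1) = link i j a b ∧ R i a j b ∧
      time K D 0 a 0 ≤ τ p ∧ τ p < time K D 0 a (width K)) ∨ (c = 1 ∧ ∃ i', v L = psnk i' i) := by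
  have h1 := h.adj p hp
  rw [hv'] at h1
  have key : p + 1 < L → v (p + 1 + 1) ≠ out c i := fun h2 h3 => by
    have := h.inj (p + 1 + 1) p (by omega) (by omega) (by rw [hv', h3])
    omega
  rcases adj_out h1 with h1 | h1 | ⟨a, h1⟩ | ⟨rfl, j, a, ha, b, hb, h1, hR, ht⟩ | ⟨rfl, i', h1⟩
  · rcases Nat.lt_or_eq_of_le (Nat.succ_le_of_lt hp) with hL | hL
    · have h2 := h.adj _ hL
      rw [Nat.succ_eq_add_one, h1] at h2
      exact absurd (adj_snk h2).1 (key hL)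
    · rw [← hL]
      exact .inl h1
  · have := h.inj (p + 1) n (by omega) (by omega) (by rw [h1, hv])
    omega
  · have hL := succ_lt hz hp h1 (by simp [IsEnd])
    have h2 := h.adj _ hL
    rw [h1] at h2
    rcases adj_gap h2 with h2 | h2
    · have := h.inj (p + 1 + 1) n (by omega) (by omega) (by rw [h2.1, hv])
      omega
    · exact absurd h2.1 (key hL)
  · exact .inr (.inl ⟨rfl, succ_lt hz hp h1 (by simp [IsEnd]), j, a, ha, b, hb, h1, hR, ht⟩)
  · rcases Nat.lt_or_eq_of_le (Nat.succ_le_of_lt hp) with hL | hL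
    · have h2 := h.adj _ hL
      rw [Nat.succ_eq_add_one, h1] at h2
      exact absurd (adj_psnk h2) (key hL)
    · rw [← hL]
      exact .inr (.inr ⟨rfl, i', h1⟩)

theorem sel (h : Trail K D R L v τ) {c i : ℕ} (h0 : v 0 = src c i) (hL : v L = snk c i) :
    ∃ p, 1 ≤ p ∧ p + 1 < L ∧ v 1 = inn c i ∧ τ 0 = c * epoch K D ∧ v (p + 1) = out c i ∧
      τ (p + 1) = c * epoch K D + epoch K D - 1 ∧
      (τ 1 = τ p ∨ ∃ a < D, τ 1 = time K D c a 0 ∧ τ p = time K D c a (width K - 1)) := by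
  have hz : (v L).IsEnd := .inl ⟨c, i, hL⟩
  have hpos : 0 < L := by
    rcases Nat.eq_zero_or_pos L with rfl | h
    · rw [h0] at hL
      simp at hL
    · exact h
  have h1 := h.adj 0 hpos
  rw [h0] at h1
  obtain ⟨h1, h2⟩ := adj_src h1
  obtain ⟨p, hp, hp', h3, -, h4⟩ := h.cross hz (succ_lt hz hpos h1 (by simp [IsEnd])) h1
  -- The vertex before `snk` is `out`; as no vertex is repeated, it is the visit found above, which
  -- dates the departure from `out`.
  have h5 := (h.adj (L - 1) (by omega)).symm
  rw [Nat.sub_add_cancel (by omega), hL] at h5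
  obtain ⟨h5, h6⟩ := adj_snk h5
  have := h.inj (L - 1) (p + 1) (by omega) (by omega) (by rw [h5, h3])
  rw [this] at h6
  exact ⟨p, hp, hp', h1, h2, h3, h6, h4⟩

/-- The link ties the departure from `out` on the left and the arrival at `inn` on the right to the
intervals of two compatible values. Of the remaining crossing times only the order matters. -/
theorem ver (h : Trail K D R L v τ) {i j : ℕ} (h0 : v 0 = psrc i j) (hL : v L = psnk i j) :
    ∃ a < D, ∃ b < D, R i a j b ∧ ∃ p q r, 1 ≤ p ∧ q + 1 < L ∧ r ≤ q ∧ r + 1 < L ∧ p + 1 < L ∧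
      v 1 = inn 0 i ∧ v (p + 1) = out 0 i ∧ τ 0 ≤ τ (p + 1) ∧
      time K D 0 a 0 ≤ τ (p + 1) ∧ τ (p + 1) < time K D 0 a (width K) ∧
      v (r + 1) = inn 1 j ∧ v (q + 1) = out 1 j ∧ τ r ≤ τ (q + 1) ∧
      time K D 1 b 0 ≤ τ r ∧ τ r < time K D 1 b (width K) := by
  have hz : (v L).IsEnd := .inr ⟨i, j, hL⟩
  have hpos : 0 < L := by
    rcases Nat.eq_zero_or_pos L with rfl | h
    · rw [h0] at hL
      simp at hL
    · exact h
  have h1 := h.adj 0 hpos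
  rw [h0] at h1
  replace h1 := adj_psrc h1
  have hL1 := succ_lt hz hpos h1 (by simp [IsEnd])
  obtain ⟨p, hp, hp', h3, ht, -⟩ := h.cross hz hL1 h1
  rcases h.leave hz (by omega) hp' h1 h3 with h4 | ⟨-, hp2, j', a, ha, b, hb, h4, hR, hs, hs'⟩ |
    ⟨h4, -⟩
  · rw [h4] at hL
    simp at hL
  · have h5 := h.adj _ hp2
    rw [h4] at h5
    rcases adj_link h5 with h6 | ⟨h5', -, h6⟩
    · have := h.inj (p + 1 + 1 + 1) (p + 1) (by omega) (by omega) (by rw [h6.1, h3])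
      omega
    have hp3 := succ_lt hz hp2 h5' (by simp [IsEnd])
    obtain ⟨q, hq, hq', h7, ht', -⟩ := h.cross hz hp3 h5'
    rcases h.leave hz (by omega) hq' h5' h7 with h8 | ⟨h8, -⟩ | ⟨-, i', h8⟩
    · rw [h8] at hL
      simp at hL
    · simp at h8
    · rw [h8] at hL
      simp only [psnk.injEq] at hL
      obtain ⟨rfl, rfl⟩ := hL
      have e1 := h.lt 0 hL1
      have e2 := h.lt p hp'
      have e3 := h.lt (p + 1 + 1) hp3
      have e4 := h.lt q hq'
      simp only [zero_add] at e1 ht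
      exact ⟨a, ha, b, hb, hR, p, q, p + 1 + 1, hp, hq', by omega, hp3, hp', h1, h3, by omega, hs, hs',
        h5', h7, by omega, h6.1, h6.2⟩
  · simp at h4

end Trail

end Trail

/-! ### The temporal graph and its paths -/

section Graph

variable (K D : ℕ) (R : ℕ → ℕ → ℕ → ℕ → Prop)

/-- The number of vertices. -/
def card : ℕ := 8 * base K D ^ 4

variable {K D R}

theorem Adj.irrefl {t u : ℕ} : ¬ Adj K D R (num (base K D)) t u u := by
  rw [adj_iff]
  rintro ⟨x, y, hx, hy, h, rfl, h'⟩
  obtain rfl := num_inj hx hy h'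
  rcases h with ⟨c, -, i, -, j, -, a, -, b, -, h⟩ | ⟨c, -, i, -, j, -, a, -, b, -, h⟩ <;>
  · rcases h with ⟨h, h', -⟩ | ⟨h, h', -⟩ | ⟨h, h', -⟩ | ⟨h, h', -⟩ | ⟨h, h'⟩ | ⟨h, h'⟩ |
      ⟨h, h'⟩ | ⟨h, h', -⟩ | ⟨h, h', -⟩ <;>
    · rw [h] at h'
      simp at h'

variable (K D R) in
/-- The temporal graph of the constraint satisfaction problem. -/
def graph : TemporalGraph (Fin (card K D)) where
  lifetime := 2 * epoch K D
  layer t :=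
    { Adj := fun u v => Adj K D R (num (base K D)) t u v
      symm := ⟨fun _ _ h => h.symm⟩
      loopless := ⟨fun _ h => h.irrefl⟩ }

theorem card_pos : 0 < card K D := by
  unfold card base
  positivity

variable (K D) in
/-- A vertex as a vertex of the temporal graph. -/
def node (x : Vertex) : Fin (card K D) := ⟨x.num (base K D) % card K D, Nat.mod_lt _ card_pos⟩

theorem val_node {x : Vertex} (hx : x.Small (base K D)) :
    (node K D x).val = x.num (base K D) :=
  Nat.mod_eq_of_lt (num_lt hx)

theorem node_inj {x y : Vertex} (hx : x.Small (base K D)) (hy : y.Small (base K D))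
    (h : node K D x = node K D y) : x = y :=
  num_inj hx hy (by rw [← val_node hx, ← val_node hy, h])

theorem graph_adj {t : Fin (graph K D R).lifetime} {u v : Fin (card K D)} :
    ((graph K D R).layer t).Adj u v ↔ ∃ x y : Vertex, x.Small (base K D) ∧ y.Small (base K D) ∧
      Adj K D R id t x y ∧ u = node K D x ∧ v = node K D y := by
  refine Iff.trans (adj_iff (t := t)) ?_
  constructor
  · rintro ⟨x, y, hx, hy, h, hu, hv⟩
    exact ⟨x, y, hx, hy, h, Fin.ext (hu.trans (val_node hx).symm),
      Fin.ext (hv.trans (val_node hy).symm)⟩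
  · rintro ⟨x, y, hx, hy, h, rfl, rfl⟩
    exact ⟨x, y, hx, hy, h, val_node hx, val_node hy⟩

/-- The path occupies the vertex `x` at time `t`. -/
def OccupiesAt {s z : Fin (card K D)} (P : (graph K D R).TPath s z) (x : Vertex) (t : ℕ) : Prop :=
  ∃ a b : Fin (graph K D R).lifetime, P.Occupies (node K D x) a b ∧ a.val ≤ t ∧ t ≤ b.val

theorem not_occupiesAt_of_not_intersects {s z s' z' : Fin (card K D)}
    {P : (graph K D R).TPath s z} {Q : (graph K D R).TPath s' z'} (h : ¬ P.Intersects Q)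
    {x : Vertex} {t : ℕ} (h' : OccupiesAt P x t) : ¬ OccupiesAt Q x t := by
  rintro ⟨a₂, b₂, h2, h3, h4⟩
  obtain ⟨a₁, b₁, h5, h6, h7⟩ := h'
  exact h ⟨_, a₁, b₁, a₂, b₂, h5, h2, ⟨t, h4.trans_lt b₂.isLt⟩, ⟨h6, h7⟩, ⟨h3, h4⟩⟩

/-- Numbers that do not name a vertex with small indices are isolated, so a path never meets them.
Only the occupation of inner vertices is recorded, since the endpoints play no role in conflicts
between paths. -/
theorem exists_trail {s z : Vertex} (hs : s.Small (base K D)) (hz : z.Small (base K D))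
    (hsz : s ≠ z) (P : (graph K D R).TPath (node K D s) (node K D z)) :
    ∃ v τ, Trail K D R P.len v τ ∧ v 0 = s ∧ v P.len = z ∧
      ∀ i, i + 1 < P.len → ∀ t, τ i ≤ t → t ≤ τ (i + 1) → OccupiesAt P (v (i + 1)) t := by
  have hpos : 0 < P.len := by
    by_contra h0
    apply hsz
    refine node_inj hs hz (P.vert_zero.symm.trans (Eq.trans ?_ P.vert_last))
    congr 1
    ext
    simp only [Fin.val_zero, Fin.val_last]
    omega
  have hv : ∀ i : Fin (P.len + 1), ∃ x : Vertex, x.Small (base K D) ∧ P.vert i = node K D x := by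
    intro i
    by_cases hi : i.val < P.len
    · obtain ⟨x, y, hx, hy, -, h, -⟩ := graph_adj.1 (P.adj ⟨i, hi⟩)
      exact ⟨x, hx, h⟩
    · have : i = Fin.last P.len := Fin.ext (by simp only [Fin.val_last]; omega)
      exact ⟨z, hz, by rw [this, P.vert_last]⟩
  choose v hv hv' using hv
  let v' : ℕ → Vertex := fun i => if h : i < P.len + 1 then v ⟨i, h⟩ else s
  let τ : ℕ → ℕ := fun i => if h : i < P.len then (P.time ⟨i, h⟩).val else 0
  have ev : ∀ i (h : i < P.len + 1), v' i = v ⟨i, h⟩ := fun i h => dif_pos h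
  have eτ : ∀ i (h : i < P.len), τ i = (P.time ⟨i, h⟩).val := fun i h => dif_pos h
  refine ⟨v', τ, ⟨fun i hi => ?_, fun i hi => ?_, fun i j hi hj h => ?_⟩, ?_, ?_,
    fun i hi t h h' => ?_⟩
  · obtain ⟨x, y, hx, hy, h, h1, h2⟩ := graph_adj.1 (P.adj ⟨i, hi⟩)
    rw [hv'] at h1 h2
    have h1 := node_inj (hv _) hx h1
    have h2 := node_inj (hv _) hy h2
    rw [eτ i hi, ev i (by omega), ev (i + 1) (by omega)]
    rw [← h1, ← h2] at h
    exact h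
  · rw [eτ i (by omega), eτ _ hi]
    exact P.time_strictMono (Fin.mk_lt_mk.2 (Nat.lt_succ_self i))
  · rw [ev i (by omega), ev j (by omega)] at h
    have := P.vert_injective (a₁ := ⟨i, by omega⟩) (a₂ := ⟨j, by omega⟩) (by rw [hv', hv', h])
    exact Fin.mk.inj_iff.1 this
  · apply node_inj (by rw [ev 0 (by omega)]; exact hv _) hs
    rw [ev 0 (by omega), ← hv']
    exact P.vert_zero
  · apply node_inj (by rw [ev _ (by omega)]; exact hv _) hz
    rw [ev _ (by omega), ← hv']
    exact P.vert_last
  · rw [eτ i (by omega)] at h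
    rw [eτ _ hi] at h'
    refine ⟨_, _, ?_, h, h'⟩
    rw [ev _ (by omega), ← hv']
    exact .inner i hi

end Graph

end CSP

theorem TDPInstance.solvable_map_iff {ι : Type} {n : ℕ} {G : TemporalGraph (Fin n)}
    {f : ι → Fin n × Fin n} {l : List ι} (hl : l.Nodup) :
    (TDPInstance.mk n G (l.map f)).Solvable ↔
      ∃ P : ∀ x : ι, x ∈ l → G.TPath (f x).1 (f x).2,
        ∀ x hx y hy, x ≠ y → ¬ (P x hx).Intersects (P y hy) := by
  -- Paths for equal pairs are exchanged by substitution; only `Occupies` is remembered, because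
  -- whether paths intersect depends on nothing else.
  have key : ∀ (p q : Fin n × Fin n) (_ : p = q) (P : G.TPath p.1 p.2),
      ∃ Q : G.TPath q.1 q.2, Q.Occupies = P.Occupies := by
    rintro p _ rfl P
    exact ⟨P, rfl⟩
  constructor
  · rintro ⟨P, hP⟩
    have h1 : ∀ x, x ∈ l → ∃ i : Fin (l.map f).length, ∃ Q : G.TPath (f x).1 (f x).2,
        l[i.val]'(by simpa using i.isLt) = x ∧ Q.Occupies = (P i).Occupies := by
      intro x hx
      obtain ⟨i, hi, h⟩ := List.getElem_of_mem hx
      obtain ⟨Q, hQ⟩ := key _ (f x) (by simp [h]) (P ⟨i, by simpa using hi⟩)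
      exact ⟨⟨i, by simpa using hi⟩, Q, h, hQ⟩
    choose i Q hi hQ using h1
    refine ⟨Q, fun x hx y hy hxy => ?_⟩
    have := hP (i x hx) (i y hy) fun h => hxy (by rw [← hi x hx, ← hi y hy]; simp [h])
    unfold TemporalGraph.TPath.Intersects at this ⊢
    rwa [hQ, hQ]
  · rintro ⟨P, hP⟩
    have h1 : ∀ i : Fin (l.map f).length, ∃ Q : G.TPath (l.map f)[i].1 (l.map f)[i].2,
        Q.Occupies = (P (l[i.val]'(by simpa using i.isLt)) (List.getElem_mem _)).Occupies :=
      fun i => key _ _ (by simp) _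
    choose Q hQ using h1
    refine ⟨Q, fun i j hij => ?_⟩
    have := hP _ (List.getElem_mem (n := i.val) (by simpa using i.isLt)) _
      (List.getElem_mem (n := j.val) (by simpa using j.isLt)) fun h =>
        hij (Fin.ext ((hl.getElem_inj_iff).1 h))
    unfold TemporalGraph.TPath.Intersects at this ⊢
    rwa [hQ, hQ]

/-! ### The paths to be found and the instance -/

namespace CSP

open Vertex

/-- The paths of the temporal graph: a selecting path for every variable, and a verifying path for
every pair of variables. -/
inductive Agent where
  | sel (c i : ℕ)
  | ver (i j : ℕ)

namespace Agent

def source : Agent → Vertex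
  | sel c i => src c i
  | ver i j => psrc i j

def sink : Agent → Vertex
  | sel c i => snk c i
  | ver i j => psnk i j

end Agent

open Agent

def agents (K : ℕ) : List Agent :=
  ((List.range 2).flatMap fun c => (List.range K).flatMap fun i => [sel c i]) ++
    (List.range K).flatMap fun i => (List.range K).flatMap fun j => [ver i j]

theorem sel_mem_agents {K c i : ℕ} : sel c i ∈ agents K ↔ c < 2 ∧ i < K := by
  simp [agents]

theorem ver_mem_agents {K i j : ℕ} : ver i j ∈ agents K ↔ i < K ∧ j < K := by
  simp [agents]

theorem nodup_flatMap_range {α : Type} {n : ℕ} {f : ℕ → List α} (hf : ∀ i, (f i).Nodup)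
    (h : ∀ i j x, x ∈ f i → x ∈ f j → i = j) : ((List.range n).flatMap f).Nodup :=
  List.nodup_flatMap.2 ⟨fun i _ => hf i, List.nodup_range.imp fun hij x hx hx' =>
    hij (h _ _ x hx hx')⟩

theorem nodup_agents (K : ℕ) : (agents K).Nodup := by
  refine List.Nodup.append ?_ ?_ ?_
  · refine nodup_flatMap_range (fun c => nodup_flatMap_range (fun i => List.nodup_singleton _) ?_) ?_
    · simp +contextual
    · rintro c c' x h h'
      simp only [List.mem_flatMap, List.mem_range, List.mem_singleton] at h h'
      obtain ⟨i, -, rfl⟩ := h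
      obtain ⟨j, -, h⟩ := h'
      injection h
  · refine nodup_flatMap_range (fun c => nodup_flatMap_range (fun i => List.nodup_singleton _) ?_) ?_
    · simp +contextual
    · rintro c c' x h h'
      simp only [List.mem_flatMap, List.mem_range, List.mem_singleton] at h h'
      obtain ⟨i, -, rfl⟩ := h
      obtain ⟨j, -, h⟩ := h'
      injection h
  · intro x h h'
    simp only [List.mem_flatMap, List.mem_range, List.mem_singleton] at h h'
    obtain ⟨c, -, i, -, rfl⟩ := h
    obtain ⟨i, -, j, -, h⟩ := h'
    cases h

theorem length_agents (K : ℕ) : (agents K).length = 2 * K + K * K := by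
  simp [agents, List.length_flatMap, two_mul]

/-- The instance of Temporally Disjoint Paths for a constraint satisfaction problem. -/
def tdp (K D : ℕ) (R : ℕ → ℕ → ℕ → ℕ → Prop) : TDPInstance where
  n := card K D
  graph := graph K D R
  pairs := (agents K).map fun x => (node K D x.source, node K D x.sink)

/-- `A 0` and `A 1` are compatible values of the left and of the right variables. -/
def IsSolution (K D : ℕ) (R : ℕ → ℕ → ℕ → ℕ → Prop) (A : ℕ → ℕ → ℕ) : Prop :=
  (∀ c < 2, ∀ i < K, A c i < D) ∧ ∀ i < K, ∀ j < K, R i (A 0 i) j (A 1 j)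

variable {K D : ℕ} {R : ℕ → ℕ → ℕ → ℕ → Prop}

/-! ### Disjoint paths yield a solution -/

section Soundness

/-- Starting and ending its epoch at fixed times, a selecting path blocks `inn` up to `t₁` and `out`
from `t₂` on. Only a detour through a gap leaves a window between these times. -/
theorem occupiesAt_sel {c i : ℕ} (hc : c < 2) (hi : i < K)
    (P : (graph K D R).TPath (node K D (src c i)) (node K D (snk c i))) :
    ∃ t₁ t₂, (∀ t, c * epoch K D ≤ t → t ≤ t₁ → OccupiesAt P (inn c i) t) ∧
      (∀ t, t₂ ≤ t → t ≤ c * epoch K D + epoch K D - 1 → OccupiesAt P (out c i) t) ∧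
      (t₁ = t₂ ∨ ∃ a < D, t₁ = time K D c a 0 ∧ t₂ = time K D c a (width K - 1)) := by
  obtain ⟨v, τ, h, h0, hL, hocc⟩ := exists_trail (by simp only [Vertex.Small, base]; omega)
    (by simp only [Vertex.Small, base]; omega) (by simp) P
  obtain ⟨p, hp, hp', h1, ht, h2, ht', h3⟩ := h.sel h0 hL
  refine ⟨τ 1, τ p, fun t h4 h5 => ?_, fun t h4 h5 => ?_, h3⟩
  · rw [← h1]
    exact hocc 0 (by omega) t (by omega) h5
  · rw [← h2]
    exact hocc p hp' t h4 (by omega)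

theorem occupiesAt_ver {i j : ℕ} (hi : i < K) (hj : j < K)
    (P : (graph K D R).TPath (node K D (psrc i j)) (node K D (psnk i j))) :
    ∃ a < D, ∃ b < D, R i a j b ∧ (∃ s t, s ≤ t ∧ OccupiesAt P (inn 0 i) s ∧
      OccupiesAt P (out 0 i) t ∧ time K D 0 a 0 ≤ t ∧ t < time K D 0 a (width K)) ∧
      ∃ s t, s ≤ t ∧ t < 2 * epoch K D ∧ OccupiesAt P (inn 1 j) s ∧ OccupiesAt P (out 1 j) t ∧
        time K D 1 b 0 ≤ s ∧ s < time K D 1 b (width K) := by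
  obtain ⟨v, τ, h, h0, hL, hocc⟩ := exists_trail (by simp only [Vertex.Small, base]; omega)
    (by simp only [Vertex.Small, base]; omega) (by simp) P
  obtain ⟨a, ha, b, hb, hR, p, q, r, hp, hq, hrq, hr, hp', h1, h2, h3, h4, h5, h6, h7, h8, h9,
    h10⟩ := h.ver h0 hL
  have o1 := hocc p hp' (τ (p + 1)) (h.lt p hp').le le_rfl
  have o2 := hocc q hq (τ (q + 1)) (h.lt q hq).le le_rfl
  have o3 := hocc 0 (by omega) (τ 0) le_rfl (h.lt 0 (by omega)).le
  have o4 := hocc r hr (τ r) le_rfl (h.lt r hr).le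
  rw [h2] at o1
  rw [h7] at o2
  rw [h1] at o3
  rw [h6] at o4
  refine ⟨a, ha, b, hb, hR, ⟨_, _, h3, o3, o1, h4, h5⟩, _, _, h8, ?_, o4, o2, h9, h10⟩
  obtain ⟨_, x, -, -, hx⟩ := o2
  exact hx.trans_lt x.isLt

theorem exists_isSolution (hK : 0 < K) (h : (tdp K D R).Solvable) :
    ∃ A, IsSolution K D R A := by
  obtain ⟨P, hP⟩ := (TDPInstance.solvable_map_iff (nodup_agents K)).1 h
  have hsel : ∀ c i, ∃ t₁ t₂, c < 2 → i < K → ∃ hx,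
      (∀ t, c * epoch K D ≤ t → t ≤ t₁ → OccupiesAt (P (sel c i) hx) (inn c i) t) ∧
      (∀ t, t₂ ≤ t → t ≤ c * epoch K D + epoch K D - 1 →
        OccupiesAt (P (sel c i) hx) (out c i) t) ∧
      (t₁ = t₂ ∨ ∃ a < D, t₁ = time K D c a 0 ∧ t₂ = time K D c a (width K - 1)) := by
    intro c i
    by_cases hci : c < 2 ∧ i < K
    · obtain ⟨t₁, t₂, h⟩ := occupiesAt_sel hci.1 hci.2 (P (sel c i) (sel_mem_agents.2 hci))
      exact ⟨t₁, t₂, fun _ _ => ⟨sel_mem_agents.2 hci, h⟩⟩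
    · exact ⟨0, 0, fun hc hi => absurd ⟨hc, hi⟩ hci⟩
  choose T₁ T₂ hsel using hsel
  -- If something passes within a delay, then at the selected time.
  have key : ∀ c i a s t x, c < 2 → i < K → a < D → x = s ∨ x = t →
      time K D c a 0 ≤ x → x < time K D c a (width K) →
      s ≤ t → T₁ c i < s → t < T₂ c i →
      T₁ c i = time K D c a 0 := by
    intro c i a s t x hc hi ha hx h1 h2 hst hs ht
    obtain ⟨-, -, -, h⟩ := hsel c i hc hi
    -- Without a delay, `T₁ c i < s ≤ t < T₂ c i` is impossible. With a delay for `a'`, the time `x`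
    -- lies in the intervals of both `a` and `a'`.
    rcases h with h | ⟨a', ha', h3, h4⟩
    · omega
    · rw [h3]
      have e := time_add (K := K) (D := D) c a' (width K)
      have e' := time_add (K := K) (D := D) c a' (width K - 1)
      rw [eq_of_time_le (K := K) (D := D) (c := c) (a := a) (a' := a') (t := x) h1 h2 (by omega)
        (by omega)]
  have hver : ∀ i < K, ∀ j < K, ∃ a < D, ∃ b < D, R i a j b ∧ T₁ 0 i = time K D 0 a 0 ∧
      T₁ 1 j = time K D 1 b 0 := by
    intro i hi j hj
    have hx := ver_mem_agents.2 ⟨hi, hj⟩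
    obtain ⟨a, ha, b, hb, hR, ⟨s, t, hst, o1, o2, h1, h2⟩, s', t', hst', ht', o1', o2', h1', h2'⟩ :=
      occupiesAt_ver hi hj (P (ver i j) hx)
    refine ⟨a, ha, b, hb, hR, ?_, ?_⟩
    · obtain ⟨hy, q1, q2, -⟩ := hsel 0 i (by omega) hi
      have hdis := hP _ hy _ hx (by simp)
      -- On the left the link restricts the departure from `out`, on the right the arrival at `inn`.
      refine key 0 i a s t t (by omega) hi ha (.inr rfl) h1 h2 hst ?_ ?_
      · by_contra hs
        exact not_occupiesAt_of_not_intersects hdis (q1 s (by omega) (by omega)) o1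
      · by_contra ht
        have := time_width_le (K := K) (c := 0) ha
        exact not_occupiesAt_of_not_intersects hdis (q2 t (by omega) (by omega)) o2
    · obtain ⟨hy, q1, q2, -⟩ := hsel 1 j (by omega) hj
      have hdis := hP _ hy _ hx (by simp)
      refine key 1 j b s' t' s' (by omega) hj hb (.inl rfl) h1' h2' hst' ?_ ?_
      · by_contra hs
        have := le_time (K := K) (D := D) 1 b 0
        exact not_occupiesAt_of_not_intersects hdis (q1 s' (by omega) (by omega)) o1'
      · by_contra ht
        exact not_occupiesAt_of_not_intersects hdis (q2 t' (by omega) (by omega)) o2'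
  have hinj : ∀ c a a', time K D c a 0 = time K D c a' 0 → a = a' := by
    intro c a a' h
    have h1 := time_add (K := K) (D := D) c a (width K)
    have h2 := time_add (K := K) (D := D) c a' (width K)
    have : 0 < width K := by unfold width; omega
    exact eq_of_time_le (K := K) (D := D) (c := c) le_rfl (by omega) h.symm.le (by omega)
  -- The value of a variable is read off from its verifying path with the variable `0` of the other
  -- side, which exists because `0 < K`.
  have hA : ∀ c i, ∃ a, c < 2 → i < K → a < D ∧ T₁ c i = time K D c a 0 := by
    intro c i
    by_cases hi : i < K
    · rcases Nat.lt_or_ge c 1 with hc | hc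
      · obtain rfl : c = 0 := by omega
        obtain ⟨a, ha, b, hb, -, h1, -⟩ := hver i hi 0 hK
        exact ⟨a, fun _ _ => ⟨ha, h1⟩⟩
      · obtain ⟨a, ha, b, hb, -, -, h1⟩ := hver 0 hK i hi
        refine ⟨b, fun hc _ => ?_⟩
        obtain rfl : c = 1 := by omega
        exact ⟨hb, h1⟩
    · exact ⟨0, fun _ h => absurd h hi⟩
  choose A hA using hA
  refine ⟨A, fun c hc i hi => (hA c i hc hi).1, fun i hi j hj => ?_⟩
  obtain ⟨a, ha, b, hb, hR, h1, h2⟩ := hver i hi j hj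
  rw [hinj 0 (A 0 i) a ((hA 0 i (by omega) hi).2.symm.trans h1),
    hinj 1 (A 1 j) b ((hA 1 j (by omega) hj).2.symm.trans h2)]
  exact hR

end Soundness

/-! ### A solution yields disjoint paths -/

section Completeness

/-- A temporal path from its description with natural numbers. -/
theorem Trail.exists_tPath {L : ℕ} {v : ℕ → Vertex} {τ : ℕ → ℕ} (h : Trail K D R L v τ)
    (hL : 0 < L) (hv : ∀ i ≤ L, (v i).Small (base K D)) (hτ : ∀ i < L, τ i < 2 * epoch K D)
    {s z : Vertex} (hs : v 0 = s) (hz : v L = z) :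
    ∃ P : (graph K D R).TPath (node K D s) (node K D z), ∀ u a b, P.Occupies u a b →
      ∃ x : Vertex, x.Small (base K D) ∧ u = node K D x ∧
        (x = v 0 ∧ a.val = τ 0 ∧ b.val = τ 0 ∨
        x = v L ∧ a.val = τ (L - 1) ∧ b.val = τ (L - 1) ∨
        ∃ i, i + 1 < L ∧ x = v (i + 1) ∧ a.val = τ i ∧ b.val = τ (i + 1)) := by
  subst hs hz
  refine ⟨⟨L, fun i => node K D (v i), fun i => ⟨τ i, hτ i i.isLt⟩, rfl, rfl, fun i => ?_, ?_,
    fun i j hij => ?_⟩, fun u a b hu => ?_⟩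
  · exact graph_adj.2 ⟨v i, v (i + 1), hv _ (by omega), hv _ (by omega), h.adj i i.isLt, rfl, rfl⟩
  · have key : ∀ k i, i + k < L → τ i ≤ τ (i + k) := by
      intro k
      induction k with
      | zero => exact fun _ _ => le_rfl
      | succ k ih => exact fun i hi => (ih i (by omega)).trans (h.lt (i + k) hi).le
    intro i j hij
    change τ i < τ j
    have h1 := j.isLt
    have h2 : i.val < j.val := hij
    have h3 := key (j - (i + 1)) (i + 1) (by omega)
    rw [show i.val + 1 + (j - (i + 1)) = j.val by omega] at h3
    exact (h.lt i (by omega)).trans_le h3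
  · have h1 := node_inj (hv i (by omega)) (hv j (by omega)) hij
    exact Fin.ext (h.inj _ _ (by omega) (by omega) h1)
  · cases hu with
    | first hl => exact ⟨v 0, hv 0 (by omega), rfl, .inl ⟨rfl, rfl, rfl⟩⟩
    | inner i hi => exact ⟨v (i + 1), hv _ hi.le, rfl, .inr (.inr ⟨i, hi, rfl, rfl, rfl⟩)⟩
    | last hl => exact ⟨v L, hv L le_rfl, rfl, .inr (.inl ⟨rfl, rfl, rfl⟩)⟩

variable (K D) in
/-- The vertices and times that the path of an agent occupies, for the solution `A`. -/
def Claims (A : ℕ → ℕ → ℕ) : Agent → Vertex → ℕ → Prop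
  | sel c i, x, t => x = src c i ∨ (x = inn c i ∧ t ≤ time K D c (A c i) 0) ∨
      (∃ a, x = gap c i a) ∨ (x = out c i ∧ time K D c (A c i) (width K - 1) ≤ t) ∨ x = snk c i
  | ver i j, x, t => x = psrc i j ∨
      (x = inn 0 i ∧ time K D 0 (A 0 i) (1 + 3 * j) ≤ t ∧ t ≤ time K D 0 (A 0 i) (2 + 3 * j)) ∨
      (x = out 0 i ∧ time K D 0 (A 0 i) (2 + 3 * j) ≤ t ∧ t ≤ time K D 0 (A 0 i) (3 + 3 * j)) ∨
      (∃ a b, x = link i j a b) ∨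
      (x = inn 1 j ∧ time K D 1 (A 1 j) (1 + 3 * i) ≤ t ∧ t ≤ time K D 1 (A 1 j) (2 + 3 * i)) ∨
      (x = out 1 j ∧ time K D 1 (A 1 j) (2 + 3 * i) ≤ t ∧ t ≤ time K D 1 (A 1 j) (3 + 3 * i)) ∨
      x = psnk i j

/-- The selecting path frees a variable strictly between slots `0` and `3 * K + 1` of its value.
There the verifying paths get three slots each, `1 + 3 * j` to `3 + 3 * j` on the left and likewise
with `i` on the right; this explains the width `3 * K + 2`. All vertices other than `inn` and `out`
belong to one agent. -/
theorem claims_unique {A : ℕ → ℕ → ℕ} {g g' : Agent} {x : Vertex} {t : ℕ}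
    (hg : g ∈ agents K) (hg' : g' ∈ agents K) (h : Claims K D A g x t)
    (h' : Claims K D A g' x t) : g = g' := by
  rcases g with ⟨c, i⟩ | ⟨i, j⟩ <;> rcases g' with ⟨c', i'⟩ | ⟨i', j'⟩
  · rcases h with rfl | ⟨rfl, h⟩ | ⟨a, rfl⟩ | ⟨rfl, h⟩ | rfl <;> simp [Claims] at h' <;> simp [h']
  · rw [ver_mem_agents] at hg'
    rcases h with rfl | ⟨rfl, h⟩ | ⟨a, rfl⟩ | ⟨rfl, h⟩ | rfl <;>
      simp [Claims] at h' <;> rcases h' with ⟨⟨rfl, rfl⟩, h'⟩ | ⟨⟨rfl, rfl⟩, h'⟩ <;>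
      simp only [time, width] at h h' <;> omega
  · rw [ver_mem_agents] at hg
    rcases h' with rfl | ⟨rfl, h'⟩ | ⟨a, rfl⟩ | ⟨rfl, h'⟩ | rfl <;>
      simp [Claims] at h <;> rcases h with ⟨⟨rfl, rfl⟩, h⟩ | ⟨⟨rfl, rfl⟩, h⟩ <;>
      simp only [time, width] at h h' <;> omega
  · rcases h with rfl | ⟨rfl, h⟩ | ⟨rfl, h⟩ | ⟨a, b, rfl⟩ | ⟨rfl, h⟩ | ⟨rfl, h⟩ | rfl <;>
      simp [Claims] at h' <;>
    first
    | (simp [h']; done)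
    | (obtain ⟨rfl, h'⟩ := h'
       simp only [time] at h h'
       simp only [ver.injEq, true_and, and_true]
       omega)

def selVertex (c i a : ℕ) : ℕ → Vertex
  | 0 => src c i
  | 1 => inn c i
  | 2 => gap c i a
  | 3 => out c i
  | _ => snk c i

variable (K D) in
def selTime (c a : ℕ) : ℕ → ℕ
  | 0 => c * epoch K D
  | 1 => time K D c a 0
  | 2 => time K D c a (width K - 1)
  | _ => c * epoch K D + epoch K D - 1

def verVertex (i j a b : ℕ) : ℕ → Vertex
  | 0 => psrc i j
  | 1 => inn 0 i
  | 2 => out 0 i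
  | 3 => link i j a b
  | 4 => inn 1 j
  | 5 => out 1 j
  | _ => psnk i j

variable (K D) in
def verTime (i j a b : ℕ) : ℕ → ℕ
  | 0 => time K D 0 a (1 + 3 * j)
  | 1 => time K D 0 a (2 + 3 * j)
  | 2 => time K D 0 a (3 + 3 * j)
  | 3 => time K D 1 b (1 + 3 * i)
  | 4 => time K D 1 b (2 + 3 * i)
  | _ => time K D 1 b (3 + 3 * i)

theorem trail_sel {c i a : ℕ} (hc : c < 2) (hi : i < K) (ha : a < D) :
    Trail K D R 4 (selVertex c i a) (selTime K D c a) := by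
  refine ⟨fun n hn => ?_, fun n hn => ?_, fun n n' hn hn' h => ?_⟩
  -- The indices that are irrelevant for a selecting path are filled with `i` and `a`.
  · have key : ∀ t x y, EdgeAt K D R id t x y c i i a a → Adj K D R id t x y := fun t x y h =>
      .inl ⟨c, hc, i, hi, i, hi, a, ha, a, ha, h⟩
    interval_cases n <;> apply key <;> simp [EdgeAt, selVertex, selTime]
  · have h1 := time_width_le (K := K) (c := c) ha
    have h2 := le_time (K := K) (D := D) c a 0
    have h3 := time_add (K := K) (D := D) c a (width K)
    have h4 := time_add (K := K) (D := D) c a (width K - 1)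
    have h5 : 2 ≤ width K := by unfold width; omega
    have : n < 3 := by omega
    interval_cases n <;> simp only [selTime] <;> omega
  · interval_cases n <;> interval_cases n' <;> simp [selVertex] at h <;> rfl

theorem trail_ver {i j a b : ℕ} (hi : i < K) (hj : j < K) (ha : a < D) (hb : b < D)
    (hR : R i a j b) : Trail K D R 6 (verVertex i j a b) (verTime K D i j a b) := by
  refine ⟨fun n hn => ?_, fun n hn => ?_, fun n n' hn hn' h => ?_⟩
  · have key : ∀ t x y c k, c < 2 → k < K → EdgeAt K D R id t x y c k j a b ∨
        EdgeAt K D R id t x y c i k a b → Adj K D R id t x y := by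
      rintro t x y c k hc hk (h | h)
      · exact .inl ⟨c, hc, k, hk, j, hj, a, ha, b, hb, h⟩
      · exact .inl ⟨c, hc, i, hi, k, hk, a, ha, b, hb, h⟩
    interval_cases n
    · exact key _ _ _ 0 j (by omega) hj (.inr (by simp [EdgeAt, verVertex]))
    · exact key _ _ _ 0 i (by omega) hi (.inl (by simp [EdgeAt, verVertex]))
    · exact key _ _ _ 0 i (by omega) hi (.inl (by
        simp [EdgeAt, verVertex, verTime, time, width, hR]; omega))
    · exact key _ _ _ 0 i (by omega) hi (.inl (by
        simp [EdgeAt, verVertex, verTime, time, width, hR]; omega))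
    · exact key _ _ _ 1 j (by omega) hj (.inl (by simp [EdgeAt, verVertex]))
    · exact key _ _ _ 0 i (by omega) hi (.inl (by simp [EdgeAt, verVertex]))
  · have h1 := time_width_le (K := K) (c := 0) ha
    have h2 := le_time (K := K) (D := D) 1 b (1 + 3 * i)
    have : n < 5 := by omega
    interval_cases n <;> simp only [verTime, time, width] at * <;> omega
  · interval_cases n <;> interval_cases n' <;> simp [verVertex] at h <;> rfl

theorem exists_tPath_claims {A : ℕ → ℕ → ℕ} (hA : IsSolution K D R A) {g : Agent}
    (hg : g ∈ agents K) : ∃ P : (graph K D R).TPath (node K D g.source) (node K D g.sink),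
      ∀ u a b, P.Occupies u a b → ∃ x : Vertex, x.Small (base K D) ∧ u = node K D x ∧
        ∀ t, a.val ≤ t → t ≤ b.val → Claims K D A g x t := by
  rcases g with ⟨c, i⟩ | ⟨i, j⟩
  · obtain ⟨hc, hi⟩ := sel_mem_agents.1 hg
    have ha := hA.1 c hc i hi
    have hw := time_width_le (K := K) (c := c) ha
    have hw' := time_add (K := K) (D := D) c (A c i) (width K)
    have hw'' := time_add (K := K) (D := D) c (A c i) (width K - 1)
    have hc2 : c * epoch K D ≤ 1 * epoch K D := Nat.mul_le_mul_right _ (by omega)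
    have he : 2 ≤ epoch K D := by unfold epoch; omega
    obtain ⟨P, hP⟩ := (trail_sel hc hi ha).exists_tPath (R := R) (s := src c i) (z := snk c i)
      (by omega) (fun n hn => by
        interval_cases n <;> simp only [selVertex, Vertex.Small, base] <;> omega)
      (fun n hn => by interval_cases n <;> simp only [selTime] <;> omega) rfl rfl
    refine ⟨P, fun u a b hu => ?_⟩
    obtain ⟨x, hx, rfl, h⟩ := hP u a b hu
    refine ⟨x, hx, rfl, fun t h1 h2 => ?_⟩
    rcases h with ⟨rfl, -⟩ | ⟨rfl, -⟩ | ⟨n, hn, rfl, h3, h4⟩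
    · exact .inl rfl
    · exact .inr (.inr (.inr (.inr rfl)))
    · have : n < 3 := by omega
      rw [h3] at h1
      rw [h4] at h2
      interval_cases n
      · exact .inr (.inl ⟨rfl, h2⟩)
      · exact .inr (.inr (.inl ⟨_, rfl⟩))
      · exact .inr (.inr (.inr (.inl ⟨rfl, h1⟩)))
  · obtain ⟨hi, hj⟩ := ver_mem_agents.1 hg
    have ha := hA.1 0 (by omega) i hi
    have hb := hA.1 1 (by omega) j hj
    have hw := time_width_le (K := K) (c := 0) ha
    have hw' := time_width_le (K := K) (c := 1) hb
    obtain ⟨P, hP⟩ := (trail_ver hi hj ha hb (hA.2 i hi j hj)).exists_tPath (R := R)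
      (s := psrc i j) (z := psnk i j) (by omega) (fun n hn => by
        interval_cases n <;> simp only [verVertex, Vertex.Small, base] <;> omega)
      (fun n hn => by
        interval_cases n <;> simp only [verTime, time, width] at * <;> omega) rfl rfl
    refine ⟨P, fun u a b hu => ?_⟩
    obtain ⟨x, hx, rfl, h⟩ := hP u a b hu
    refine ⟨x, hx, rfl, fun t h1 h2 => ?_⟩
    rcases h with ⟨rfl, -⟩ | ⟨rfl, -⟩ | ⟨n, hn, rfl, h3, h4⟩
    · exact .inl rfl
    · exact .inr (.inr (.inr (.inr (.inr (.inr rfl)))))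
    · have : n < 5 := by omega
      rw [h3] at h1
      rw [h4] at h2
      interval_cases n
      · exact .inr (.inl ⟨rfl, h1, h2⟩)
      · exact .inr (.inr (.inl ⟨rfl, h1, h2⟩))
      · exact .inr (.inr (.inr (.inl ⟨_, _, rfl⟩)))
      · exact .inr (.inr (.inr (.inr (.inl ⟨rfl, h1, h2⟩))))
      · exact .inr (.inr (.inr (.inr (.inr (.inl ⟨rfl, h1, h2⟩)))))

theorem solvable_of_isSolution {A : ℕ → ℕ → ℕ} (hA : IsSolution K D R A) :
    (tdp K D R).Solvable := by
  refine (TDPInstance.solvable_map_iff (nodup_agents K)).2 ?_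
  choose P hP using fun g (hg : g ∈ agents K) => exists_tPath_claims hA hg
  refine ⟨P, fun g hg g' hg' hne => ?_⟩
  rintro ⟨u, a₁, b₁, a₂, b₂, h1, h2, t, ⟨h3, h4⟩, h5, h6⟩
  obtain ⟨x, hx, rfl, hc⟩ := hP g hg _ _ _ h1
  obtain ⟨y, hy, hxy, hc'⟩ := hP g' hg' _ _ _ h2
  obtain rfl := node_inj hx hy hxy
  exact hne (claims_unique hg hg' (hc t h3 h4) (hc' t h5 h6))

end Completeness

theorem tdp_solvable_iff (hK : 0 < K) : (tdp K D R).Solvable ↔ ∃ A, IsSolution K D R A :=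
  ⟨exists_isSolution hK, fun ⟨_, hA⟩ => solvable_of_isSolution hA⟩

/-! ### The vertex cover number -/

section VertexCover

/-- Every edge meets some `inn` or `out`, and the edges between `src` and `inn` and between `out`
and `snk` form a matching of the same size. The exact value is needed because the reduction must
output the parameter itself. -/
theorem vertexCoverNum_underlying (hD : 0 < D) :
    (graph K D R).underlying.vertexCoverNum = (4 * K : ℕ) := by
  let I : Finset (ℕ × ℕ × ℕ) := Finset.range 2 ×ˢ Finset.range K ×ˢ Finset.range 2
  have hI : I.card = 4 * K := by
    simp only [I, Finset.card_product, Finset.card_range]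
    ring
  let f : ℕ × ℕ × ℕ → Vertex := fun x => if x.2.2 = 0 then inn x.1 x.2.1 else out x.1 x.2.1
  let g : ℕ × ℕ × ℕ → Vertex := fun x => if x.2.2 = 0 then src x.1 x.2.1 else snk x.1 x.2.1
  have hadj : ∀ u v, (graph K D R).underlying.Adj u v ↔ ∃ t, ((graph K D R).layer t).Adj u v :=
    fun u v => by rw [TemporalGraph.underlying, SimpleGraph.iSup_adj]
  apply le_antisymm
  · have hcover : (graph K D R).underlying.IsVertexCover
        ((I.image fun x => node K D (f x) : Finset (Fin (card K D))) : Set (Fin (card K D))) := by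
      intro u v h
      obtain ⟨t, h⟩ := (hadj u v).1 h
      obtain ⟨x, y, -, -, h', rfl, rfl⟩ := graph_adj.1 h
      have key : ∀ c < 2, ∀ i < K,
          node K D (inn c i) ∈ I.image (fun x => node K D (f x)) ∧
          node K D (out c i) ∈ I.image (fun x => node K D (f x)) := fun c hc i hi =>
        ⟨Finset.mem_image.2 ⟨(c, i, 0), by simp [I, hc, hi], by simp [f]⟩,
          Finset.mem_image.2 ⟨(c, i, 1), by simp [I, hc, hi], by simp [f]⟩⟩
      simp only [Finset.mem_coe]
      rcases h' with ⟨c, hc, i, hi, j, hj, a, ha, b, hb, h'⟩ |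
          ⟨c, hc, i, hi, j, hj, a, ha, b, hb, h'⟩ <;>
      · have k1 := key c hc i hi
        have k2 := key 0 (by omega) i hi
        have k3 := key 1 (by omega) j hj
        rcases h' with ⟨rfl, rfl, -⟩ | ⟨rfl, rfl, -⟩ | ⟨rfl, rfl, -⟩ | ⟨rfl, rfl, -⟩ |
          ⟨rfl, rfl⟩ | ⟨rfl, rfl⟩ | ⟨rfl, rfl⟩ | ⟨rfl, rfl, -⟩ | ⟨rfl, rfl, -⟩ <;>
        simp only [id, k1, k2, k3, true_or, or_true]
    refine hcover.vertexCoverNum_le.trans ?_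
    rw [Set.encard_coe_eq_coe_finsetCard, Nat.cast_le, ← hI]
    exact Finset.card_image_le
  · have hsmall : ∀ x ∈ I, (f x).Small (base K D) ∧ (g x).Small (base K D) := by
      intro x hx
      simp only [I, Finset.mem_product, Finset.mem_range] at hx
      simp only [f, g]
      split_ifs <;> simp only [Vertex.Small, base] <;> omega
    simp only [SimpleGraph.vertexCoverNum, le_iInf_iff]
    intro s hs
    have hmem : ∀ x ∈ I, node K D (f x) ∈ s ∨ node K D (g x) ∈ s := by
      intro x hx
      have hx' := hsmall x hx
      simp only [I, Finset.mem_product, Finset.mem_range] at hx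
      have he : 2 ≤ epoch K D := by unfold epoch; omega
      have hc2 : x.1 * epoch K D ≤ 1 * epoch K D := Nat.mul_le_mul_right _ (by omega)
      have key : ∀ t, t < 2 * epoch K D → Adj K D R id t (f x) (g x) →
          node K D (f x) ∈ s ∨ node K D (g x) ∈ s := fun t ht h =>
        hs ((hadj _ _).2 ⟨⟨t, ht⟩, graph_adj.2 ⟨_, _, hx'.1, hx'.2, h, rfl, rfl⟩⟩)
      by_cases h0 : x.2.2 = 0
      · refine key (x.1 * epoch K D) (by omega) (.inr ⟨x.1, hx.1, x.2.1, hx.2.1, x.2.1, hx.2.1,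
          0, hD, 0, hD, ?_⟩)
        simp [EdgeAt, f, g, h0]
      · refine key (x.1 * epoch K D + epoch K D - 1) (by omega) (.inl ⟨x.1, hx.1, x.2.1, hx.2.1,
          x.2.1, hx.2.1, 0, hD, 0, hD, ?_⟩)
        simp [EdgeAt, f, g, h0]
    classical
    -- Picks an endpoint in the cover for every edge of the matching; disjointness of these edges
    -- makes the choice injective.
    let e : ℕ × ℕ × ℕ → Fin (card K D) := fun x =>
      if node K D (f x) ∈ s then node K D (f x) else node K D (g x)
    have he : Set.InjOn e I := by
      intro x hx y hy hxy
      have h1 := hsmall x hx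
      have h2 := hsmall y hy
      simp only [I, Finset.coe_product, Set.mem_prod, Finset.coe_range, Set.mem_Iio] at hx hy
      have : ∃ x' y', (x' = f x ∨ x' = g x) ∧ (y' = f y ∨ y' = g y) ∧ x' = y' := by
        simp only [e] at hxy
        split_ifs at hxy
        · exact ⟨_, _, .inl rfl, .inl rfl, node_inj h1.1 h2.1 hxy⟩
        · exact ⟨_, _, .inl rfl, .inr rfl, node_inj h1.1 h2.2 hxy⟩
        · exact ⟨_, _, .inr rfl, .inl rfl, node_inj h1.2 h2.1 hxy⟩
        · exact ⟨_, _, .inr rfl, .inr rfl, node_inj h1.2 h2.2 hxy⟩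
      obtain ⟨x', y', hx', hy', h⟩ := this
      obtain ⟨c, i, k⟩ := x
      obtain ⟨c', i', k'⟩ := y
      have hk : c = c' ∧ i = i' ∧ (k = 0 ↔ k' = 0) := by
        simp only [f, g] at hx' hy'
        rcases hx' with rfl | rfl <;> rcases hy' with rfl | rfl <;> split_ifs at h <;>
          simp at h <;> simp [*]
      dsimp only at hx hy
      simp only [Prod.mk.injEq]
      omega
    calc ((4 * K : ℕ) : ℕ∞) = (I : Set (ℕ × ℕ × ℕ)).encard := by
          rw [Set.encard_coe_eq_coe_finsetCard, hI]
      _ = (e '' I).encard := he.encard_image.symm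
      _ ≤ s.encard := Set.encard_le_encard (by
          rintro _ ⟨x, hx, rfl⟩
          simp only [e]
          split_ifs with h
          · exact h
          · exact (hmem x hx).resolve_left h)

theorem param_tdp (hD : 0 < D) : (tdp K D R).param = 2 * K + K * K + 4 * K := by
  have : (tdp K D R).graph.underlying.vertexCoverNum = (4 * K : ℕ) := vertexCoverNum_underlying hD
  unfold TDPInstance.param
  rw [this, ENat.toNat_natCast]
  simp [tdp, length_agents]

end VertexCover

end CSP

/-! ### Three-valued evaluation of circuits -/

namespace Circuit

/-- Partial information on the inputs (`In` holds only for true inputs, `Out` only for false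
inputs) determines that node `j` has value `b`; the first argument bounds the depth. -/
def Det (inp : ℕ) (ty fan : ℕ → ℕ) (ch : ℕ → ℕ → ℕ) (In Out : ℕ → Prop) :
    ℕ → Bool → ℕ → Prop
  | 0, b, j => j < inp ∧ bif b then In j else Out j
  | f + 1, b, j => (j < inp ∧ bif b then In j else Out j) ∨
      (inp ≤ j ∧ ((ty j = 0 ∧ Det inp ty fan ch In Out f (!b) (ch j 0)) ∨
        (ty j = (bif b then 1 else 2) ∧ ∀ r < fan j, Det inp ty fan ch In Out f b (ch j r)) ∨
        (ty j = (bif b then 2 else 1) ∧ ∃ r < fan j, Det inp ty fan ch In Out f b (ch j r))))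

/-- The value of node `j` if every value of a large gate that is not determined is the default
one. -/
def Guess (inp : ℕ) (ty fan : ℕ → ℕ) (ch : ℕ → ℕ → ℕ) (In Out : ℕ → Prop) : ℕ → ℕ → Prop
  | 0, j => j < inp ∧ In j
  | f + 1, j => (j < inp ∧ In j) ∨
      (inp ≤ j ∧ ((ty j = 0 ∧ ¬ Guess inp ty fan ch In Out f (ch j 0)) ∨
        (2 < fan j ∧ ((ty j = 1 ∧ ¬ Det inp ty fan ch In Out (f + 1) false j) ∨
          (ty j = 2 ∧ Det inp ty fan ch In Out (f + 1) true j))) ∨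
        (fan j ≤ 2 ∧ ((ty j = 1 ∧ ∀ r < fan j, Guess inp ty fan ch In Out f (ch j r)) ∨
          (ty j = 2 ∧ ∃ r < fan j, Guess inp ty fan ch In Out f (ch j r))))))

/-- The values, depths and wefts of the nodes of a circuit. -/
structure Model (inp size : ℕ) (ty fan : ℕ → ℕ) (ch : ℕ → ℕ → ℕ) (val : ℕ → Prop)
    (dep wft : ℕ → ℕ) : Prop where
  ty_lt : ∀ j, inp ≤ j → j < size → ty j < 3
  fan_pos : ∀ j, inp ≤ j → j < size → 0 < fan j
  fan_not : ∀ j, inp ≤ j → j < size → ty j = 0 → fan j = 1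
  ch_lt : ∀ j, inp ≤ j → j < size → ∀ r < fan j, ch j r < size
  val_not : ∀ j, inp ≤ j → j < size → ty j = 0 → (val j ↔ ¬ val (ch j 0))
  val_and : ∀ j, inp ≤ j → j < size → ty j = 1 → (val j ↔ ∀ r < fan j, val (ch j r))
  val_or : ∀ j, inp ≤ j → j < size → ty j = 2 → (val j ↔ ∃ r < fan j, val (ch j r))
  dep_lt : ∀ j, inp ≤ j → j < size → ∀ r < fan j, dep (ch j r) < dep j
  wft_le : ∀ j, inp ≤ j → j < size → ∀ r < fan j,
    wft (ch j r) + (if 2 < fan j then 1 else 0) ≤ wft j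

/-! ### Few inputs suffice to evaluate a circuit of weft one -/

namespace Model

variable {inp size : ℕ} {ty fan : ℕ → ℕ} {ch : ℕ → ℕ → ℕ} {val : ℕ → Prop} {dep wft : ℕ → ℕ}
  {In Out : ℕ → Prop}

theorem det_sound (h : Model inp size ty fan ch val dep wft)
    (hIn : ∀ j < inp, In j → val j) (hOut : ∀ j < inp, Out j → ¬ val j) (f : ℕ) :
    ∀ b j, j < size → Det inp ty fan ch In Out f b j → (val j ↔ b = true) := by
  induction f with
  | zero =>
    rintro (_ | _) j - ⟨hj, h'⟩
    · simpa using hOut j hj h'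
    · simpa using hIn j hj h'
  | succ f ih =>
    rintro b j hs (⟨hj, h'⟩ | ⟨hj, ⟨ht, h'⟩ | ⟨ht, h'⟩ | ⟨ht, r, hr, h'⟩⟩)
    · cases b
      · simpa using hOut j hj h'
      · simpa using hIn j hj h'
    · have hf := h.fan_not j hj hs ht
      have := ih _ _ (h.ch_lt j hj hs 0 (by omega)) h'
      rw [h.val_not j hj hs ht, this]
      cases b <;> simp
    · have key : ∀ r < fan j, (val (ch j r) ↔ b = true) := fun r hr =>
        ih _ _ (h.ch_lt j hj hs r hr) (h' r hr)
      have hf := h.fan_pos j hj hs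
      cases b
      · rw [h.val_or j hj hs ht]
        simp only [Bool.false_eq_true, iff_false] at key ⊢
        exact fun ⟨r, hr, h⟩ => key r hr h
      · rw [h.val_and j hj hs ht]
        simp only [iff_true] at key ⊢
        exact key
    · have key := ih _ _ (h.ch_lt j hj hs r hr) h'
      cases b
      · rw [h.val_and j hj hs ht]
        simp only [Bool.false_eq_true, iff_false] at key ⊢
        exact fun h => key (h r hr)
      · rw [h.val_or j hj hs ht]
        simp only [iff_true] at key ⊢
        exact ⟨r, hr, key⟩

/-- `In` and `Out` contain the values of all inputs in `S`. -/
def Covers (val : ℕ → Prop) (In Out : ℕ → Prop) (S : Finset ℕ) : Prop :=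
  ∀ c ∈ S, (val c → In c) ∧ (¬ val c → Out c)

theorem Covers.mono {S S' : Finset ℕ} (h : Covers val In Out S') (hS : S ⊆ S') :
    Covers val In Out S := fun c hc => h c (hS hc)

theorem card_biUnion_range_le {n m : ℕ} {S : ℕ → Finset ℕ} (hn : n ≤ 2)
    (h : ∀ r < n, (S r).card ≤ m) : ((Finset.range n).biUnion S).card ≤ m * 2 := by
  refine Finset.card_biUnion_le.trans ((Finset.sum_le_card_nsmul _ _ m fun r hr =>
    h r (Finset.mem_range.1 hr)).trans ?_)
  rw [Finset.card_range, smul_eq_mul, mul_comm]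
  exact Nat.mul_le_mul_left _ hn

/-- Without large gates the fan-in is at most two, so a node of depth at most `f` has at most `2 ^
f` inputs below it, and their values determine it. -/
theorem exists_det (h : Model inp size ty fan ch val dep wft) (f : ℕ) :
    ∀ j < size, dep j ≤ f → wft j = 0 → ∃ S ⊆ Finset.range inp, S.card ≤ 2 ^ f ∧
      ∀ In Out, Covers val In Out S →
        (val j → Det inp ty fan ch In Out f true j) ∧
        (¬ val j → Det inp ty fan ch In Out f false j) := by
  have hinp : ∀ f j, j < inp → ∃ S ⊆ Finset.range inp, S.card ≤ 2 ^ f ∧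
      ∀ In Out, Covers val In Out S →
        (val j → Det inp ty fan ch In Out f true j) ∧
        (¬ val j → Det inp ty fan ch In Out f false j) := by
    intro f j hj
    refine ⟨{j}, by simpa using hj, by simpa using Nat.one_le_two_pow, fun In Out hS => ?_⟩
    have := hS j (Finset.mem_singleton_self j)
    cases f with
    | zero => exact ⟨fun h => ⟨hj, this.1 h⟩, fun h => ⟨hj, this.2 h⟩⟩
    | succ f => exact ⟨fun h => .inl ⟨hj, this.1 h⟩, fun h => .inl ⟨hj, this.2 h⟩⟩
  induction f with
  | zero =>
    intro j hs hd hw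
    rcases Nat.lt_or_ge j inp with hj | hj
    · exact hinp 0 j hj
    · have := h.dep_lt j hj hs 0 (h.fan_pos j hj hs)
      omega
  | succ f ih =>
    intro j hs hd hw
    rcases Nat.lt_or_ge j inp with hj | hj
    · exact hinp _ j hj
    have hchild : ∀ r, ∃ S ⊆ Finset.range inp, S.card ≤ 2 ^ f ∧ (r < fan j →
        ∀ In Out, Covers val In Out S →
          (val (ch j r) → Det inp ty fan ch In Out f true (ch j r)) ∧
          (¬ val (ch j r) → Det inp ty fan ch In Out f false (ch j r))) := by
      intro r
      by_cases hr : r < fan j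
      · have h1 := h.dep_lt j hj hs r hr
        have h2 := h.wft_le j hj hs r hr
        obtain ⟨S, hS, hc, h3⟩ := ih _ (h.ch_lt j hj hs r hr) (by omega) (by omega)
        exact ⟨S, hS, hc, fun _ => h3⟩
      · exact ⟨∅, by simp, by simp, fun h => absurd h hr⟩
    choose S hS hcard hdet using hchild
    have hfan : fan j ≤ 2 := by
      have := h.wft_le j hj hs 0 (h.fan_pos j hj hs)
      split_ifs at this <;> omega
    refine ⟨(Finset.range (fan j)).biUnion S, Finset.biUnion_subset.2 fun r _ => hS r,
      by rw [pow_succ]; exact card_biUnion_range_le hfan fun r _ => hcard r, fun In Out hc => ?_⟩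
    have key := fun r hr => hdet r hr In Out
      (hc.mono (Finset.subset_biUnion_of_mem S (Finset.mem_range.2 hr)))
    have ht := h.ty_lt j hj hs
    generalize e : ty j = t at ht
    interval_cases t
    · have hf := h.fan_not j hj hs e
      have h0 := key 0 (by omega)
      rw [h.val_not j hj hs e]
      exact ⟨fun hv => .inr ⟨hj, .inl ⟨e, h0.2 hv⟩⟩,
        fun hv => .inr ⟨hj, .inl ⟨e, h0.1 (not_not.1 hv)⟩⟩⟩
    · rw [h.val_and j hj hs e]
      refine ⟨fun hv => .inr ⟨hj, .inr (.inl ⟨e, fun r hr => (key r hr).1 (hv r hr)⟩)⟩,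
        fun hv => ?_⟩
      push Not at hv
      obtain ⟨r, hr, hv⟩ := hv
      exact .inr ⟨hj, .inr (.inr ⟨e, r, hr, (key r hr).2 hv⟩)⟩
    · rw [h.val_or j hj hs e]
      refine ⟨fun ⟨r, hr, hv⟩ => .inr ⟨hj, .inr (.inr ⟨e, r, hr, (key r hr).1 hv⟩)⟩,
        fun hv => ?_⟩
      push Not at hv
      exact .inr ⟨hj, .inr (.inl ⟨e, fun r hr => (key r hr).2 (hv r hr)⟩)⟩

/-- Small gates unite the sets of their children. A large gate with its controlling value needs one
child of that value, which has weft zero; with the other value the empty set is enough, because by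
`det_sound` correct information never overrides a correct default. Quantifying over all correct
information that covers `S` frees `Guess` from knowing `S`. -/
theorem exists_guess (h : Model inp size ty fan ch val dep wft) (f : ℕ) :
    ∀ j < size, dep j ≤ f → wft j ≤ 1 → ∃ S ⊆ Finset.range inp, S.card ≤ 2 ^ f ∧
      ∀ In Out, (∀ j < inp, In j → val j) → (∀ j < inp, Out j → ¬ val j) →
        Covers val In Out S → (Guess inp ty fan ch In Out f j ↔ val j) := by
  have hinp : ∀ f j, j < inp → ∃ S ⊆ Finset.range inp, S.card ≤ 2 ^ f ∧
      ∀ In Out, (∀ j < inp, In j → val j) → (∀ j < inp, Out j → ¬ val j) →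
        Covers val In Out S → (Guess inp ty fan ch In Out f j ↔ val j) := by
    intro f j hj
    refine ⟨{j}, by simpa using hj, by simpa using Nat.one_le_two_pow,
      fun In Out hIn _ hS => ?_⟩
    have h1 := hS j (Finset.mem_singleton_self j)
    have h2 : (j < inp ∧ In j) ↔ val j := ⟨fun h => hIn j hj h.2, fun h => ⟨hj, h1.1 h⟩⟩
    cases f with
    | zero => exact h2
    | succ f =>
      rw [← h2, Guess]
      exact ⟨fun h => h.resolve_right fun h => by omega, .inl⟩
  induction f with
  | zero =>
    intro j hs hd hw
    rcases Nat.lt_or_ge j inp with hj | hj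
    · exact hinp 0 j hj
    · have := h.dep_lt j hj hs 0 (h.fan_pos j hj hs)
      omega
  | succ f ih =>
    intro j hs hd hw
    rcases Nat.lt_or_ge j inp with hj | hj
    · exact hinp _ j hj
    have ht := h.ty_lt j hj hs
    have hnot : ¬ j < inp := by omega
    by_cases hfan : 2 < fan j
    · have hdet : ∀ r < fan j, ∃ S ⊆ Finset.range inp, S.card ≤ 2 ^ f ∧
          ∀ In Out, Covers val In Out S →
            (val (ch j r) → Det inp ty fan ch In Out f true (ch j r)) ∧
            (¬ val (ch j r) → Det inp ty fan ch In Out f false (ch j r)) := fun r hr => by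
        have h1 := h.dep_lt j hj hs r hr
        have h2 := h.wft_le j hj hs r hr
        rw [if_pos hfan] at h2
        exact h.exists_det f _ (h.ch_lt j hj hs r hr) (by omega) (by omega)
      have hpow : 2 ^ f ≤ 2 ^ (f + 1) := Nat.pow_le_pow_right (by omega) (by omega)
      have h0 : ty j ≠ 0 := fun h0 => by
        have := h.fan_not j hj hs h0
        omega
      generalize e : ty j = t at ht h0
      interval_cases t
      · omega
      · have hG : ∀ In Out, Guess inp ty fan ch In Out (f + 1) j ↔
            ¬ Det inp ty fan ch In Out (f + 1) false j := fun In Out => by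
          rw [Guess, e]
          simp [hnot, hj, hfan, not_le.2 hfan]
        by_cases hv : val j
        · refine ⟨∅, by simp, by simp, fun In Out hIn hOut _ => ?_⟩
          rw [hG]
          exact ⟨fun _ => hv, fun _ hd => by
            simpa [hv] using h.det_sound hIn hOut _ _ _ hs hd⟩
        · have hv' := hv
          rw [h.val_and j hj hs e] at hv'
          push Not at hv'
          obtain ⟨r, hr, hv'⟩ := hv'
          obtain ⟨S, hS, hc, hd⟩ := hdet r hr
          refine ⟨S, hS, hc.trans hpow, fun In Out _ _ hcov => ?_⟩
          rw [hG]
          exact ⟨fun hn => absurd (.inr ⟨hj, .inr (.inr ⟨e, r, hr, (hd In Out hcov).2 hv'⟩)⟩) hn,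
            fun h => absurd h hv⟩
      · have hG : ∀ In Out, Guess inp ty fan ch In Out (f + 1) j ↔
            Det inp ty fan ch In Out (f + 1) true j := fun In Out => by
          rw [Guess, e]
          simp [hnot, hj, hfan, not_le.2 hfan]
        by_cases hv : val j
        · have hv' := hv
          rw [h.val_or j hj hs e] at hv'
          obtain ⟨r, hr, hv'⟩ := hv'
          obtain ⟨S, hS, hc, hd⟩ := hdet r hr
          refine ⟨S, hS, hc.trans hpow, fun In Out _ _ hcov => ?_⟩
          rw [hG]
          exact ⟨fun _ => hv, fun _ => .inr ⟨hj, .inr (.inr ⟨e, r, hr, (hd In Out hcov).1 hv'⟩)⟩⟩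
        · refine ⟨∅, by simp, by simp, fun In Out hIn hOut _ => ?_⟩
          rw [hG]
          exact ⟨fun hd => by simpa using h.det_sound hIn hOut _ _ _ hs hd, fun h => absurd h hv⟩
    · have hchild : ∀ r, ∃ S ⊆ Finset.range inp, S.card ≤ 2 ^ f ∧ (r < fan j →
          ∀ In Out, (∀ j < inp, In j → val j) → (∀ j < inp, Out j → ¬ val j) →
            Covers val In Out S → (Guess inp ty fan ch In Out f (ch j r) ↔ val (ch j r))) := by
        intro r
        by_cases hr : r < fan j
        · have h1 := h.dep_lt j hj hs r hr
          have h2 := h.wft_le j hj hs r hr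
          obtain ⟨S, hS, hc, h3⟩ := ih _ (h.ch_lt j hj hs r hr) (by omega) (by omega)
          exact ⟨S, hS, hc, fun _ => h3⟩
        · exact ⟨∅, by simp, by simp, fun h => absurd h hr⟩
      choose S hS hcard hguess using hchild
      refine ⟨(Finset.range (fan j)).biUnion S, Finset.biUnion_subset.2 fun r _ => hS r,
        by rw [pow_succ]; exact card_biUnion_range_le (not_lt.1 hfan) fun r _ => hcard r,
        fun In Out hIn hOut hc => ?_⟩
      have key := fun r hr => hguess r hr In Out hIn hOut
        (hc.mono (Finset.subset_biUnion_of_mem S (Finset.mem_range.2 hr)))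
      generalize e : ty j = t at ht
      interval_cases t
      · have hf := h.fan_not j hj hs e
        rw [h.val_not j hj hs e, ← key 0 (by omega), Guess, e]
        simp [hnot, hj]
      · rw [h.val_and j hj hs e, Guess, e]
        simp only [hnot, hj, hfan, not_lt.1 hfan, false_and, true_and, false_or, or_false,
          one_ne_zero, OfNat.one_ne_ofNat]
        exact forall₂_congr key
      · rw [h.val_or j hj hs e, Guess, e]
        simp only [hnot, hj, hfan, not_lt.1 hfan, false_and, true_and, false_or,
          OfNat.ofNat_ne_zero, OfNat.ofNat_ne_one]
        exact exists_congr fun r => and_congr_right (key r)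

end Model

/-! ### Evaluation of the circuits of the problem -/

/-- Appending does not change earlier entries, and a gate reads only these. So each value computed
from a partial list agrees with the one computed from the final list. -/
theorem foldl_spec {α : Type} (d : α) (init : List α) (step : Gate → (ℕ → α) → α)
    (hstep : ∀ g u v, (∀ j ∈ g.children, u j = v j) → step g u = step g v) (gs : List Gate)
    (hgs : ∀ p (h : p < gs.length), ∀ j ∈ gs[p].children, j < init.length + p) :
    let V := gs.foldl (fun vals g => vals ++ [step g fun j => vals.getD j d]) init
    V.length = init.length + gs.length ∧ (∀ j < init.length, V.getD j d = init.getD j d) ∧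
      ∀ p (h : p < gs.length), V.getD (init.length + p) d = step gs[p] fun j => V.getD j d := by
  induction gs using List.reverseRecOn with
  | nil => simp
  | append_singleton gs g ih =>
    intro V
    have hgs' : ∀ p (h : p < gs.length), ∀ j ∈ gs[p].children, j < init.length + p := by
      intro p h j hj
      refine hgs p (by simp; omega) j ?_
      rwa [List.getElem_append_left h]
    obtain ⟨h1, h2, h3⟩ := ih hgs'
    set W := gs.foldl (fun vals g => vals ++ [step g fun j => vals.getD j d]) init with hW
    have hV : V = W ++ [step g fun j => W.getD j d] := by
      simp only [V, List.foldl_append, List.foldl_cons, List.foldl_nil, ← hW]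
    have hlt : ∀ j < W.length, V.getD j d = W.getD j d := fun j hj => by
      rw [hV, List.getD_append _ _ _ _ hj]
    refine ⟨by simp [hV, h1]; omega, fun j hj => ?_, fun p hp => ?_⟩
    · rw [hlt j (by omega), h2 j hj]
    · rcases Nat.lt_or_eq_of_le (Nat.lt_succ_iff.1 (by simpa using hp)) with h | rfl
      · rw [hlt _ (by omega), h3 p h, List.getElem_append_left h]
        exact hstep _ _ _ fun j hj => (hlt j (by have := hgs' p h j hj; omega)).symm
      · have e : (gs ++ [g])[gs.length] = g := by simp
        have hg := hgs gs.length hp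
        simp only [e] at hg ⊢
        rw [hV, List.getD_append_right _ _ _ _ (by omega), h1, ← hV]
        simp only [Nat.sub_self, List.getD_cons_zero]
        exact hstep _ _ _ fun j hj => (hlt j (by have := hg j hj; omega)).symm

theorem exists_fold (C : Circuit) {α : Type} (d : α) (init : List α) (hinit : init.length = C.inputs)
    (step : Gate → (ℕ → α) → α)
    (hstep : ∀ g u v, (∀ j ∈ g.children, u j = v j) → step g u = step g v) :
    ∃ val : ℕ → α, C.fold d init step = val C.out ∧ (∀ j < C.inputs, val j = init.getD j d) ∧
      ∀ p (h : p < C.gates.length), val (C.inputs + p) = step C.gates[p] val := by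
  obtain ⟨-, h1, h2⟩ := foldl_spec d init step hstep C.gates fun p h j hj => by
    rw [hinit]
    exact (C.valid p h).1 j hj
  rw [hinit] at h1 h2
  exact ⟨_, rfl, h1, h2⟩

end Circuit

namespace Gate

def ty : Gate → ℕ
  | not _ => 0
  | and _ => 1
  | or _ => 2

end Gate

namespace Circuit

variable (C : Circuit)

def gate (j : ℕ) : Gate := C.gates.getD (j - C.inputs) (.not 0)

def ty (j : ℕ) : ℕ := (C.gate j).ty

def fan (j : ℕ) : ℕ := (C.gate j).children.length

def child (j r : ℕ) : ℕ := (C.gate j).children.getD r 0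

theorem le_foldr_max {l : List ℕ} {a : ℕ} (h : a ∈ l) : a ≤ l.foldr max 0 := by
  induction l with
  | nil => simp at h
  | cons b l ih =>
    rcases List.mem_cons.1 h with rfl | h
    · exact le_max_left _ _
    · exact (ih h).trans (le_max_right _ _)

/-- Value, depth and weft are instances of the same fold, so each satisfies its recursion at all
gates, including those that do not contribute to the output. -/
theorem exists_model (x : Fin C.inputs → Bool) :
    ∃ (val : ℕ → Prop) (dep wft : ℕ → ℕ),
      Model C.inputs (C.inputs + C.gates.length) C.ty C.fan C.child val dep wft ∧
      (C.eval x = true ↔ val C.out) ∧ C.depth = dep C.out ∧ C.weft = wft C.out ∧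
      ∀ j (hj : j < C.inputs), val j ↔ x ⟨j, hj⟩ = true := by
  obtain ⟨v, hv, hv0, hv'⟩ := C.exists_fold false (List.ofFn x) (by simp) Gate.eval (by
    rintro (j | l | l) u v h
    · simp only [Gate.eval, h j (by simp [Gate.children])]
    · simp only [Gate.eval]
      rw [Bool.eq_iff_iff, List.all_eq_true, List.all_eq_true]
      exact forall₂_congr fun j hj => by rw [h j hj]
    · simp only [Gate.eval]
      rw [Bool.eq_iff_iff, List.any_eq_true, List.any_eq_true]
      exact exists_congr fun j => and_congr_right fun hj => by rw [h j hj])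
  obtain ⟨dep, hd, -, hd'⟩ := C.exists_fold 0 (List.replicate C.inputs 0) (by simp)
    (fun g v => (g.children.map v).foldr max 0 + 1)
    (fun g u v h => by rw [List.map_congr_left h])
  obtain ⟨wft, hw, -, hw'⟩ := C.exists_fold 0 (List.replicate C.inputs 0) (by simp)
    (fun g v => (g.children.map v).foldr max 0 + if 2 < g.children.length then 1 else 0)
    (fun g u v h => by rw [List.map_congr_left h])
  have hgate : ∀ j, C.inputs ≤ j → j < C.inputs + C.gates.length →
      ∃ p, ∃ h : p < C.gates.length, j = C.inputs + p ∧ C.gate j = C.gates[p] := by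
    intro j hj hj'
    refine ⟨j - C.inputs, by omega, by omega, ?_⟩
    rw [gate, List.getD_eq_getElem _ _ (by omega)]
  have hchild : ∀ j, ∀ r < C.fan j, C.child j r ∈ (C.gate j).children := by
    intro j r hr
    unfold child
    rw [List.getD_eq_getElem _ _ hr]
    exact List.getElem_mem _
  have hchild' : ∀ j c, c ∈ (C.gate j).children ↔ ∃ r < C.fan j, C.child j r = c := by
    intro j c
    refine ⟨fun h => ?_, fun ⟨r, hr, h⟩ => h ▸ hchild j r hr⟩
    obtain ⟨r, hr, h⟩ := List.getElem_of_mem h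
    refine ⟨r, hr, ?_⟩
    unfold child
    rw [List.getD_eq_getElem _ _ hr, h]
  have hval : ∀ j, C.inputs ≤ j → j < C.inputs + C.gates.length → v j = (C.gate j).eval v := by
    intro j hj hj'
    obtain ⟨p, hp, rfl, hg⟩ := hgate j hj hj'
    rw [hv' p hp, hg]
  have hvalid : ∀ j, C.inputs ≤ j → j < C.inputs + C.gates.length → (C.gate j).Valid j := by
    intro j hj hj'
    obtain ⟨p, hp, rfl, hg⟩ := hgate j hj hj'
    rw [hg]
    exact C.valid p hp
  refine ⟨fun j => v j = true, dep, wft, ⟨?_, ?_, ?_, ?_, ?_, ?_, ?_, ?_, ?_⟩,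
    by beta_reduce; rw [← hv]; rfl,
    hd, hw, fun j hj => ?_⟩
  · intro j _ _
    unfold ty Gate.ty
    split <;> omega
  · intro j hj hj'
    have := (hvalid j hj hj').2.2
    unfold fan
    cases h : C.gate j <;> rw [h] at this <;> simp [Gate.children] at this ⊢ <;> omega
  · intro j hj hj' ht
    unfold ty at ht
    unfold fan
    cases h : C.gate j <;> rw [h] at ht <;> simp [Gate.children, Gate.ty] at ht ⊢
  · intro j hj hj' r hr
    have := (hvalid j hj hj').1 _ (hchild j r hr)
    omega
  · intro j hj hj' ht
    rw [hval j hj hj']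
    unfold ty at ht
    unfold child
    cases h : C.gate j <;> rw [h] at ht <;> simp [Gate.children, Gate.ty, Gate.eval] at ht ⊢
  · intro j hj hj' ht
    have hc := hchild' j
    rw [hval j hj hj']
    unfold ty at ht
    cases h : C.gate j <;> rw [h] at ht hc <;> simp [Gate.ty, Gate.children] at ht hc
    rw [Gate.eval, List.all_eq_true]
    exact ⟨fun h r hr => h _ ((hc _).2 ⟨r, hr, rfl⟩), fun h c hc' => by
      obtain ⟨r, hr, rfl⟩ := (hc c).1 hc'
      exact h r hr⟩
  · intro j hj hj' ht
    have hc := hchild' j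
    rw [hval j hj hj']
    unfold ty at ht
    cases h : C.gate j <;> rw [h] at ht hc <;> simp [Gate.ty, Gate.children] at ht hc
    rw [Gate.eval, List.any_eq_true]
    exact ⟨fun ⟨c, hc', h⟩ => by
      obtain ⟨r, hr, rfl⟩ := (hc c).1 hc'
      exact ⟨r, hr, h⟩, fun ⟨r, hr, h⟩ => ⟨_, (hc _).2 ⟨r, hr, rfl⟩, h⟩⟩
  · intro j hj hj' r hr
    have hmem := hchild j r hr
    obtain ⟨p, hp, rfl, hg⟩ := hgate j hj hj'
    rw [hd' p hp, ← hg]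
    exact Nat.lt_succ_iff.2 (le_foldr_max (List.mem_map_of_mem hmem))
  · intro j hj hj' r hr
    have hmem := hchild j r hr
    have hf : C.fan j = (C.gate j).children.length := rfl
    obtain ⟨p, hp, rfl, hg⟩ := hgate j hj hj'
    rw [hw' p hp, ← hg, hf]
    exact Nat.add_le_add_right (le_foldr_max (List.mem_map_of_mem hmem)) _
  · beta_reduce
    rw [hv0 j hj, List.getD_eq_getElem _ _ (by simpa using hj), List.getElem_ofFn]

end Circuit

/-! ### Weighted satisfiability as a binary constraint satisfaction problem -/

namespace CSP

open Finset

/-- The digits of `m` in base `B`. -/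
def digit (B m j : ℕ) : ℕ := m / B ^ j % B

theorem digit_lt {B : ℕ} (hB : 0 < B) (m j : ℕ) : digit B m j < B := Nat.mod_lt _ hB

theorem exists_digit {B : ℕ} (f : ℕ → ℕ) (Q : ℕ) (hf : ∀ j < Q, f j < B) :
    ∃ m < B ^ Q, ∀ j < Q, digit B m j = f j := by
  induction Q generalizing f with
  | zero => exact ⟨0, by simp, by simp⟩
  | succ Q ih =>
    obtain ⟨m, hm, h⟩ := ih (fun j => f (j + 1)) fun j hj => hf (j + 1) (by omega)
    have h0 := hf 0 (by omega)
    refine ⟨f 0 + B * m, ?_, fun j hj => ?_⟩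
    · have : B * (m + 1) ≤ B * B ^ Q := Nat.mul_le_mul_left _ hm
      rw [pow_succ']
      linarith
    · rcases j with _ | j
      · simp [digit, Nat.mod_eq_of_lt h0]
      · rw [← h j (by omega), digit, digit, pow_succ', ← Nat.div_div_eq_div_mul,
          Nat.add_mul_div_left _ _ (by omega), Nat.div_eq_of_lt h0, zero_add]

/-- Some digit of `y` shows that the input `c` is true. -/
def KnownTrue (Q n y c : ℕ) : Prop := ∃ j < Q, digit (n + 2) y j = c + 1

/-- Two consecutive positions show that the input `c` is false. -/
def KnownFalse (Q n k s y c : ℕ) : Prop :=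
  ∃ j < Q, ∃ r < Q, digit (k + 2) s r = digit (k + 2) s j + 1 ∧
    digit (n + 2) y j < c + 1 ∧ c + 1 < digit (n + 2) y r

/-- The digits of `y` can be the values of a strictly increasing sequence from `0` to `n + 1` at
the positions that are the digits of `s`. -/
def ValidPositions (Q n k s y : ℕ) : Prop :=
  ∀ j < Q, (digit (k + 2) s j = 0 → digit (n + 2) y j = 0) ∧
    (digit (k + 2) s j = k + 1 → digit (n + 2) y j = n + 1) ∧
    ∀ r < Q, digit (k + 2) s r = digit (k + 2) s j + 1 →
      digit (n + 2) y j < digit (n + 2) y r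

/-- The left variable `i > 0` is the `i`-th true input, and the right variable `s` lists the true
inputs number `digit s j`.  The left variable `0` is a pair of a right variable and its value. -/
def Rel (Q n k : ℕ) (E : (ℕ → Prop) → (ℕ → Prop) → Prop) (i a s b : ℕ) : Prop :=
  (0 < i ∧ ∀ j < Q, digit (k + 2) s j = i → digit (n + 2) b j = a) ∨
  (i = 0 ∧ ValidPositions Q n k s b ∧
    (a % (k + 2) ^ Q = s → ∀ j < Q,
      digit (n + 2) (a / (k + 2) ^ Q) j = digit (n + 2) b j) ∧
    E (fun c => KnownTrue Q n b c ∨ KnownTrue Q n (a / (k + 2) ^ Q) c)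
      (fun c => KnownFalse Q n k s b c ∨
        KnownFalse Q n k (a % (k + 2) ^ Q) (a / (k + 2) ^ Q) c))

/-- `x 1, …, x k` are the elements of `X` in increasing order, shifted by one. -/
structure Positions (n k : ℕ) (X : Finset ℕ) (x : ℕ → ℕ) : Prop where
  zero : x 0 = 0
  last : x (k + 1) = n + 1
  step : ∀ i ≤ k, x i < x (i + 1)
  mem : ∀ c < n, c ∈ X ↔ ∃ i < k, x (i + 1) = c + 1

/-! ### Increasing enumerations of the true inputs -/

namespace Positions

variable {Q n k : ℕ} {X : Finset ℕ} {x : ℕ → ℕ}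

theorem lt_of_step {x : ℕ → ℕ} (h : ∀ i ≤ k, x i < x (i + 1)) {i j : ℕ} (hij : i < j)
    (hj : j ≤ k + 1) : x i < x j := by
  induction j with
  | zero => omega
  | succ j ih =>
    rcases Nat.lt_succ_iff_lt_or_eq.1 hij with h' | rfl
    · exact (ih h' (by omega)).trans (h j (by omega))
    · exact h i (by omega)

theorem lt (h : Positions n k X x) {i j : ℕ} (hij : i < j) (hj : j ≤ k + 1) : x i < x j :=
  lt_of_step h.step hij hj

theorem lt_iff (h : Positions n k X x) {i j : ℕ} (hi : i ≤ k + 1) (hj : j ≤ k + 1) :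
    x i < x j ↔ i < j := by
  refine ⟨fun h' => ?_, fun h' => h.lt h' hj⟩
  by_contra hij
  rcases Nat.lt_or_eq_of_le (not_lt.1 hij) with h'' | rfl
  · have := h.lt h'' hi
    omega
  · omega

theorem lt_add_two (h : Positions n k X x) {i : ℕ} (hi : i < k + 2) : x i < n + 2 := by
  rcases Nat.lt_or_eq_of_le (Nat.lt_succ_iff.1 hi) with h' | rfl
  · have := h.lt h' le_rfl
    have := h.last
    omega
  · have := h.last
    omega

/-- The shift by one maps the inputs to `1, …, n` and so separates them from the sentinels `0` and
`n + 1`; strict monotonicity makes the `k` inner terms distinct. -/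
theorem of_step {x : ℕ → ℕ} (h0 : x 0 = 0) (h1 : x (k + 1) = n + 1)
    (h : ∀ i ≤ k, x i < x (i + 1)) :
    ∃ X ⊆ range n, X.card = k ∧ Positions n k X x := by
  have hpos : ∀ i < k, 0 < x (i + 1) ∧ x (i + 1) < n + 1 := fun i hi => by
    have := lt_of_step h (show 0 < i + 1 by omega) (by omega)
    have := lt_of_step h (show i + 1 < k + 1 by omega) le_rfl
    omega
  refine ⟨(range k).image fun i => x (i + 1) - 1, fun c hc => ?_, ?_, h0, h1, h, fun c hc => ?_⟩
  · obtain ⟨i, hi, rfl⟩ := mem_image.1 hc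
    have := hpos i (mem_range.1 hi)
    exact mem_range.2 (by omega)
  · rw [card_image_of_injOn, card_range]
    intro i hi j hj hij
    rw [coe_range, Set.mem_Iio] at hi hj
    have := hpos i hi
    have := hpos j hj
    simp only at hij
    by_contra hne
    rcases Nat.lt_or_gt_of_ne hne with h' | h'
    · have := lt_of_step h (Nat.succ_lt_succ h') (by omega)
      simp only [Nat.succ_eq_add_one] at this
      omega
    · have := lt_of_step h (Nat.succ_lt_succ h') (by omega)
      simp only [Nat.succ_eq_add_one] at this
      omega
  · simp only [mem_image, mem_range]
    refine exists_congr fun i => and_congr_right fun hi => ?_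
    have := hpos i hi
    omega

theorem exists_of_card (hX : X ⊆ range n) (hk : X.card = k) : ∃ x, Positions n k X x := by
  have hlt : ∀ i < k, Nat.nth (· ∈ X) i ∈ X := fun i hi =>
    Nat.nth_mem_of_lt_card (p := (· ∈ X)) X.finite_toSet (by simpa [hk] using hi)
  have hmono : ∀ i j, i < j → j < k → Nat.nth (· ∈ X) i < Nat.nth (· ∈ X) j := fun i j hij hj =>
    Nat.nth_lt_nth_of_lt_card (p := (· ∈ X)) X.finite_toSet hij (by simpa [hk] using hj)
  refine ⟨fun i => if i = 0 then 0 else if i ≤ k then Nat.nth (· ∈ X) (i - 1) + 1 else n + 1,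
    by simp, by simp, fun i hi => ?_, fun c hc => ?_⟩
  · rcases i with _ | i
    · simp only [if_true, Nat.add_eq_zero_iff, one_ne_zero, and_false, if_false]
      split_ifs <;> omega
    · rw [if_neg (by omega), if_pos hi, if_neg (by omega)]
      split_ifs with h
      · have := hmono i (i + 1) (by omega) (by omega)
        simpa using this
      · have := mem_range.1 (hX (hlt i (by omega)))
        simpa using this
  · constructor
    · intro h
      obtain ⟨i, hi, h⟩ := Nat.exists_lt_card_finite_nth_eq (p := (· ∈ X)) X.finite_toSet h
      have hi : i < k := by simpa [hk] using hi
      exact ⟨i, hi, by simp [h, Nat.succ_le_iff.2 hi]⟩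
    · rintro ⟨i, hi, h⟩
      rw [if_neg (by omega), if_pos (by omega)] at h
      have := hlt i hi
      simp only [Nat.add_sub_cancel, Nat.add_right_cancel_iff] at h
      rwa [h] at this

theorem mem_of_knownTrue (h : Positions n k X x) {s y c : ℕ}
    (hy : ∀ j < Q, digit (n + 2) y j = x (digit (k + 2) s j)) (hc : c < n)
    (hk : KnownTrue Q n y c) : c ∈ X := by
  obtain ⟨j, hj, hk⟩ := hk
  rw [hy j hj] at hk
  rw [h.mem c hc]
  have := digit_lt (B := k + 2) (by omega) s j
  rcases e : digit (k + 2) s j with _ | i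
  · rw [e, h.zero] at hk
    omega
  · rw [e] at hk this
    refine ⟨i, ?_, hk⟩
    by_contra hi
    obtain rfl : i = k := by omega
    rw [h.last] at hk
    omega

/-- No term lies strictly between two consecutive terms of a strictly increasing sequence. -/
theorem notMem_of_knownFalse (h : Positions n k X x) {s y c : ℕ}
    (hy : ∀ j < Q, digit (n + 2) y j = x (digit (k + 2) s j)) (hc : c < n)
    (hk : KnownFalse Q n k s y c) : c ∉ X := by
  obtain ⟨j, hj, j', hj', h1, h2, h3⟩ := hk
  rw [hy j hj] at h2
  rw [hy j' hj'] at h3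
  rw [h.mem c hc]
  rintro ⟨i, hi, h'⟩
  have hd := digit_lt (B := k + 2) (by omega) s j
  have hd' := digit_lt (B := k + 2) (by omega) s j'
  rw [← h', h.lt_iff (by omega) (by omega)] at h2 h3
  omega

/-- A tuple of positions that determines the membership of the elements of `S`. -/
theorem exists_covering (h : Positions n k X x) {q : ℕ} {S : Finset ℕ} (hS : S ⊆ range n)
    (hq : S.card ≤ q) : ∃ s < (k + 2) ^ (2 * q), ∀ y,
      (∀ j < 2 * q, digit (n + 2) y j = x (digit (k + 2) s j)) → ∀ c ∈ S,
        (c ∈ X → KnownTrue (2 * q) n y c) ∧ (c ∉ X → KnownFalse (2 * q) n k s y c) := by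
  -- Two positions for every input: if it is true, its own position and a dummy; if it is false, the
  -- consecutive positions around it, found by the least `i` with `c + 1 < x i`.
  have hpos : ∀ c, ∃ l < k + 2, ∃ r < k + 2, c < n →
      (c ∈ X → x l = c + 1) ∧ (c ∉ X → r = l + 1 ∧ x l < c + 1 ∧ c + 1 < x r) := by
    intro c
    by_cases hc : c < n
    · by_cases hX : c ∈ X
      · obtain ⟨i, hi, h'⟩ := (h.mem c hc).1 hX
        exact ⟨i + 1, by omega, 0, by omega, fun _ => ⟨fun _ => h', fun hn => absurd hX hn⟩⟩
      · have hex : ∃ i, c + 1 < x i := ⟨k + 1, by rw [h.last]; omega⟩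
        have hf := Nat.find_spec hex
        have hmin : Nat.find hex ≤ k + 1 := Nat.find_le (by rw [h.last]; omega)
        rcases e : Nat.find hex with _ | i
        · rw [e, h.zero] at hf
          omega
        · have hi := Nat.find_min hex (m := i) (by omega)
          rw [e] at hf hmin
          refine ⟨i, by omega, i + 1, by omega, fun _ => ⟨fun h' => absurd h' hX, fun _ =>
            ⟨rfl, ?_, hf⟩⟩⟩
          by_contra hlt
          have hxi : x i = c + 1 := by omega
          rcases i with _ | i
          · rw [h.zero] at hxi
            omega
          · exact hX ((h.mem c hc).2 ⟨i, by omega, hxi⟩)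
    · exact ⟨0, by omega, 0, by omega, fun h => absurd h hc⟩
  choose l hl r hr hlr using hpos
  -- Entries `2 * j` and `2 * j + 1` of the tuple serve element number `j` of `S`; the default `0`
  -- fills the tuple when `S` has fewer than `q` elements.
  let e : ℕ → ℕ := fun j => S.toList.getD j 0
  obtain ⟨s, hs, hd⟩ := exists_digit (B := k + 2)
    (fun j => if j % 2 = 0 then l (e (j / 2)) else r (e (j / 2))) (2 * q) fun j _ => by
      split_ifs
      · exact hl _
      · exact hr _
  refine ⟨s, hs, fun y hy c hc => ?_⟩
  obtain ⟨j, hj, hjc⟩ := List.getElem_of_mem (mem_toList.2 hc)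
  have he : e j = c := by simp only [e, List.getD_eq_getElem _ _ hj, hjc]
  rw [length_toList] at hj
  have h0 := hd (2 * j) (by omega)
  have h1 := hd (2 * j + 1) (by omega)
  rw [if_pos (by omega), Nat.mul_div_cancel_left _ (by omega), he] at h0
  rw [if_neg (by omega), show (2 * j + 1) / 2 = j by omega, he] at h1
  have hy0 := hy (2 * j) (by omega)
  have hy1 := hy (2 * j + 1) (by omega)
  rw [h0] at hy0
  rw [h1] at hy1
  obtain ⟨h2, h3⟩ := hlr c (mem_range.1 (hS hc))
  refine ⟨fun hX => ⟨2 * j, by omega, hy0.trans (h2 hX)⟩, fun hX => ?_⟩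
  obtain ⟨h4, h5, h6⟩ := h3 hX
  exact ⟨2 * j, by omega, 2 * j + 1, by omega, by omega, by omega, by omega⟩

end Positions

/-- The set `S` depends on `X`, so no fixed constraint can refer to it. In a solution, some right
variable covers `S`, and its constraint with the left variable `0` evaluates `E` on sufficient
information. For the converse, the left variable `0` names a covering tuple, so every right variable
sees sufficient information. Agreement with the right variable that it names keeps the left variable
`0` from supplying false information. -/
theorem exists_isSolution_iff {q n k : ℕ} (hq : 0 < q) {E : (ℕ → Prop) → (ℕ → Prop) → Prop}
    {T : Finset ℕ → Prop}
    (hE : ∀ X ⊆ range n, ∃ S ⊆ range n, S.card ≤ q ∧ ∀ In Out : ℕ → Prop,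
      (∀ c < n, In c → c ∈ X) → (∀ c < n, Out c → c ∉ X) →
      (∀ c ∈ S, (c ∈ X → In c) ∧ (c ∉ X → Out c)) → (E In Out ↔ T X)) :
    (∃ A, IsSolution ((k + 2) ^ (2 * q)) ((k + 2) ^ (2 * q) * (n + 2) ^ (2 * q))
      (Rel (2 * q) n k E) A) ↔ ∃ X ⊆ range n, X.card = k ∧ T X := by
  set K := (k + 2) ^ (2 * q) with hK
  have hkK : k + 2 ≤ K := Nat.le_self_pow (by omega) _
  have hnD : n + 2 ≤ (n + 2) ^ (2 * q) := Nat.le_self_pow (by omega) _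
  constructor
  · rintro ⟨A, -, hA⟩
    let x : ℕ → ℕ := fun i => if i = 0 then 0 else A 0 i
    have h0 : ∀ s < K, ValidPositions (2 * q) n k s (A 1 s) := fun s hs =>
      ((hA 0 (by omega) s hs).resolve_left fun h => by simp at h).2.1
    have hx : ∀ s < K, ∀ j < 2 * q,
        digit (n + 2) (A 1 s) j = x (digit (k + 2) s j) := by
      intro s hs j hj
      have hd := digit_lt (B := k + 2) (by omega) s j
      by_cases h : digit (k + 2) s j = 0
      · simp only [x, if_pos h, (h0 s hs j hj).1 h]
      · simp only [x, if_neg h]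
        exact ((hA _ (by omega) s hs).resolve_right fun h' => h h'.1).2 j hj rfl
    -- The conditions on `x` are read off from suitable tuples: a constant one here, and one
    -- containing `i` and `i + 1` for the monotonicity, which needs two entries and hence `0 < q`.
    have hlast : x (k + 1) = n + 1 := by
      obtain ⟨s, hs, hd⟩ := exists_digit (B := k + 2) (fun _ => k + 1) (2 * q)
        fun _ _ => by omega
      have h := (h0 s hs 0 (by omega)).2.1 (hd 0 (by omega))
      rwa [hx s hs 0 (by omega), hd 0 (by omega)] at h
    have hstep : ∀ i ≤ k, x i < x (i + 1) := by
      intro i hi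
      obtain ⟨s, hs, hd⟩ := exists_digit (B := k + 2) (fun j => if j = 0 then i else i + 1) (2 * q)
        fun j _ => by split_ifs <;> omega
      have hd0 := hd 0 (by omega)
      have hd1 := hd 1 (by omega)
      simp only [if_true, one_ne_zero, if_false] at hd0 hd1
      have h := (h0 s hs 0 (by omega)).2.2 1 (by omega) (by rw [hd0, hd1])
      rwa [hx s hs 0 (by omega), hx s hs 1 (by omega), hd0, hd1] at h
    obtain ⟨X, hX, hXk, h⟩ := Positions.of_step (by simp [x]) hlast hstep
    refine ⟨X, hX, hXk, ?_⟩
    obtain ⟨S, hS, hSq, hES⟩ := hE X hX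
    obtain ⟨s, hs, hcov⟩ := h.exists_covering hS hSq
    have hcov := hcov _ (hx s hs)
    have hs' : A 0 0 % K < K := Nat.mod_lt _ (by omega)
    have hx' : ∀ j < 2 * q, digit (n + 2) (A 0 0 / K) j = x (digit (k + 2) (A 0 0 % K) j) := by
      intro j hj
      have := ((hA 0 (by omega) _ hs').resolve_left fun h => by simp at h).2.2.1 rfl j hj
      rw [← hx _ hs' j hj, ← this]
    refine (hES _ _ (fun c hc h' => ?_) (fun c hc h' => ?_) fun c hc => ?_).1
      ((hA 0 (by omega) s hs).resolve_left fun h => by simp at h).2.2.2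
    · exact h'.elim (h.mem_of_knownTrue (hx s hs) hc) (h.mem_of_knownTrue hx' hc)
    · exact h'.elim (h.notMem_of_knownFalse (hx s hs) hc) (h.notMem_of_knownFalse hx' hc)
    · exact ⟨fun h => .inl ((hcov c hc).1 h), fun h => .inl ((hcov c hc).2 h)⟩
  · rintro ⟨X, hX, hXk, hT⟩
    obtain ⟨x, h⟩ := Positions.exists_of_card hX hXk
    have hdig : ∀ s j, digit (k + 2) s j < k + 2 := fun s j => digit_lt (by omega) s j
    have hy : ∀ s, ∃ y < (n + 2) ^ (2 * q), ∀ j < 2 * q,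
        digit (n + 2) y j = x (digit (k + 2) s j) := fun s =>
      exists_digit (fun j => x (digit (k + 2) s j)) _ fun j _ => h.lt_add_two (hdig s j)
    choose y hyD hy using hy
    obtain ⟨S, hS, hSq, hES⟩ := hE X hX
    obtain ⟨s', hs', hcov⟩ := h.exists_covering hS hSq
    have hcov := hcov _ (hy s')
    have hmod : (s' + K * y s') % K = s' := by
      rw [Nat.add_mul_mod_self_left, Nat.mod_eq_of_lt hs']
    have hdiv : (s' + K * y s') / K = y s' := by
      rw [Nat.add_mul_div_left _ _ (by omega), Nat.div_eq_of_lt hs', zero_add]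
    have hle : (n + 2) ^ (2 * q) ≤ K * (n + 2) ^ (2 * q) := Nat.le_mul_of_pos_left _ (by omega)
    -- Left variables from `k + 2` on only pad the left side to `K` variables; no digit refers to
    -- them, so any value will do.
    refine ⟨fun c i => if c = 0 then if i = 0 then s' + K * y s' else if i < k + 2 then x i else 0
      else y i, fun c _ i _ => ?_, fun i hi s hs => ?_⟩
    · simp only
      split_ifs with h1 h2 h3
      · have : K * (y s' + 1) ≤ K * (n + 2) ^ (2 * q) := Nat.mul_le_mul_left _ (hyD s')
        linarith
      · exact (h.lt_add_two h3).trans_le (hnD.trans hle)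
      · omega
      · exact (hyD i).trans_le hle
    · simp only [if_true, one_ne_zero, if_false]
      rcases Nat.eq_zero_or_pos i with rfl | hi'
      · right
        rw [if_pos rfl, ← hK, hmod, hdiv]
        refine ⟨rfl, fun j hj => ?_, ?_, ?_⟩
        · rw [hy s j hj]
          refine ⟨fun e => by rw [e, h.zero], fun e => by rw [e, h.last], fun j' hj' e => ?_⟩
          rw [hy s j' hj', e]
          have := hdig s j'
          exact h.step _ (by omega)
        · rintro rfl j hj
          rfl
        · refine (hES _ _ (fun c hc h' => ?_) (fun c hc h' => ?_) fun c hc => ?_).2 hT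
          · exact h'.elim (h.mem_of_knownTrue (hy s) hc) (h.mem_of_knownTrue (hy s') hc)
          · exact h'.elim (h.notMem_of_knownFalse (hy s) hc) (h.notMem_of_knownFalse (hy s') hc)
          · exact ⟨fun h => .inr ((hcov c hc).1 h), fun h => .inr ((hcov c hc).2 h)⟩
      · refine .inl ⟨hi', fun j hj e => ?_⟩
        rw [if_neg (by omega), hy s j hj, e, if_pos (by have := hdig s j; omega)]

end CSP

namespace Circuit

theorem Model.congr {inp size : ℕ} {ty fan ty' fan' : ℕ → ℕ} {ch ch' : ℕ → ℕ → ℕ} {val : ℕ → Prop}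
    {dep wft : ℕ → ℕ} (h : Model inp size ty fan ch val dep wft)
    (hc : ∀ j, inp ≤ j → j < size → ty' j = ty j ∧ fan' j = fan j ∧
      ∀ r < fan j, ch' j r = ch j r) : Model inp size ty' fan' ch' val dep wft := by
  refine ⟨?_, ?_, ?_, ?_, ?_, ?_, ?_, ?_, ?_⟩ <;> intro j hj hj' <;>
    obtain ⟨h1, h2, h3⟩ := hc j hj hj' <;> simp only [h1, h2]
  · exact h.ty_lt j hj hj'
  · exact h.fan_pos j hj hj'
  · exact h.fan_not j hj hj'
  · intro r hr
    rw [h3 r hr]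
    exact h.ch_lt j hj hj' r hr
  · intro ht
    rw [h3 0 (h.fan_pos j hj hj')]
    exact h.val_not j hj hj' ht
  · intro ht
    rw [h.val_and j hj hj' ht]
    exact forall₂_congr fun r hr => by rw [h3 r hr]
  · intro ht
    rw [h.val_or j hj hj' ht]
    exact exists_congr fun r => and_congr_right fun hr => by rw [h3 r hr]
  · intro r hr
    rw [h3 r hr]
    exact h.dep_lt j hj hj' r hr
  · intro r hr
    rw [h3 r hr]
    exact h.wft_le j hj hj' r hr

open CSP Finset in
-- The tables `ty`, `fan` and `ch` will be read from the code, so agreement with the circuit is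
-- asked only at its gates.
theorem exists_isSolution_iff (C : Circuit) {d k : ℕ} (hw : C.weft ≤ 1) (hd : C.depth ≤ d)
    {ty fan : ℕ → ℕ} {ch : ℕ → ℕ → ℕ}
    (hc : ∀ j, C.inputs ≤ j → j < C.inputs + C.gates.length → ty j = C.ty j ∧ fan j = C.fan j ∧
      ∀ r < C.fan j, ch j r = C.child j r) :
    (∃ A, IsSolution ((k + 2) ^ (2 * 2 ^ d))
      ((k + 2) ^ (2 * 2 ^ d) * (C.inputs + 2) ^ (2 * 2 ^ d))
      (Rel (2 * 2 ^ d) C.inputs k fun In Out => Guess C.inputs ty fan ch In Out d C.out) A) ↔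
    ∃ x : Fin C.inputs → Bool,
      (univ.filter fun i => x i = true).card = k ∧ C.eval x = true := by
  rw [CSP.exists_isSolution_iff (q := 2 ^ d)
    (T := fun X => C.eval (fun i => decide (i.val ∈ X)) = true) (by positivity)]
  · constructor
    · rintro ⟨X, hX, hk, hT⟩
      refine ⟨_, ?_, hT⟩
      rw [← hk, ← card_map Fin.valEmbedding]
      congr 1
      ext c
      simp only [decide_eq_true_eq, mem_map, mem_filter, mem_univ, true_and,
        Fin.valEmbedding_apply]
      exact ⟨fun ⟨i, hi, h⟩ => h ▸ hi, fun h => ⟨⟨c, mem_range.1 (hX h)⟩, h, rfl⟩⟩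
    · rintro ⟨x, hk, hT⟩
      refine ⟨(univ.filter fun i => x i = true).map Fin.valEmbedding, fun c hc => ?_, by simpa, ?_⟩
      · obtain ⟨i, -, rfl⟩ := mem_map.1 hc
        exact mem_range.2 i.isLt
      · have e : (fun i : Fin C.inputs => decide (i.val ∈
            (univ.filter fun i => x i = true).map Fin.valEmbedding)) = x := by
          funext i
          rw [Bool.eq_iff_iff, decide_eq_true_eq]
          simp [Fin.val_inj]
        rw [e]
        exact hT
  · intro X _
    obtain ⟨val, dep, wft, hM, hv, hdep, hwft, hx⟩ :=
      C.exists_model fun i => decide (i.val ∈ X)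
    obtain ⟨S, hS, hSc, h⟩ := (hM.congr hc).exists_guess d C.out C.out_lt (by omega) (by omega)
    simp only [decide_eq_true_eq] at hx
    refine ⟨S, hS, hSc, fun In Out h1 h2 h3 => ?_⟩
    rw [hv]
    refine h In Out (fun j hj h' => (hx j hj).2 (h1 j hj h')) (fun j hj h' => ?_) fun c hcS => ?_
    · rw [hx j hj]
      exact h2 j hj h'
    · rw [hx c (mem_range.1 (hS hcS))]
      exact h3 c hcS

end Circuit

/-! ### Reading the word of a circuit -/

/-- Entry number `i` of a list whose word is given by its cells and its length. -/
def wordEntry (A : ℕ → ℕ) (len i : ℕ) : ℕ :=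
  ∑ p ∈ Finset.range len,
    if A p = 2 ∧ (∑ p' ∈ Finset.range p, if A p' = 1 then 1 else 0) = i then 1 else 0

theorem wordEntry_le (A : ℕ → ℕ) (len i : ℕ) : wordEntry A len i ≤ len := by
  refine (Finset.sum_le_card_nsmul _ _ 1 fun p _ => by split_ifs <;> omega).trans ?_
  simp

theorem wordCell_cons_succ (b : Bool) (w : List Bool) (p : ℕ) :
    wordCell (b :: w) (p + 1) = wordCell w p := by
  simp [wordCell]

/-- The number of letters `false` before a `true` is the index of its entry. A leading `true` thus
increases entry `0`, while a leading `false` shifts all entries. -/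
theorem wordEntry_cons_true (w : List Bool) (i : ℕ) :
    wordEntry (wordCell (true :: w)) (true :: w).length i =
      wordEntry (wordCell w) w.length i + if i = 0 then 1 else 0 := by
  have h0 : wordCell (true :: w) 0 = 2 := rfl
  rw [wordEntry, List.length_cons, Finset.sum_range_succ']
  simp only [Finset.sum_range_succ', wordCell_cons_succ, h0]
  simp [wordEntry, eq_comm]

theorem wordEntry_cons_false (w : List Bool) (i : ℕ) :
    wordEntry (wordCell (false :: w)) (false :: w).length i =
      if i = 0 then 0 else wordEntry (wordCell w) w.length (i - 1) := by
  have h0 : wordCell (false :: w) 0 = 1 := rfl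
  rw [wordEntry, List.length_cons, Finset.sum_range_succ']
  simp only [Finset.sum_range_succ', wordCell_cons_succ, h0]
  rcases i with _ | i
  · simp
  · simp [wordEntry]

theorem wordEntry_unaryWord (l : List ℕ) (i : ℕ) :
    wordEntry (wordCell (unaryWord l)) (unaryWord l).length i = l.getD i 0 := by
  induction l generalizing i with
  | nil => simp [unaryWord, wordEntry]
  | cons a l ih =>
    have key : ∀ (n : ℕ) (w : List Bool) (i : ℕ),
        wordEntry (wordCell (List.replicate n true ++ w)) (List.replicate n true ++ w).length i =
          wordEntry (wordCell w) w.length i + if i = 0 then n else 0 := by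
      intro n w i
      induction n with
      | zero => simp
      | succ n ih =>
        rw [List.replicate_succ, List.cons_append, wordEntry_cons_true, ih]
        split_ifs <;> omega
    have e : unaryWord (a :: l) = List.replicate a true ++ (false :: unaryWord l) := by
      simp [unaryWord]
    rw [e, key, wordEntry_cons_false]
    rcases i with _ | i
    · simp
    · simp [ih]

namespace Circuit

section Parse

variable (L : ℕ → ℕ)

/-- The position of the gate after the one at position `q`. -/
def nextGate (q : ℕ) : ℕ := if L q = 0 then q + 2 else q + 2 + L (q + 1)

/-- The position of gate number `p`. -/
def gatePos (p : ℕ) : ℕ := (nextGate L)^[p] 2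

def readTy (j : ℕ) : ℕ := L (gatePos L (j - L 0))

def readFan (j : ℕ) : ℕ :=
  if L (gatePos L (j - L 0)) = 0 then 1 else L (gatePos L (j - L 0) + 1)

def readChild (j r : ℕ) : ℕ :=
  if L (gatePos L (j - L 0)) = 0 then L (gatePos L (j - L 0) + 1)
  else L (gatePos L (j - L 0) + 2 + r)

end Parse

/-- Gate codes differ in length, so a gate is located by skipping its predecessors; the first two
entries of a code tell how far to skip. -/
theorem drop_gatePos (C : Circuit) {p : ℕ} (hp : p ≤ C.gates.length) :
    C.code.drop (gatePos (fun i => C.code.getD i 0) p) =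
      (C.gates.drop p).flatMap Gate.code := by
  induction p with
  | zero => simp [gatePos, code]
  | succ p ih =>
    have ih := ih (by omega)
    rw [List.drop_eq_getElem_cons (i := p) (by omega), List.flatMap_cons] at ih
    rw [gatePos, Function.iterate_succ_apply', ← gatePos]
    set q := gatePos (fun i => C.code.getD i 0) p
    have hget : ∀ i, C.code.getD (q + i) 0 =
        (C.gates[p].code ++ (C.gates.drop (p + 1)).flatMap Gate.code).getD i 0 := by
      intro i
      rw [← ih, List.getD_eq_getElem?_getD, List.getD_eq_getElem?_getD, List.getElem?_drop]
    have hn : nextGate (fun i => C.code.getD i 0) q = q + C.gates[p].code.length := by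
      have h0 := hget 0
      have h1 := hget 1
      rw [Nat.add_zero] at h0
      simp only [nextGate]
      rw [h0, h1]
      cases C.gates[p] <;> simp [Gate.code] <;> omega
    rw [hn, ← List.drop_drop, ih, List.drop_left]

theorem read_spec (C : Circuit) (j : ℕ) (hj : C.inputs ≤ j)
    (hj' : j < C.inputs + C.gates.length) :
    readTy (fun i => C.code.getD i 0) j = C.ty j ∧
    readFan (fun i => C.code.getD i 0) j = C.fan j ∧
    ∀ r < C.fan j, readChild (fun i => C.code.getD i 0) j r = C.child j r := by
  have hp : j - C.inputs < C.gates.length := by omega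
  have h := C.drop_gatePos hp.le
  rw [List.drop_eq_getElem_cons hp, List.flatMap_cons] at h
  have hL : (fun i => C.code.getD i 0) 0 = C.inputs := rfl
  have hg : C.gate j = C.gates[j - C.inputs] := List.getD_eq_getElem _ _ hp
  unfold readTy readFan readChild ty fan child
  rw [hL, hg]
  set q := gatePos (fun i => C.code.getD i 0) (j - C.inputs)
  have hget : ∀ i, C.code.getD (q + i) 0 =
      (C.gates[j - C.inputs].code ++
        (C.gates.drop (j - C.inputs + 1)).flatMap Gate.code).getD i 0 := by
    intro i
    rw [← h, List.getD_eq_getElem?_getD, List.getD_eq_getElem?_getD, List.getElem?_drop]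
  have h0 := hget 0
  have h1 := hget 1
  rw [Nat.add_zero] at h0
  have h2 : ∀ r, C.code.getD (q + 2 + r) 0 = _ := fun r => by rw [Nat.add_assoc, hget (2 + r)]
  simp only [h0, h1, h2]
  cases C.gates[j - C.inputs] with
  | not j => simp [Gate.code, Gate.ty, Gate.children]
  | and l =>
    simp only [Gate.code, Gate.ty, Gate.children]
    refine ⟨rfl, rfl, fun r hr => ?_⟩
    rw [Nat.add_comm 2 r]
    simp [List.getElem?_append_left hr]
  | or l =>
    simp only [Gate.code, Gate.ty, Gate.children]
    refine ⟨rfl, rfl, fun r hr => ?_⟩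
    rw [Nat.add_comm 2 r]
    simp [List.getElem?_append_left hr]

end Circuit

/-! ### The reduction is computable in polynomial time -/

namespace PolyTime

variable {α β γ δ : Type} [Storable α] [Storable β] [Storable γ] [Storable δ]

theorem comp₂ {F : β → γ → δ} {f : α → β} {g : α → γ} (hF : PolyTime fun p : β × γ => F p.1 p.2)
    (hf : PolyTime f) (hg : PolyTime g) : PolyTime fun x => F (f x) (g x) :=
  hF.comp (hf.pair hg)

theorem wordEntry {A : α → ℕ → ℕ} {len i : α → ℕ} (hA : PolyTime A) (hlen : PolyTime len)
    (hi : PolyTime i) : PolyTime fun x => wordEntry (A x) (len x) (i x) := by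
  unfold _root_.wordEntry
  refine hlen.sum (toNat ((eq (load (hA.comp fst') snd') (const 2)).and
    (eq (sum snd' (toNat (eq (load (hA.comp (fst'.comp fst')) snd') (const 1))))
      (hi.comp fst'))))

/-- The power `B ^ j` need not be polynomially bounded, so the machine divides by `B` repeatedly,
which never increases the value. -/
theorem digit {B m j : α → ℕ} (hB : PolyTime B) (hm : PolyTime m) (hj : PolyTime j) :
    PolyTime fun x => CSP.digit (B x) (m x) (j x) := by
  have e : ∀ B m j : ℕ, m / B ^ j = (fun a => a / B)^[j] m := by
    intro B m j
    induction j with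
    | zero => simp
    | succ j ih => rw [Function.iterate_succ_apply', ← ih, pow_succ, Nat.div_div_eq_div_mul]
  unfold CSP.digit
  refine mod ?_ hB
  simp only [e]
  have hm' := hm
  obtain ⟨⟨c, hc⟩, -⟩ := hm'
  refine iterate (g := fun x a => a / B x) hj hm (div snd' (hB.comp fst')) _ (.base c)
    fun N x hx i _ => ?_
  rw [← e]
  exact (Nat.div_le_self _ _).trans (hc N x hx)

/-! ### Parsing and evaluating circuits in polynomial time -/

section Circuit

open _root_.Circuit

variable {L : α → ℕ → ℕ} {b : ℕ → ℕ}

/-- Each skip advances by at most `b N + 2`, which gives the bound on intermediate values that the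
iteration requires. -/
theorem gatePos (hL : PolyTime fun p : α × ℕ => L p.1 p.2) (hb : PolyBdd b)
    (hLb : ∀ N x, Bdd N x → ∀ i, L x i ≤ b N) {p : α → ℕ} (hp : PolyTime p) :
    PolyTime fun x => gatePos (L x) (p x) := by
  have hp' := hp
  obtain ⟨⟨c, hc⟩, -⟩ := hp'
  have h : PolyTime fun y : α × ℕ => nextGate (L y.1) y.2 := by
    unfold nextGate
    exact ite (hL.eq (const 0)) (by fun_prop)
      ((by fun_prop : PolyTime fun y : α × ℕ => y.2 + 2).add (hL.comp₂ fst' (snd'.add (const 1))))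
  refine iterate (g := fun x => nextGate (L x)) hp (const 2) h
    (fun N => 2 + (N + 2) ^ c * (b N + 2)) ((PolyBdd.const 2).add ((PolyBdd.base c).mul
      (hb.add (.const 2)))) fun N x hx i hi => ?_
  have key : ∀ i, (nextGate (L x))^[i] 2 ≤ 2 + i * (b N + 2) := by
    intro i
    induction i with
    | zero => simp
    | succ i ih =>
      rw [Function.iterate_succ_apply', add_mul, one_mul]
      have := hLb N x hx ((nextGate (L x))^[i] 2 + 1)
      have : ∀ q, nextGate (L x) q ≤ q + 2 + b N := fun q => by
        have := hLb N x hx (q + 1)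
        unfold nextGate
        split_ifs <;> omega
      have := this ((nextGate (L x))^[i] 2)
      omega
  exact (key i).trans (Nat.add_le_add_left (Nat.mul_le_mul_right _ (hi.trans (hc N x hx))) _)

theorem gatePos_sub (hL : PolyTime fun p : α × ℕ => L p.1 p.2) (hb : PolyBdd b)
    (hLb : ∀ N x, Bdd N x → ∀ i, L x i ≤ b N) :
    PolyTime fun p : α × ℕ => Circuit.gatePos (L p.1) (p.2 - L p.1 0) :=
  gatePos (α := α × ℕ) (L := fun p => L p.1) (hL.comp₂ (fst'.comp fst') snd') hb
    (fun N x hx => hLb N x.1 hx.1) (snd'.sub (hL.comp₂ fst' (const 0)))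

theorem readTy (hL : PolyTime fun p : α × ℕ => L p.1 p.2) (hb : PolyBdd b)
    (hLb : ∀ N x, Bdd N x → ∀ i, L x i ≤ b N) :
    PolyTime fun p : α × ℕ => readTy (L p.1) p.2 :=
  hL.comp₂ fst' (gatePos_sub hL hb hLb)

theorem readFan (hL : PolyTime fun p : α × ℕ => L p.1 p.2) (hb : PolyBdd b)
    (hLb : ∀ N x, Bdd N x → ∀ i, L x i ≤ b N) :
    PolyTime fun p : α × ℕ => readFan (L p.1) p.2 := by
  have h := gatePos_sub hL hb hLb
  exact ite ((hL.comp₂ fst' h).eq (const 0)) (const 1) (hL.comp₂ fst' (h.add (const 1)))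

theorem readChild (hL : PolyTime fun p : α × ℕ => L p.1 p.2) (hb : PolyBdd b)
    (hLb : ∀ N x, Bdd N x → ∀ i, L x i ≤ b N) :
    PolyTime fun p : (α × ℕ) × ℕ => readChild (L p.1.1) p.1.2 p.2 := by
  have h := (gatePos_sub hL hb hLb).comp (fst' (α := α × ℕ) (β := ℕ))
  have hL' := fun {f : (α × ℕ) × ℕ → ℕ} (hf : PolyTime f) => hL.comp₂ (fst'.comp fst') hf
  exact ite ((hL' h).eq (const 0)) (hL' (h.add (const 1))) (hL' ((h.add (const 2)).add snd'))

variable {inp : α → ℕ} {ty fan : α → ℕ → ℕ} {ch : α → ℕ → ℕ → ℕ} {In Out : α → ℕ → Prop}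

/-- The depth `f` is a constant here, so the recursion unrolls into a fixed nesting of bounded
quantifiers; only the degree of the polynomial depends on it. -/
theorem det (hinp : PolyTime inp) (hty : PolyTime fun p : α × ℕ => ty p.1 p.2)
    (hfan : PolyTime fun p : α × ℕ => fan p.1 p.2)
    (hch : PolyTime fun p : (α × ℕ) × ℕ => ch p.1.1 p.1.2 p.2)
    (hIn : PolyTime fun p : α × ℕ => In p.1 p.2) (hOut : PolyTime fun p : α × ℕ => Out p.1 p.2)
    (f : ℕ) : ∀ b, PolyTime fun p : α × ℕ =>
      Det (inp p.1) (ty p.1) (fan p.1) (ch p.1) (In p.1) (Out p.1) f b p.2 := by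
  have hbase : ∀ b, PolyTime fun p : α × ℕ =>
      p.2 < inp p.1 ∧ bif b then In p.1 p.2 else Out p.1 p.2 := by
    rintro (_ | _)
    · exact (snd'.lt (hinp.comp fst')).and hOut
    · exact (snd'.lt (hinp.comp fst')).and hIn
  induction f with
  | zero => exact hbase
  | succ f ih =>
    intro b
    have ih' := fun b => (ih b).comp₂ (F := fun x j =>
      Det (inp x) (ty x) (fan x) (ch x) (In x) (Out x) f b j) (fst'.comp fst') hch
    have ih0 := (ih' (!b)).comp (id.pair (const 0))
    simp only [Det]
    exact (hbase b).or (((hinp.comp fst').le snd').and (((hty.eq (const 0)).and ih0).or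
      (((hty.eq (const _)).and (hfan.ball (ih' b))).or
        ((hty.eq (const _)).and (hfan.bex (ih' b))))))

theorem guess (hinp : PolyTime inp) (hty : PolyTime fun p : α × ℕ => ty p.1 p.2)
    (hfan : PolyTime fun p : α × ℕ => fan p.1 p.2)
    (hch : PolyTime fun p : (α × ℕ) × ℕ => ch p.1.1 p.1.2 p.2)
    (hIn : PolyTime fun p : α × ℕ => In p.1 p.2) (hOut : PolyTime fun p : α × ℕ => Out p.1 p.2)
    (f : ℕ) : PolyTime fun p : α × ℕ =>
      Guess (inp p.1) (ty p.1) (fan p.1) (ch p.1) (In p.1) (Out p.1) f p.2 := by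
  have hbase : PolyTime fun p : α × ℕ => p.2 < inp p.1 ∧ In p.1 p.2 :=
    (snd'.lt (hinp.comp fst')).and hIn
  induction f with
  | zero => exact hbase
  | succ f ih =>
    have hd := det hinp hty hfan hch hIn hOut (f + 1)
    have ih' := ih.comp₂ (F := fun x j =>
      Guess (inp x) (ty x) (fan x) (ch x) (In x) (Out x) f j) (fst'.comp fst') hch
    have ih0 := ih'.comp (id.pair (const 0))
    simp only [Guess]
    exact hbase.or (((hinp.comp fst').le snd').and (((hty.eq (const 0)).and ih0.not).or
      ((((const 2).lt hfan).and (((hty.eq (const 1)).and (hd false).not).or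
        ((hty.eq (const 2)).and (hd true)))).or
      ((hfan.le (const 2)).and (((hty.eq (const 1)).and (hfan.ball ih')).or
        ((hty.eq (const 2)).and (hfan.bex ih')))))))

end Circuit

/-! ### Deciding constraints and edges in polynomial time -/

section CSP

open CSP

variable {n k i a s b c y o t u v K D B : α → ℕ}

theorem knownTrue (Q : ℕ) (hn : PolyTime n) (hy : PolyTime y) (hc : PolyTime c) :
    PolyTime fun x => KnownTrue Q (n x) (y x) (c x) :=
  (const Q).bex (eq (digit ((hn.comp fst').add (const 2)) (hy.comp fst') snd')
    ((hc.comp fst').add (const 1)))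

theorem knownFalse (Q : ℕ) (hn : PolyTime n) (hk : PolyTime k) (hs : PolyTime s) (hy : PolyTime y)
    (hc : PolyTime c) : PolyTime fun x => KnownFalse Q (n x) (k x) (s x) (y x) (c x) := by
  have hp : PolyTime fun p : (α × ℕ) × ℕ => p.1.1 := fst'.comp fst'
  have hj : PolyTime fun p : (α × ℕ) × ℕ => p.1.2 := snd'.comp fst'
  have hk' := (hk.comp hp).add (const 2)
  have hn' := (hn.comp hp).add (const 2)
  have hc' := (hc.comp hp).add (const 1)
  exact (const Q).bex ((const Q).bex ((eq (digit hk' (hs.comp hp) snd')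
    ((digit hk' (hs.comp hp) hj).add (const 1))).and
      ((lt (digit hn' (hy.comp hp) hj) hc').and (lt hc' (digit hn' (hy.comp hp) snd')))))

theorem validPositions (Q : ℕ) (hn : PolyTime n) (hk : PolyTime k) (hs : PolyTime s)
    (hy : PolyTime y) : PolyTime fun x => ValidPositions Q (n x) (k x) (s x) (y x) := by
  have hp : PolyTime fun p : (α × ℕ) × ℕ => p.1.1 := fst'.comp fst'
  have hj : PolyTime fun p : (α × ℕ) × ℕ => p.1.2 := snd'.comp fst'
  have hk' := (hk.comp hp).add (const 2)
  have hn' := (hn.comp hp).add (const 2)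
  have hs0 := digit ((hk.comp fst').add (const 2)) (hs.comp fst') snd'
  have hy0 := digit ((hn.comp fst').add (const 2)) (hy.comp fst') snd'
  exact (const Q).ball (((hs0.eq (const 0)).imp (hy0.eq (const 0))).and
    (((hs0.eq ((hk.comp fst').add (const 1))).imp (hy0.eq ((hn.comp fst').add (const 1)))).and
      ((const Q).ball ((eq (digit hk' (hs.comp hp) snd')
        ((digit hk' (hs.comp hp) hj).add (const 1))).imp
          (lt (digit hn' (hy.comp hp) hj) (digit hn' (hy.comp hp) snd'))))))

theorem rel {ty fan : α → ℕ → ℕ} {ch : α → ℕ → ℕ → ℕ} (Q d : ℕ) (hn : PolyTime n)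
    (hty : PolyTime fun p : α × ℕ => ty p.1 p.2) (hfan : PolyTime fun p : α × ℕ => fan p.1 p.2)
    (hch : PolyTime fun p : (α × ℕ) × ℕ => ch p.1.1 p.1.2 p.2) (ho : PolyTime o)
    (hk : PolyTime k) (hi : PolyTime i) (ha : PolyTime a) (hs : PolyTime s) (hb : PolyTime b) :
    PolyTime fun x => Rel Q (n x) (k x)
      (fun In Out => Circuit.Guess (n x) (ty x) (fan x) (ch x) In Out d (o x))
      (i x) (a x) (s x) (b x) := by
  have hK : PolyTime fun x => (k x + 2) ^ Q := (hk.add (const 2)).pow_const Q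
  have hdiv := ha.div hK
  have hmod := ha.mod hK
  have hn' := (hn.comp (fst' (β := ℕ))).add (const 2)
  have hIn := (knownTrue Q (hn.comp fst') (hb.comp fst') snd').or
    (knownTrue Q (hn.comp fst') (hdiv.comp fst') snd')
  have hOut := (knownFalse Q (hn.comp fst') (hk.comp fst') (hs.comp fst') (hb.comp fst') snd').or
    (knownFalse Q (hn.comp fst') (hk.comp fst') (hmod.comp fst') (hdiv.comp fst') snd')
  have hg := (guess (In := fun x c => KnownTrue Q (n x) (b x) c ∨
      KnownTrue Q (n x) (a x / (k x + 2) ^ Q) c)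
    (Out := fun x c => KnownFalse Q (n x) (k x) (s x) (b x) c ∨
      KnownFalse Q (n x) (k x) (a x % (k x + 2) ^ Q) (a x / (k x + 2) ^ Q) c)
    hn hty hfan hch hIn hOut d).comp (id.pair ho)
  have h1 : PolyTime fun x => 0 < i x ∧ ∀ j < Q, CSP.digit (k x + 2) (s x) j = i x →
      CSP.digit (n x + 2) (b x) j = a x :=
    (((const 0).lt hi).and ((const Q).ball ((eq (digit ((hk.comp fst').add (const 2))
    (hs.comp fst') snd') (hi.comp fst')).imp (eq (digit hn' (hb.comp fst') snd')
      (ha.comp fst')))))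
  have h2 : PolyTime fun x => ∀ j < Q, CSP.digit (n x + 2) (a x / (k x + 2) ^ Q) j =
      CSP.digit (n x + 2) (b x) j := (const Q).ball (eq (digit hn' (hdiv.comp fst') snd')
    (digit hn' (hb.comp fst') snd'))
  exact h1.or ((hi.eq (const 0)).and ((validPositions Q hn hk hs hb).and
    (((hmod.eq hs).imp h2).and hg)))

theorem num_edge {R : α → ℕ → ℕ → ℕ → ℕ → Prop} (hK : PolyTime K) (hD : PolyTime D)
    (hB : PolyTime B) (ht : PolyTime t) (hu : PolyTime u) (hv : PolyTime v)
    (hR : PolyTime fun p : (((α × ℕ) × ℕ) × ℕ) × ℕ => R p.1.1.1.1 p.1.1.1.2 p.1.1.2 p.1.2 p.2) :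
    PolyTime fun x => Edge (K x) (D x) (R x) (Vertex.num (B x)) (t x) (u x) (v x) := by
  -- The constraint is replaced by an abstract predicate `P`, so that `fun_prop` does not have to
  -- look into it.
  have key : ∀ {β : Type} [Storable β] {K D B t u v c i j a b : β → ℕ} {P : β → Prop}
      {R : β → ℕ → ℕ → ℕ → ℕ → Prop}, PolyTime K → PolyTime D → PolyTime B → PolyTime t →
      PolyTime u → PolyTime v → PolyTime c → PolyTime i → PolyTime j → PolyTime a → PolyTime b →
      (∀ x, R x (i x) (a x) (j x) (b x) = P x) → PolyTime P →
      PolyTime fun x => EdgeAt (K x) (D x) (R x) (Vertex.num (B x)) (t x) (u x) (v x)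
        (c x) (i x) (j x) (a x) (b x) := by
    intro β _ K D B t u v c i j a b P R hK hD hB ht hu hv hc hi hj ha hb hRP hP
    simp only [EdgeAt, hRP, Vertex.num, pack, time, epoch, width]
    fun_prop
  -- The quantifiers of `Edge` come in the order `c, i, j, a, b`, while `R` takes `i, a, j, b`.
  have hR' := hR.comp (f := fun p : ((((α × ℕ) × ℕ) × ℕ) × ℕ) × ℕ =>
    ((((p.1.1.1.1.1, p.1.1.1.2), p.1.2), p.1.1.2), p.2)) (by fun_prop)
  refine (const 2).bex ((hK.comp fst').bex ((hK.comp (fst'.comp fst')).bex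
    ((hD.comp (fst'.comp (fst'.comp fst'))).bex
      ((hD.comp (fst'.comp (fst'.comp (fst'.comp fst')))).bex ?_))))
  exact key (by fun_prop) (by fun_prop) (by fun_prop) (by fun_prop) (by fun_prop) (by fun_prop)
    (by fun_prop) (by fun_prop) (by fun_prop) (by fun_prop) (by fun_prop) (fun _ => rfl) hR'

end CSP

end PolyTime

/-! ### Writing the word of the instance -/

namespace CSP

variable (K D : ℕ) (R : ℕ → ℕ → ℕ → ℕ → Prop)

-- Only natural numbers and ranges remain, as `Emits.flatMap_range` requires. The remainders modulo
-- `card` stem from `node` and change nothing for vertices with small indices.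
open Classical Vertex in
theorem code_tdp : (tdp K D R).code =
    [card K D] ++ ([2 * epoch K D] ++
      (((List.range (2 * epoch K D)).flatMap fun t => (List.range (card K D)).flatMap fun u =>
        (List.range (card K D)).flatMap fun v =>
          [if Adj K D R (num (base K D)) t u v then 1 else 0]) ++
      (((List.range 2).flatMap fun c => (List.range K).flatMap fun i =>
          [num (base K D) (src c i) % card K D] ++ [num (base K D) (snk c i) % card K D]) ++
        (List.range K).flatMap fun i => (List.range K).flatMap fun j =>
          [num (base K D) (psrc i j) % card K D] ++ [num (base K D) (psnk i j) % card K D]))) := by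
  have key : ∀ (n : ℕ) (f : ℕ → List ℕ),
      ((List.finRange n).flatMap fun i : Fin n => f i.val) = (List.range n).flatMap f := by
    intro n f
    rw [← List.map_coe_finRange_eq_range, List.flatMap_map]
  have e : (tdp K D R).matrices = (List.range (2 * epoch K D)).flatMap fun t =>
      (List.range (card K D)).flatMap fun u => (List.range (card K D)).flatMap fun v =>
          [if Adj K D R (num (base K D)) t u v then 1 else 0] := by
    simp only [← key, ← List.map_eq_flatMap]
    rfl
  rw [TDPInstance.code, e]
  simp only [List.cons_append, List.nil_append, List.append_cancel_left_eq, List.cons.injEq]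
  refine ⟨rfl, rfl, ?_⟩
  simp [tdp, agents, List.flatMap_map, List.flatMap_append, List.flatMap_assoc, node,
    Agent.source, Agent.sink]

end CSP

namespace Emits

open PolyTime CSP Vertex

variable {α : Type} [Storable α] {K D : α → ℕ} {R : α → ℕ → ℕ → ℕ → ℕ → Prop}

theorem pairs_tdp {n : α → ℕ} {x y : ℕ → ℕ → Vertex} (hn : PolyTime n) (hK : PolyTime K)
    (hD : PolyTime D)
    (hx : PolyTime fun p : (ℕ × ℕ) × ℕ => num p.1.1 (x p.1.2 p.2))
    (hy : PolyTime fun p : (ℕ × ℕ) × ℕ => num p.1.1 (y p.1.2 p.2)) :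
    Emits fun a => (List.range (n a)).flatMap fun i => (List.range (K a)).flatMap fun j =>
      [num (base (K a) (D a)) (x i j) % card (K a) (D a)] ++
        [num (base (K a) (D a)) (y i j) % card (K a) (D a)] := by
  have hB : PolyTime fun x => base (K x) (D x) := (hK.add hD).add (const 2)
  have hcard : PolyTime fun x => card (K x) (D x) := (const 8).mul (hB.pow_const 4)
  have hp : PolyTime fun p : (α × ℕ) × ℕ => p.1.1 := fst'.comp fst'
  have h : PolyTime fun p : (α × ℕ) × ℕ => ((base (K p.1.1) (D p.1.1), p.1.2), p.2) :=
    ((hB.comp hp).pair (snd'.comp fst')).pair snd'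
  exact flatMap_range hn (flatMap_range (hK.comp fst')
    ((singleton ((hx.comp h).mod (hcard.comp hp))).append
      (singleton ((hy.comp h).mod (hcard.comp hp)))))

theorem _root_.PolyTime.num_adj (hK : PolyTime K) (hD : PolyTime D)
    (hR : PolyTime fun p : (((α × ℕ) × ℕ) × ℕ) × ℕ => R p.1.1.1.1 p.1.1.1.2 p.1.1.2 p.1.2 p.2) :
    PolyTime fun p : ((α × ℕ) × ℕ) × ℕ => Adj (K p.1.1.1) (D p.1.1.1) (R p.1.1.1)
      (num (base (K p.1.1.1) (D p.1.1.1))) p.1.1.2 p.1.2 p.2 := by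
  have hp : PolyTime fun p : ((α × ℕ) × ℕ) × ℕ => p.1.1.1 := fst'.comp (fst'.comp fst')
  have hK' := hK.comp hp
  have hD' := hD.comp hp
  have hB : PolyTime fun x => base (K x) (D x) := (hK.add hD).add (const 2)
  have hq : PolyTime fun p : ((((((α × ℕ) × ℕ) × ℕ) × ℕ) × ℕ) × ℕ) × ℕ =>
      ((((p.1.1.1.1.1.1.1, p.1.1.1.2), p.1.1.2), p.1.2), p.2) := by fun_prop
  have hR' : PolyTime fun p : ((((((α × ℕ) × ℕ) × ℕ) × ℕ) × ℕ) × ℕ) × ℕ =>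
    R p.1.1.1.1.1.1.1 p.1.1.1.2 p.1.1.2 p.1.2 p.2 := hR.comp hq
  have ht : PolyTime fun p : ((α × ℕ) × ℕ) × ℕ => p.1.1.2 := by fun_prop
  have hu : PolyTime fun p : ((α × ℕ) × ℕ) × ℕ => p.1.2 := by fun_prop
  exact (num_edge (R := fun p => R p.1.1.1) hK' hD' (hB.comp hp) ht hu snd' hR').or
    (num_edge (R := fun p => R p.1.1.1) hK' hD' (hB.comp hp) ht snd' hu hR')

theorem code_tdp (hK : PolyTime K) (hD : PolyTime D)
    (hR : PolyTime fun p : (((α × ℕ) × ℕ) × ℕ) × ℕ => R p.1.1.1.1 p.1.1.1.2 p.1.1.2 p.1.2 p.2) :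
    Emits fun x => (tdp (K x) (D x) (R x)).code := by
  classical
  simp only [CSP.code_tdp]
  have hB : PolyTime fun x => base (K x) (D x) := (hK.add hD).add (const 2)
  have hcard : PolyTime fun x => card (K x) (D x) := (const 8).mul (hB.pow_const 4)
  have hT : PolyTime fun x => 2 * epoch (K x) (D x) := by
    unfold epoch width
    fun_prop
  have hp : PolyTime fun p : (α × ℕ) × ℕ => p.1.1 := fst'.comp fst'
  refine (singleton hcard).append ((singleton hT).append (Emits.append ?_ (Emits.append ?_ ?_)))
  · exact flatMap_range hT (flatMap_range (hcard.comp fst') (flatMap_range (hcard.comp hp)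
      (singleton (num_adj hK hD hR).toNat)))
  · refine pairs_tdp (const 2) hK hD ?_ ?_ <;> simp only [Vertex.num, pack] <;> fun_prop
  · refine pairs_tdp hK hK hD ?_ ?_ <;> simp only [Vertex.num, pack] <;> fun_prop

end Emits

/-! ### The complete reduction -/

namespace Circuit

open CSP

/-- The instance of Temporally Disjoint Paths for a circuit with the code `L` and the weight `k`. -/
def disjointPaths (d : ℕ) (L : ℕ → ℕ) (k : ℕ) : TDPInstance :=
  tdp ((k + 2) ^ (2 * 2 ^ d)) ((k + 2) ^ (2 * 2 ^ d) * (L 0 + 2) ^ (2 * 2 ^ d))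
    (Rel (2 * 2 ^ d) (L 0) k fun In Out =>
      Guess (L 0) (readTy L) (readFan L) (readChild L) In Out d (L 1))

theorem solvable_disjointPaths (C : Circuit) {d k : ℕ} (hw : C.weft ≤ 1) (hd : C.depth ≤ d) :
    (disjointPaths d (fun i => C.code.getD i 0) k).Solvable ↔
      ∃ x : Fin C.inputs → Bool,
        (Finset.univ.filter fun i => x i = true).card = k ∧ C.eval x = true := by
  rw [← C.exists_isSolution_iff hw hd C.read_spec]
  exact tdp_solvable_iff (by positivity)

theorem emits_disjointPaths (d : ℕ) : Emits fun x : ((ℕ → ℕ) × ℕ) × ℕ =>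
    (disjointPaths d (wordEntry x.1.1 x.1.2) x.2).code := by
  have hL : PolyTime fun p : (((ℕ → ℕ) × ℕ) × ℕ) × ℕ => wordEntry p.1.1.1 p.1.1.2 p.2 :=
    .wordEntry (by fun_prop) (by fun_prop) (by fun_prop)
  have hb : ∀ N (x : ((ℕ → ℕ) × ℕ) × ℕ), Bdd N x → ∀ i, wordEntry x.1.1 x.1.2 i ≤ N :=
    fun N x hx i => (wordEntry_le _ _ _).trans hx.1.2
  have hn := hL.comp (PolyTime.id.pair (.const 0))
  have hK : PolyTime fun x : ((ℕ → ℕ) × ℕ) × ℕ => (x.2 + 2) ^ (2 * 2 ^ d) :=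
    .pow_const (by fun_prop) _
  refine .code_tdp hK (hK.mul ((hn.add (.const 2)).pow_const _)) ?_
  have hp : PolyTime fun p : ((((((ℕ → ℕ) × ℕ) × ℕ) × ℕ) × ℕ) × ℕ) × ℕ => p.1.1.1.1 := by fun_prop
  have h1 : PolyTime fun p : (((((((ℕ → ℕ) × ℕ) × ℕ) × ℕ) × ℕ) × ℕ) × ℕ) × ℕ =>
    (p.1.1.1.1.1, p.2) := by fun_prop
  have h2 : PolyTime fun p : ((((((((ℕ → ℕ) × ℕ) × ℕ) × ℕ) × ℕ) × ℕ) × ℕ) × ℕ) × ℕ =>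
    ((p.1.1.1.1.1.1, p.1.2), p.2) := by fun_prop
  exact .rel _ d (hn.comp hp) ((PolyTime.readTy hL .id hb).comp h1)
    ((PolyTime.readFan hL .id hb).comp h1) ((PolyTime.readChild hL .id hb).comp h2)
    ((hL.comp (PolyTime.id.pair (.const 1))).comp hp) (by fun_prop) (by fun_prop) (by fun_prop)
    (by fun_prop) (by fun_prop)

end Circuit

theorem mainTheorem1 : WHard 1 temporallyDisjointPaths := by
  rintro P ⟨d, h⟩
  refine h.trans_emits (fun I => Circuit.disjointPaths d (fun i => I.1.1.code.getD i 0) I.1.2)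
    (fun I => ?_) (Circuit.emits_disjointPaths d)
    -- With `K = (k + 2) ^ (2 * 2 ^ d)`: the number `2 * K + K * K` of paths plus the vertex cover
    -- number `4 * K`.
    (g := fun k => 2 * (k + 2) ^ (2 * 2 ^ d) + (k + 2) ^ (2 * 2 ^ d) * (k + 2) ^ (2 * 2 ^ d) +
      4 * (k + 2) ^ (2 * 2 ^ d)) ?_ (fun I => ?_) fun I => ?_
  · exact (I.1.1.solvable_disjointPaths I.2.1 I.2.2).symm
  · have hK : PolyTime fun k : ℕ => (k + 2) ^ (2 * 2 ^ d) := .pow_const (by fun_prop) _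
    exact (((PolyTime.const 2).mul hK).add (hK.mul hK)).add ((PolyTime.const 4).mul hK)
  · have e : wordEntry (wordCell (unaryWord I.1.1.code)) (unaryWord I.1.1.code).length =
        fun i => I.1.1.code.getD i 0 := funext fun i => wordEntry_unaryWord _ _
    change unaryWord _ = unaryWord (TDPInstance.code (Circuit.disjointPaths d
      (wordEntry (wordCell (unaryWord I.1.1.code)) (unaryWord I.1.1.code).length) I.1.2))
    rw [e]
  · exact CSP.param_tdp (by positivity)
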